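/- **Setting.** A linear system with latent state $x_t\in\mathbb R^{d_x}$ ($d_x\ge1$), input $u_t\in\mathbb R^{d_u}$ and observation $y_t$ in a measurable space $\mathcal Y$ evolves as $x_{t+1}=Ax_t+Bu_t+w_t$, $y_t\sim q(\cdot\mid x_t)$, with $x_0\sim\mathcal N(0,\Sigma_0)$ and i.i.d. $w_t\sim\mathcal N(0,\Sigma_w)$, $\Sigma_w\succ0$, all independent. There is a decoder $f_\star$ with $f_\star(y)=x$ for $q(\cdot\mid x)$-almost every $y$, for every $x$; $\mathcal F$ is a finite class of measurable functions $\mathcal Y\to\mathbb R^{d_x}$ with $f_\star\in\mathcal F$ and $\|f(y)\|\le L\max\{1,\|f_\star(y)\|\}$ for all $y\in\mathcal Y$, $f\in\mathcal F$, where $L\ge1$. Let $\Psi,\alpha\ge1$, $\gamma\in(0,1)$ and $\kappa\in\mathbb N$ be such that: $\mathcal C_{k}=[A^{k-1}B\mid\dots\mid B]$ has rank $d_x$ for some $k\le\kappa$; there is an invertible $T$ with $\|T\|_{\rm op}\|T^{-1}\|_{\rm op}\le\alpha$ and $\|T^{-1}AT\|_{\rm op}\le\gamma$; and $\Psi$ bounds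 the operator norms of $A,B,\Sigma_w,\Sigma_w^{-1},\Sigma_0$. Write $\sigma_{\min}$ for the smallest singular value ($\sigma_{m\wedge n}$ of an $m\times n$ matrix). **Phase I.** For $n\ge1$ put $\kappa_0=\big\lceil(1-\gamma)^{-1}\ln\big(84\Psi^5\alpha^4d_x(1-\gamma)^{-2}\ln(1000n)\big)\big\rceil$ and $\kappa_1=\kappa_0+\kappa$. Draw $2n$ independent trajectories with inputs $u_t\sim\mathcal N(0,I)$ i.i.d., and let $v=(u_{\kappa_0},\dots,u_{\kappa_1-1})\in\mathbb R^{\kappa d_u}$. From the first $n$ trajectories compute (measurably) a minimizer $\hat h$ of $\sum_{i\le n}\|h(y^{(i)}_{\kappa_1})-v^{(i)}\|^2$ over $h\in\{Mf(\cdot):f\in\mathcal F,\ M\in\mathbb R^{\kappa d_u\times d_x},\ \|M\|_{\rm op}\le\sqrt\Psi\}$. Let the columns of $\hat V\in\mathbb R^{\kappa d_u\times d_x}$ be any orthonormal basis of the span of top $d_x$ eigenvectors of $\frac1n\sum_{i=n+1}^{2n}\hat h(y^{(i)}_{\kappa_1})\hat h(y^{(i)}_{\kappa_1})^\top$, and set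 $\hat f_{\rm id}(y)=\hat V^\top\hat h(y)$. For $\beta\geq 0$ say that *Phase I succeeds with error $\beta$* if, with probability at least $1-3\delta$ over the $2n$ trajectories, there is an invertible $S_{\rm id}\in\mathbb R^{d_x\times d_x}$ with $$1\wedge\sigma_{\min}(S_{\rm id})\ge\frac{\sigma_{\min}(\mathcal C_\kappa)(1-\gamma)}{4\Psi^2\alpha^2},\qquad 1\vee\|S_{\rm id}\|_{\rm op}\le\sqrt\Psi,\qquad \mathbb E\|\hat f_{\rm id}(y_{\kappa_1})-S_{\rm id}f_\star(y_{\kappa_1})\|^2\le\beta,$$ where the expectation is over a fresh $y_{\kappa_1}$ only. **Theorem.** There are a universal constant $c\ge8$ and universal polynomials $P,Q$ in six variables such that, in every setting as above and for all $n\ge1$ and $\delta\in(0,1)$, the following holds. Let $c_{\rm conc}=12L^2\Psi^3\alpha^2/(1-\gamma)$ and $$\varepsilon_h^2=c\,\frac{\ln^2(n/\delta)\,(d_u\kappa+d_xc_{\rm conc})\,(\ln|\mathcal F|+d_ud_x\kappa)}{n}.$$ 1. If $\varepsilon_h\sqrt{d_xc_{\rm conc}}\le\dfrac{(1-\gamma)\,\sigma_{\min}(\mathcal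 C_\kappa)^2}{71\,\alpha^2\Psi^2}$, then Phase I succeeds with error $\varepsilon_h^2$. 2. Let $C_1,C_2$ be the values of $P,Q$ at $(\alpha,\gamma^{-1},(1-\gamma)^{-1},\Psi,L,\sigma_{\min}(\mathcal C_\kappa)^{-1})$. If $n\ge C_1\,d_xd_u\kappa(\ln|\mathcal F|+d_ud_x\kappa)$, then Phase I succeeds with error $$C_2\,\frac{d_u\kappa(\ln|\mathcal F|+d_ud_x\kappa)\ln^2(n/\delta)}{n},$$ and it also succeeds with error $$C_2\,\frac{d_u\kappa(\ln|\mathcal F|+d_ud_x\kappa)\ln^3(n/\delta)}{n}.$$ -/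

import Mathlib

open MeasureTheory ProbabilityTheory
open scoped Matrix ENNReal Matrix.Norms.L2Operator

noncomputable section

namespace RichLQR

/-- `ℝ^d` with the Euclidean norm. -/
abbrev Vec (d : ℕ) : Type := EuclideanSpace ℝ (Fin d)

/-- `ℝ^{k d}`, the space of stacked input sequences `(u₁, …, u_k)` with `u_j ∈ ℝ^d`;
the coordinate `(j, b)` is the `b`-th entry of the `j`-th input. -/
abbrev Stack (k d : ℕ) : Type := EuclideanSpace ℝ (Fin k × Fin d)

/-- The smallest singular value `σ_{m ∧ n}(M)` of an `m × n` matrix (Mathlib's singular values are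
sorted in decreasing order and indexed from `0`). -/
def sigmaMin {m n : Type} [Fintype m] [Fintype n] [DecidableEq n] (M : Matrix m n ℝ) : ℝ :=
  (Matrix.toEuclideanLin M).singularValues (min (Fintype.card m) (Fintype.card n) - 1)

/-- The data of a linear system with rich observations:
`x_{t+1} = A x_t + B u_t + w_t`, `y_t ∼ q(· ∣ x_t)`, `x_0 ∼ N(0, Σ₀)`, `w_t ∼ N(0, Σ_w)` i.i.d. -/
structure System (dx du : ℕ) (Y : Type*) [MeasurableSpace Y] where
  A : Matrix (Fin dx) (Fin dx) ℝ
  B : Matrix (Fin dx) (Fin du) ℝ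
  Sigma0 : Matrix (Fin dx) (Fin dx) ℝ
  SigmaW : Matrix (Fin dx) (Fin dx) ℝ
  q : Kernel (Vec dx) Y

/-- The controllability matrix `C_k = [A^{k-1} B ∣ ⋯ ∣ A B ∣ B] ∈ ℝ^{dx × k du}`. -/
def ctrb {dx du : ℕ} (A : Matrix (Fin dx) (Fin dx) ℝ) (B : Matrix (Fin dx) (Fin du) ℝ) (k : ℕ) :
    Matrix (Fin dx) (Fin k × Fin du) ℝ :=
  Matrix.of fun a jb => (A ^ (k - 1 - (jb.1 : ℕ)) * B) a jb.2

/-- `(α, γ)`-strong stability. -/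
def StronglyStable {d : ℕ} (X : Matrix (Fin d) (Fin d) ℝ) (α γ : ℝ) : Prop :=
  γ < 1 ∧ ∃ S : Matrix (Fin d) (Fin d) ℝ, IsUnit S ∧ ‖S‖ * ‖S⁻¹‖ ≤ α ∧ ‖S⁻¹ * X * S‖ ≤ γ

/-- The upper bounds on the system parameters that are known to the learner, and the growth
constant `L` of the decoder class. -/
structure Params where
  Psi : ℝ
  alpha : ℝ
  gamma : ℝ
  kappa : ℕ
  L : ℝ

variable {dx du : ℕ} {Y : Type*} [MeasurableSpace Y]

/-- The standing assumptions, for a system, parameter bounds, the true decoder `fstar` and a finite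
decoder class `F`. -/
structure Assumptions (S : System dx du Y) (p : Params) (fstar : Y → Vec dx)
    (F : Finset (Y → Vec dx)) : Prop where
  dx_pos : 0 < dx
  one_le_Psi : 1 ≤ p.Psi
  one_le_alpha : 1 ≤ p.alpha
  gamma_mem : p.gamma ∈ Set.Ioo (0 : ℝ) 1
  one_le_L : 1 ≤ p.L
  /-- `q(· ∣ x)` is a probability distribution. -/
  markov : IsMarkovKernel S.q
  /-- covariance matrices, with nondegenerate process noise -/
  Sigma0_psd : S.Sigma0.PosSemidef
  SigmaW_pd : S.SigmaW.PosDef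
  /-- perfect decodability -/
  decodable : ∀ x, ∀ᵐ y ∂(S.q x), fstar y = x
  /-- realizability -/
  realizable : fstar ∈ F
  measurable : ∀ f ∈ F, Measurable f
  /-- growth condition -/
  growth : ∀ f ∈ F, ∀ y, ‖f y‖ ≤ p.L * max 1 ‖fstar y‖
  /-- controllability, with index at most `κ` -/
  controllable : ∃ k ≤ p.kappa, (ctrb S.A S.B k).rank = dx
  /-- strong stability of the open loop -/
  stable : StronglyStable S.A p.alpha p.gamma
  /-- operator norm bounds -/
  norm_A : ‖S.A‖ ≤ p.Psi
  norm_B : ‖S.B‖ ≤ p.Psi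
  norm_SigmaW : ‖S.SigmaW‖ ≤ p.Psi
  norm_SigmaW_inv : ‖S.SigmaW⁻¹‖ ≤ p.Psi
  norm_Sigma0 : ‖S.Sigma0‖ ≤ p.Psi

/-! ### The data distribution of Phase I -/

/-- Initial state, inputs and process noise of one trajectory. -/
abbrev Noise (dx du : ℕ) : Type := Vec dx × (ℕ → Vec du) × (ℕ → Vec dx)

/-- The law of `(x_0, (u_t)_t, (w_t)_t)`: all independent, `x_0 ∼ N(0, Σ₀)`, `u_t ∼ N(0, I)`,
`w_t ∼ N(0, Σ_w)`. -/
def noiseLaw (S : System dx du Y) : Measure (Noise dx du) :=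
  (multivariateGaussian 0 S.Sigma0).prod
    ((Measure.infinitePi fun _ : ℕ => multivariateGaussian 0 (1 : Matrix (Fin du) (Fin du) ℝ)).prod
      (Measure.infinitePi fun _ : ℕ => multivariateGaussian 0 S.SigmaW))

/-- The state `x_t`, by the recursion `x_{t+1} = A x_t + B u_t + w_t`. -/
def state (S : System dx du Y) (z : Noise dx du) : ℕ → Vec dx
  | 0 => z.1
  | t + 1 => Matrix.toEuclideanLin S.A (state S z t) + Matrix.toEuclideanLin S.B (z.2.1 t) + z.2.2 t

/-- `v = (u_{κ₀}, …, u_{κ₀ + κ - 1})`. -/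
def inputStack (κ₀ κ : ℕ) (z : Noise dx du) : Stack κ du :=
  WithLp.toLp 2 fun jb => z.2.1 (κ₀ + (jb.1 : ℕ)) jb.2

/-- The law of `(v, y_{κ₁})`, `κ₁ = κ₀ + κ`, for one trajectory: `(v, x_{κ₁})` is a function of the
noise and, given everything else, `y_{κ₁} ∼ q(· ∣ x_{κ₁})`. -/
def dataLaw (S : System dx du Y) (κ₀ κ : ℕ) : Measure (Stack κ du × Y) :=
  (((noiseLaw S).map fun z => (inputStack κ₀ κ z, state S z (κ₀ + κ))) ⊗ₘ
    Kernel.prodMkLeft (Stack κ du) S.q).map fun t => (t.1.1, t.2)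

/-- The burn-in time `κ₀`. -/
def burnIn (dx : ℕ) (p : Params) (n : ℕ) : ℕ :=
  ⌈(1 - p.gamma)⁻¹ * Real.log
    (84 * p.Psi ^ 5 * p.alpha ^ 4 * dx * Real.log (1000 * n) / (1 - p.gamma) ^ 2)⌉₊

/-! ### The algorithm -/

/-- The regression class `H = {M f(·) : f ∈ F, M ∈ ℝ^{κ du × dx}, ‖M‖ ≤ r}`. -/
def regClass (du κ : ℕ) (F : Finset (Y → Vec dx)) (r : ℝ) : Set (Y → Stack κ du) :=
  {h | ∃ f ∈ F, ∃ M : Matrix (Fin κ × Fin du) (Fin dx) ℝ, ‖M‖ ≤ r ∧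
    h = fun y => Matrix.toEuclideanLin M (f y)}

/-- `h` minimizes the empirical square loss of predicting `v` from `y_{κ₁}` over the class `H`. -/
def IsERM {κ n : ℕ} (H : Set (Y → Stack κ du)) (s : Fin n → Stack κ du × Y)
    (h : Y → Stack κ du) : Prop :=
  h ∈ H ∧ ∀ h' ∈ H, ∑ i, ‖h (s i).2 - (s i).1‖ ^ 2 ≤ ∑ i, ‖h' (s i).2 - (s i).1‖ ^ 2

/-- The empirical second moment matrix `(1/n) ∑ᵢ h(yᵢ) h(yᵢ)ᵀ`. -/
def secondMoment {κ n : ℕ} (h : Y → Stack κ du) (s : Fin n → Stack κ du × Y) :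
    Matrix (Fin κ × Fin du) (Fin κ × Fin du) ℝ :=
  (n : ℝ)⁻¹ • ∑ i, Matrix.vecMulVec (WithLp.ofLp (h (s i).2)) (WithLp.ofLp (h (s i).2))

/-- The columns of `V` are an orthonormal basis of the span of the top `d` eigenvectors of the
symmetric matrix `Λ`: there are orthonormal eigenvectors (the columns of `U`, with eigenvalues `μ`)
such that no eigenvector orthogonal to all of them has a larger eigenvalue than any of them, and the
orthonormal columns of `V` lie in (hence span) the column space of `U`. -/
def IsTopEigenbasis {ι : Type} [Fintype ι] {d : ℕ} (Λ : Matrix ι ι ℝ)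
    (V : Matrix ι (Fin d) ℝ) : Prop :=
  Vᵀ * V = 1 ∧ ∃ (U : Matrix ι (Fin d) ℝ) (μ : Fin d → ℝ),
    Uᵀ * U = 1 ∧ Λ * U = U * Matrix.diagonal μ ∧
    (∀ (w : ι → ℝ) (ν : ℝ), w ≠ 0 → Uᵀ *ᵥ w = 0 → Λ *ᵥ w = ν • w → ∀ j, ν ≤ μ j) ∧
    ∃ R : Matrix (Fin d) (Fin d) ℝ, V = U * R

/-- The learned decoder `f̂(y) = V̂ᵀ ĥ(y)`. -/
def decoder {κ : ℕ} (V : Matrix (Fin κ × Fin du) (Fin dx) ℝ) (h : Y → Stack κ du) (y : Y) :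
    Vec dx :=
  Matrix.toEuclideanLin Vᵀ (h y)

/-! ### The quantities in the guarantee -/

/-- `σ_min(C_κ)`. -/
def sigmaC (S : System dx du Y) (p : Params) : ℝ := sigmaMin (ctrb S.A S.B p.kappa)

/-- `σ_{min,id} = σ_min(C_κ) (1 - γ) / (4 Ψ² α²)`. -/
def sigmaMinId (S : System dx du Y) (p : Params) : ℝ :=
  sigmaC S p * (1 - p.gamma) / (4 * p.Psi ^ 2 * p.alpha ^ 2)

/-- `σ_{max,id} = √Ψ`. -/
def sigmaMaxId (p : Params) : ℝ := √p.Psi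

/-- `c_conc = 12 L² Ψ³ α² / (1 - γ)`. -/
def cConc (p : Params) : ℝ := 12 * p.L ^ 2 * p.Psi ^ 3 * p.alpha ^ 2 / (1 - p.gamma)

/-- `log |F| + du dx κ`. -/
def complexity (du : ℕ) (p : Params) (F : Finset (Y → Vec dx)) : ℝ :=
  Real.log F.card + du * dx * p.kappa

/-- `ε_h² = c ln²(n/δ) (du κ + dx c_conc) (ln|F| + du dx κ) / n`. -/
def epsSq (c : ℝ) (du : ℕ) (p : Params) (F : Finset (Y → Vec dx)) (n : ℕ) (δ : ℝ) : ℝ :=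
  c * (Real.log (n / δ) ^ 2 * (du * p.kappa + dx * cConc p) * complexity du p F / n)

/-- The value of a polynomial at
`(α, γ⁻¹, (1 - γ)⁻¹, Ψ, L, σ_min(C_κ)⁻¹)`. -/
def polyAt (P : MvPolynomial (Fin 6) ℝ) (S : System dx du Y) (p : Params) : ℝ :=
  MvPolynomial.eval
    ![p.alpha, p.gamma⁻¹, (1 - p.gamma)⁻¹, p.Psi, p.L, (sigmaC S p)⁻¹] P

/-- Phase I, run with `n` trajectories for the regression and `n` further ones for the PCA, succeeds
with mean squared error at most `bound` with probability at least `1 - 3δ`.  The regression step is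
any (measurable) rule `hhat` that maps the first `n` samples to an empirical risk minimizer. With
probability at least `1 - 3δ` over the `2n` independent samples, for every orthonormal basis `V` of
the top eigenspace of the empirical second moment on the last `n` samples, the decoder `Vᵀ hhat`
is within `bound` of a well-conditioned linear transformation of `fstar`. -/
def PhaseOneGuarantee (S : System dx du Y) (p : Params) (fstar : Y → Vec dx)
    (F : Finset (Y → Vec dx)) (n : ℕ) (δ bound : ℝ) : Prop :=
  ∀ hhat : (Fin n → Stack p.kappa du × Y) → Y → Stack p.kappa du,
    Measurable (Function.uncurry hhat) →
    (∀ s, IsERM (regClass du p.kappa F √p.Psi) s (hhat s)) →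
    ∃ G : Set ((Fin n → Stack p.kappa du × Y) × (Fin n → Stack p.kappa du × Y)),
      MeasurableSet G ∧
      ENNReal.ofReal (1 - 3 * δ) ≤
        ((Measure.pi fun _ : Fin n => dataLaw S (burnIn dx p n) p.kappa).prod
          (Measure.pi fun _ : Fin n => dataLaw S (burnIn dx p n) p.kappa)) G ∧
      ∀ s ∈ G, ∀ V : Matrix (Fin p.kappa × Fin du) (Fin dx) ℝ,
        IsTopEigenbasis (secondMoment (hhat s.1) s.2) V →
        ∃ Sid : Matrix (Fin dx) (Fin dx) ℝ, IsUnit Sid ∧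
          sigmaMinId S p ≤ min 1 (sigmaMin Sid) ∧
          max 1 ‖Sid‖ ≤ sigmaMaxId p ∧
          ∫⁻ t, ‖decoder V (hhat s.1) t.2 - Matrix.toEuclideanLin Sid (fstar t.2)‖ₑ ^ 2
            ∂(dataLaw S (burnIn dx p n) p.kappa) ≤ ENNReal.ofReal bound

end RichLQR

end

/-!
The proof replaces the realized quantities by three facts about the data distribution, and none of
them needs the burn-in time or a matrix concentration inequality.

*Gaussian regression.* The pair `(v, x)`, with `x` the state at time `κ₁`, is centred Gaussian:
`v` is standard, the covariance `Σ` of `x` satisfies `‖C_κᵀ a‖² + ⟪a, Σ_w a⟫ ≤ ⟪a, Σ a⟫ ≤ s ‖a‖²`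
with `s = 2 Ψ² α² / (1 - γ)`, and the cross-covariance is `C_κ`. Hence the Bayes predictor of `v` is
`h⋆ = M⋆ f⋆` with `M⋆ = C_κᵀ Σ⁻¹` and `‖M⋆‖ ≤ √Ψ`, so that `h⋆` lies in the regression class, and
the residual `v - h⋆(y)` is independent of `x`, therefore of `y`, and sub-Gaussian with parameter
`1`. All predictors are dominated by the envelope `H = Ψ L² max(1, ‖f⋆‖)²`, which has an exponential
moment at the scale `b = d_x c_conc` (`Assumptions.isRegressionModel`).

*Regression error.* For a fixed predictor `h`, sub-Gaussianity of the residual gives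
`E exp(-λ (loss h - loss h⋆)) ≤ E exp(-λ ‖h - h⋆‖² / 2)` for `λ ≤ 1 / 4`. With `λ` of order
`1 / (b log n)` the right-hand side is controlled by the truncated distance
`E min(‖h - h⋆‖², 4 b log n)`, and a Chernoff bound over a `1 / n`-net of the class bounds this
distance for every predictor whose empirical loss does not exceed that of `h⋆`, at the fast rate
`1 / n` (`IsRegressionModel.exists_event`, `Assumptions.exists_erm_event`).

*Principal components.* The vectors `ĥ(y)` lie in the range of a matrix with `d_x` columns, so the
empirical second moment has rank at most `d_x` and its top eigenspace contains the vectors `ĥ(y_i)`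
of the second half of the sample. It therefore suffices that the span of these vectors captures a
fresh `ĥ(y)` with probability `1 - ρ`, where `ρ` is of order `d_x log(n / δ) / n`. This is a
potential argument: as long as the span misses more than that, every new sample raises its dimension
with probability `ρ`, which happens at most `d_x` times (`measure_span_deficient_le`).

Outside the captured event the envelope costs `O(b √ρ)`, so a direction `e` orthogonal to the
columns of `V̂` satisfies `E ⟪e, h⋆(y)⟫² ≤ τ ‖e‖²` with `τ = E ‖ĥ - h⋆‖² + O(b √ρ)`. When
`τ ≤ (3 / 4) σ_min(C_κ)² / s`, the matrix `S_id = V̂ᵀ M⋆` satisfies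
`‖S_id a‖ ≥ σ_min(C_κ) / (2 s) ‖a‖` (`mul_norm_le_norm_adjoint_comp`), and the decoder error is at
most `E ‖ĥ - h⋆‖²` because `V̂ᵀ` is a contraction (`Assumptions.exists_transformation`).

The explicit condition is exactly of this kind. In the polynomial form, `C₁ = R⁴` with `R` a
polynomial; either `log²(n / δ)` is so large that the claimed error exceeds `8 b`, which `S_id = 1`
achieves, or else all error terms are small (`condition_of_polynomial`).
-/

namespace RichLQR

/-! ### Nets in finite-dimensional balls -/

section Net

open Metric Module

variable {E : Type*} [NormedAddCommGroup E] [NormedSpace ℝ E] [FiniteDimensional ℝ E]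

/-- Volume bound for separated sets: disjoint balls of radius `r / (2n)` inside a ball of radius
`r (1 + 1 / (2n))`. -/
theorem card_le_of_separated_ball {r : ℝ} (hr : 0 < r) {n : ℕ} (hn : 0 < n) (s : Finset E)
    (hs : ∀ c ∈ s, ‖c‖ ≤ r) (h : ∀ c ∈ s, ∀ d ∈ s, c ≠ d → r / n ≤ ‖c - d‖) :
    s.card ≤ (1 + 2 * n) ^ finrank ℝ E := by
  borelize E
  have hn' : (0 : ℝ) < n := by exact_mod_cast hn
  let μ : Measure E := Measure.addHaar
  set δ : ℝ := r / (2 * n) with hδ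
  have δpos : 0 < δ := by positivity
  set ρ : ℝ := δ + r with hρ
  have ρpos : 0 < ρ := by positivity
  have D : (s : Set E).PairwiseDisjoint fun c => ball (c : E) δ := by
    rintro c hc d hd hcd
    apply ball_disjoint_ball
    rw [dist_eq_norm]
    refine le_trans (le_of_eq ?_) (h c hc d hd hcd)
    rw [hδ]; field_simp; ring
  have A_subset : (⋃ c ∈ s, ball (c : E) δ) ⊆ ball (0 : E) ρ := by
    refine Set.iUnion₂_subset fun x hx => ball_subset_ball' ?_
    rw [dist_zero_right]
    exact add_le_add le_rfl (hs x hx)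
  have I : (s.card : ℝ≥0∞) * ENNReal.ofReal (δ ^ finrank ℝ E) * μ (ball 0 1) ≤
      ENNReal.ofReal (ρ ^ finrank ℝ E) * μ (ball 0 1) :=
    calc
      (s.card : ℝ≥0∞) * ENNReal.ofReal (δ ^ finrank ℝ E) * μ (ball 0 1)
          = μ (⋃ c ∈ s, ball (c : E) δ) := by
        rw [measure_biUnion_finset D fun c _ => measurableSet_ball]
        simp only [μ.addHaar_ball_of_pos _ δpos]
        simp only [Finset.sum_const, nsmul_eq_mul, mul_assoc]
      _ ≤ μ (ball (0 : E) ρ) := measure_mono A_subset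
      _ = ENNReal.ofReal (ρ ^ finrank ℝ E) * μ (ball 0 1) := by
        simp only [μ.addHaar_ball_of_pos _ ρpos]
  have J : (s.card : ℝ≥0∞) * ENNReal.ofReal (δ ^ finrank ℝ E) ≤
      ENNReal.ofReal (ρ ^ finrank ℝ E) :=
    (ENNReal.mul_le_mul_iff_left (measure_ball_pos _ _ zero_lt_one).ne' measure_ball_lt_top.ne).1 I
  have K : (s.card : ℝ) ≤ (1 + 2 * n : ℝ) ^ finrank ℝ E := by
    have h1 := ENNReal.toReal_le_of_le_ofReal (pow_nonneg ρpos.le _) J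
    rw [ENNReal.toReal_mul, ENNReal.toReal_natCast, ENNReal.toReal_ofReal (by positivity)] at h1
    have h2 : ρ = (1 + 2 * n) * δ := by rw [hρ, hδ]; field_simp
    rw [h2, mul_pow] at h1
    exact le_of_mul_le_mul_right h1 (by positivity)
  exact_mod_cast K

/-- A ball of radius `r` has an `r / n`-net of cardinality at most `(1 + 2n) ^ dim`. -/
theorem exists_net_closedBall {r : ℝ} (hr : 0 < r) {n : ℕ} (hn : 0 < n) :
    ∃ s : Finset E, (∀ c ∈ s, ‖c‖ ≤ r) ∧ (∀ x : E, ‖x‖ ≤ r → ∃ c ∈ s, ‖x - c‖ ≤ r / n) ∧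
      s.card ≤ (1 + 2 * n) ^ finrank ℝ E := by
  classical
  let Q : ℕ → Prop := fun k => ∃ s : Finset E, s.card = k ∧ (∀ c ∈ s, ‖c‖ ≤ r) ∧
    ∀ c ∈ s, ∀ d ∈ s, c ≠ d → r / n ≤ ‖c - d‖
  have hQ0 : Q 0 := ⟨∅, by simp⟩
  have hb : ∀ k, Q k → k ≤ (1 + 2 * n) ^ finrank ℝ E := by
    rintro k ⟨s, rfl, h1, h2⟩
    exact card_le_of_separated_ball hr hn s h1 h2
  obtain ⟨s, hk, h1, h2⟩ : Q (Nat.findGreatest Q ((1 + 2 * n) ^ finrank ℝ E)) :=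
    Nat.findGreatest_spec (Nat.zero_le _) hQ0
  refine ⟨s, h1, fun x hx => ?_, card_le_of_separated_ball hr hn s h1 h2⟩
  by_contra! hcon
  have hpos : 0 ≤ r / n := by positivity
  have hxs : x ∉ s := fun hxs => by
    have := hcon x hxs
    simp only [sub_self, norm_zero] at this
    linarith
  have hQ1 : Q (s.card + 1) := by
    refine ⟨insert x s, Finset.card_insert_of_notMem hxs, ?_, ?_⟩
    · intro c hc
      rcases Finset.mem_insert.1 hc with rfl | hc
      · exact hx
      · exact h1 c hc
    · intro c hc d hd hcd
      rcases Finset.mem_insert.1 hc with hcx | hc <;>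
        rcases Finset.mem_insert.1 hd with hdx | hd
      · exact absurd (hcx.trans hdx.symm) hcd
      · rw [hcx]; exact (hcon d hd).le
      · rw [hdx, norm_sub_rev]; exact (hcon c hc).le
      · exact h2 c hc d hd hcd
  have := Nat.le_findGreatest (hb _ hQ1) hQ1
  omega

end Net

/-! ### Smallest singular values -/

section SingularValues

open Module

/-- For a map into a space of dimension `d`, the `d`-th singular value bounds the adjoint from
below: the images of the first `d` right singular vectors form an orthogonal basis. -/
theorem singularValues_mul_norm_le_adjoint {E F : Type*} [NormedAddCommGroup E]
    [InnerProductSpace ℝ E] [FiniteDimensional ℝ E] [NormedAddCommGroup F] [InnerProductSpace ℝ F]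
    [FiniteDimensional ℝ F] (T : E →ₗ[ℝ] F) {d : ℕ} (hd : finrank ℝ F = d) (hd0 : 0 < d)
    (a : F) : T.singularValues (d - 1) * ‖a‖ ≤ ‖LinearMap.adjoint T a‖ := by
  set σ := T.singularValues (d - 1) with hσ
  rcases (T.singularValues_nonneg (d - 1)).eq_or_lt with h0 | hpos
  · rw [hσ, ← h0, zero_mul]; exact norm_nonneg _
  have hdE : d ≤ finrank ℝ E := by
    by_contra! hlt
    exact hpos.ne' (T.singularValues_of_finrank_le (by omega))
  have hT := T.isSymmetric_adjoint_comp_self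
  let e := hT.eigenvectorBasis rfl
  let k : Fin d → Fin (finrank ℝ E) := Fin.castLE hdE
  have hk : Function.Injective k := Fin.castLE_injective hdE
  have hinner : ∀ i j, inner ℝ (T (e i)) (T (e j)) =
      T.singularValues j ^ 2 * inner ℝ (e i) (e j) := by
    intro i j
    rw [← LinearMap.adjoint_inner_right, T.sq_singularValues_fin rfl j]
    have := hT.apply_eigenvectorBasis rfl j
    simp only [LinearMap.comp_apply, RCLike.ofReal_real_eq_id, id] at this
    rw [this, inner_smul_right]
  have hσi : ∀ i : Fin d, σ ≤ T.singularValues (k i) := fun i =>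
    T.singularValues_antitone (by simp only [k, Fin.val_castLE]; omega)
  have hσp : ∀ i : Fin d, 0 < T.singularValues (k i) := fun i => hpos.trans_le (hσi i)
  let f : Fin d → F := fun i => (T.singularValues (k i))⁻¹ • T (e (k i))
  have hf : Orthonormal ℝ f := by
    rw [orthonormal_iff_ite]
    intro i j
    simp only [f, inner_smul_left, inner_smul_right, hinner, conj_trivial,
      orthonormal_iff_ite.1 e.orthonormal]
    by_cases hij : i = j
    · subst hij
      have := (hσp i).ne'
      simp only [if_true]; field_simp
    · rw [if_neg (fun h => hij (hk h)), if_neg hij]; ring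
  let b : OrthonormalBasis (Fin d) ℝ F := OrthonormalBasis.mk hf (by
    have hli := hf.linearIndependent
    rw [hli.span_eq_top_of_card_eq_finrank' (by simp [hd])])
  have hsum1 : ‖a‖ ^ 2 = ∑ i, (inner ℝ (f i) a) ^ 2 := by
    rw [← b.sum_sq_norm_inner_right a]
    simp [b]
  have hsum2 : ‖LinearMap.adjoint T a‖ ^ 2 = ∑ i, (inner ℝ (e i) (LinearMap.adjoint T a)) ^ 2 := by
    rw [← e.sum_sq_norm_inner_right]
    simp
  have hterm : ∀ i : Fin d, inner ℝ (e (k i)) (LinearMap.adjoint T a) =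
      T.singularValues (k i) * inner ℝ (f i) a := by
    intro i
    rw [LinearMap.adjoint_inner_right]
    simp only [f, inner_smul_left, conj_trivial]
    have := (hσp i).ne'
    field_simp
  have hle : (σ * ‖a‖) ^ 2 ≤ ‖LinearMap.adjoint T a‖ ^ 2 := by
    rw [mul_pow, hsum1, hsum2, Finset.mul_sum]
    calc ∑ i, σ ^ 2 * inner ℝ (f i) a ^ 2
        ≤ ∑ i : Fin d, inner ℝ (e (k i)) (LinearMap.adjoint T a) ^ 2 := by
          refine Finset.sum_le_sum fun i _ => ?_
          rw [hterm, mul_pow]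
          have : σ ^ 2 ≤ T.singularValues (k i) ^ 2 := pow_le_pow_left₀ hpos.le (hσi i) 2
          exact mul_le_mul_of_nonneg_right this (sq_nonneg _)
      _ = ∑ j ∈ Finset.univ.map ⟨k, hk⟩, inner ℝ (e j) (LinearMap.adjoint T a) ^ 2 := by
          rw [Finset.sum_map]; rfl
      _ ≤ _ := Finset.sum_le_sum_of_subset_of_nonneg (Finset.subset_univ _)
          fun _ _ _ => sq_nonneg _
  exact le_of_sq_le_sq hle (norm_nonneg _)

theorem toEuclideanLin_transpose {m n : Type*} [Fintype m] [Fintype n] [DecidableEq m]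
    [DecidableEq n] (A : Matrix m n ℝ) :
    Matrix.toEuclideanLin Aᵀ = LinearMap.adjoint (Matrix.toEuclideanLin A) := by
  rw [← Matrix.toEuclideanLin_conjTranspose_eq_adjoint,
    Matrix.conjTranspose_eq_transpose_of_trivial]

theorem inner_toEuclideanLin_transpose {m n : Type*} [Fintype m] [Fintype n] [DecidableEq m]
    [DecidableEq n] (A : Matrix m n ℝ) (x : EuclideanSpace ℝ n) (y : EuclideanSpace ℝ m) :
    inner ℝ x (Matrix.toEuclideanLin Aᵀ y) = inner ℝ (Matrix.toEuclideanLin A x) y := by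
  rw [toEuclideanLin_transpose, LinearMap.adjoint_inner_right]

theorem toEuclideanLin_mul {l m n : Type*} [Fintype l] [Fintype m] [Fintype n] [DecidableEq m]
    [DecidableEq n] (A : Matrix l m ℝ) (B : Matrix m n ℝ) (x : EuclideanSpace ℝ n) :
    Matrix.toEuclideanLin (A * B) x = Matrix.toEuclideanLin A (Matrix.toEuclideanLin B x) := by
  simp [Matrix.toLpLin_apply, Matrix.mulVec_mulVec]

theorem norm_toEuclideanLin_le {m n : Type*} [Fintype m] [Fintype n] [DecidableEq n]
    (A : Matrix m n ℝ) (x : EuclideanSpace ℝ n) : ‖Matrix.toEuclideanLin A x‖ ≤ ‖A‖ * ‖x‖ :=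
  Matrix.l2_opNorm_mulVec A x

theorem sigmaMin_mul_norm_le {m n : Type} [Fintype m] [Fintype n] [DecidableEq m] [DecidableEq n]
    (C : Matrix m n ℝ) (h : Fintype.card m ≤ Fintype.card n) (h0 : 0 < Fintype.card m)
    (a : EuclideanSpace ℝ m) : sigmaMin C * ‖a‖ ≤ ‖Matrix.toEuclideanLin Cᵀ a‖ := by
  rw [sigmaMin, min_eq_left h, toEuclideanLin_transpose]
  exact singularValues_mul_norm_le_adjoint _ (by simp) h0 a

theorem le_sigmaMin {d : ℕ} (hd : 0 < d) (A : Matrix (Fin d) (Fin d) ℝ) {s : ℝ} (hs : 0 ≤ s)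
    (h : ∀ a : Vec d, s * ‖a‖ ≤ ‖Matrix.toEuclideanLin A a‖) : s ≤ sigmaMin A := by
  rw [sigmaMin, Fintype.card_fin, min_self]
  set T := Matrix.toEuclideanLin A with hTdef
  have hlt : d - 1 < finrank ℝ (EuclideanSpace ℝ (Fin d)) := by simp; omega
  obtain ⟨v, hv⟩ := (T.hasEigenvalue_adjoint_comp_self_sq_singularValues hlt).exists_hasEigenvector
  have h1 := hv.apply_eq_smul
  have h2 : ‖T v‖ ^ 2 = T.singularValues (d - 1) ^ 2 * ‖v‖ ^ 2 := by
    rw [← real_inner_self_eq_norm_sq, ← LinearMap.adjoint_inner_right]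
    rw [LinearMap.comp_apply] at h1
    rw [h1, inner_smul_right, real_inner_self_eq_norm_sq]
    rfl
  have hvpos : 0 < ‖v‖ := norm_pos_iff.2 hv.2
  have h3 : (s * ‖v‖) ^ 2 ≤ (T.singularValues (d - 1) * ‖v‖) ^ 2 := by
    rw [mul_pow (T.singularValues (d - 1)), ← h2]
    exact pow_le_pow_left₀ (by positivity) (h v) 2
  have h4 := le_of_sq_le_sq h3 (mul_nonneg (T.singularValues_nonneg _) hvpos.le)
  exact le_of_mul_le_mul_right h4 hvpos

theorem isUnit_of_mul_norm_le {d : ℕ} (A : Matrix (Fin d) (Fin d) ℝ) {s : ℝ} (hs : 0 < s)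
    (h : ∀ a : Vec d, s * ‖a‖ ≤ ‖Matrix.toEuclideanLin A a‖) : IsUnit A := by
  rw [← Matrix.mulVec_injective_iff_isUnit]
  intro x y hxy
  have h1 := h (WithLp.toLp 2 (x - y))
  rw [Matrix.toLpLin_toLp, Matrix.toLin'_apply, Matrix.mulVec_sub, sub_eq_zero.2 hxy,
    WithLp.toLp_zero, norm_zero] at h1
  have h2 : ‖(WithLp.toLp 2 (x - y) : Vec d)‖ ≤ 0 := by
    by_contra! hc
    exact absurd h1 (not_le.2 (mul_pos hs hc))
  have h3 := norm_le_zero_iff.1 h2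
  have h4 : x - y = 0 := congrArg WithLp.ofLp h3
  exact sub_eq_zero.1 h4

end SingularValues

/-! ### The top eigenspace of a low-rank second moment matrix -/

section TopEigen

theorem dotProduct_sum_vecMulVec {ι : Type*} [Fintype ι] {n : ℕ} (z : Fin n → ι → ℝ) (c : ℝ)
    (w : ι → ℝ) : w ⬝ᵥ ((c • ∑ i, Matrix.vecMulVec (z i) (z i)) *ᵥ w) =
      c * ∑ i, (z i ⬝ᵥ w) ^ 2 := by
  rw [Matrix.smul_mulVec, dotProduct_smul, Matrix.sum_mulVec, dotProduct_sum, smul_eq_mul]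
  congr 1
  refine Finset.sum_congr rfl fun i _ => ?_
  rw [Matrix.vecMulVec_mulVec]
  simp [dotProduct_comm w, sq]

/-- Vectors `z i` in the range of a matrix with `d` columns lie in the span of the top `d`
eigenvectors of their second moment matrix. -/
theorem IsTopEigenbasis.mulVec_transpose_mulVec {ι : Type} [Fintype ι] {d n : ℕ}
    {z : Fin n → ι → ℝ} {c : ℝ} (hc : 0 < c) (M : Matrix ι (Fin d) ℝ) {x : Fin n → Fin d → ℝ}
    (hz : ∀ i, z i = M *ᵥ x i) {V : Matrix ι (Fin d) ℝ}
    (hV : IsTopEigenbasis (c • ∑ i, Matrix.vecMulVec (z i) (z i)) V) (i : Fin n) :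
    V *ᵥ (Vᵀ *ᵥ z i) = z i := by
  classical
  set Λ : Matrix ι ι ℝ := c • ∑ i, Matrix.vecMulVec (z i) (z i) with hΛ
  obtain ⟨hVV, U, μ, hUU, hΛU, hmax, R, rfl⟩ := hV
  have hRR : Rᵀ * R = 1 := by
    have : (U * R)ᵀ * (U * R) = Rᵀ * (Uᵀ * U) * R := by
      rw [Matrix.transpose_mul]; simp only [Matrix.mul_assoc]
    rw [this, hUU, Matrix.mul_one] at hVV
    exact hVV
  have hRR' : R * Rᵀ = 1 := mul_eq_one_comm.1 hRR
  have hVU : U * R * (U * R)ᵀ = U * Uᵀ := by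
    rw [Matrix.transpose_mul]
    calc U * R * (Rᵀ * Uᵀ) = U * (R * Rᵀ) * Uᵀ := by simp only [Matrix.mul_assoc]
      _ = _ := by rw [hRR', Matrix.mul_one]
  rw [Matrix.mulVec_mulVec, hVU]
  have hΛt : Λᵀ = Λ := by
    rw [hΛ, Matrix.transpose_smul, Matrix.transpose_sum]
    simp only [Matrix.transpose_vecMulVec]
  by_cases hpos : ∀ j, 0 < μ j
  · -- the columns of `U` lie in the range of `M`, hence span it
    let K : Matrix (Fin d) ι ℝ := c • ∑ i, Matrix.vecMulVec (x i) (z i)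
    have hK : Λ = M * K := by
      rw [hΛ, Matrix.mul_smul, Matrix.mul_sum]
      congr 1
      refine Finset.sum_congr rfl fun i _ => ?_
      rw [Matrix.mul_vecMulVec, ← hz i]
    let Lm : Matrix (Fin d) (Fin d) ℝ := K * U * Matrix.diagonal fun j => (μ j)⁻¹
    have hU : U = M * Lm := by
      have h1 : U * Matrix.diagonal μ * Matrix.diagonal (fun j => (μ j)⁻¹) = U := by
        rw [Matrix.mul_assoc, Matrix.diagonal_mul_diagonal]
        have : (fun i => μ i * (μ i)⁻¹) = fun _ => (1 : ℝ) := by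
          funext j; exact mul_inv_cancel₀ (hpos j).ne'
        rw [this, Matrix.diagonal_one, Matrix.mul_one]
      rw [← hΛU, hK] at h1
      rw [← h1]
      simp only [Lm, Matrix.mul_assoc] at h1 ⊢
    have h2 : (Uᵀ * M) * Lm = 1 := by rw [Matrix.mul_assoc, ← hU, hUU]
    have h3 : Lm * (Uᵀ * M) = 1 := mul_eq_one_comm.1 h2
    have h4 : U * Uᵀ * M = M := by
      nth_rewrite 1 [hU]
      rw [Matrix.mul_assoc, Matrix.mul_assoc, h3, Matrix.mul_one]
    rw [hz i, Matrix.mulVec_mulVec, h4]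
  · -- the smallest of the top eigenvalues is not positive, so `Λ` vanishes on the complement of `U`
    push Not at hpos
    obtain ⟨j, hj⟩ := hpos
    let P : Matrix ι ι ℝ := 1 - U * Uᵀ
    have hPt : Pᵀ = P := by
      simp only [P, Matrix.transpose_sub, Matrix.transpose_one, Matrix.transpose_mul,
        Matrix.transpose_transpose]
    have hUP : Uᵀ * P = 0 := by
      simp only [P, Matrix.mul_sub, Matrix.mul_one, ← Matrix.mul_assoc, hUU, Matrix.one_mul,
        sub_self]
    have hUΛ : Uᵀ * Λ = Matrix.diagonal μ * Uᵀ := by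
      have := congrArg Matrix.transpose hΛU
      rwa [Matrix.transpose_mul, Matrix.transpose_mul, hΛt, Matrix.diagonal_transpose] at this
    have hcomm : P * Λ = Λ * P := by
      simp only [P, Matrix.sub_mul, Matrix.mul_sub, Matrix.one_mul, Matrix.mul_one]
      rw [Matrix.mul_assoc, hUΛ, ← Matrix.mul_assoc, ← Matrix.mul_assoc, hΛU]
    have hPP : P * P = P := by
      nth_rewrite 1 [show P = 1 - U * Uᵀ from rfl]
      rw [Matrix.sub_mul, Matrix.one_mul, Matrix.mul_assoc, hUP, Matrix.mul_zero, sub_zero]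
    have hPw : ∀ w : ι → ℝ, Uᵀ *ᵥ w = 0 → P *ᵥ w = w := by
      intro w hw
      simp only [P, Matrix.sub_mulVec, Matrix.one_mulVec, ← Matrix.mulVec_mulVec, hw,
        Matrix.mulVec_zero, sub_zero]
    have hherm : (P * Λ).IsHermitian := by
      rw [Matrix.IsHermitian, Matrix.conjTranspose_eq_transpose_of_trivial, Matrix.transpose_mul,
        hPt, hΛt, hcomm]
    have hzero : P * Λ = 0 := by
      rw [← hherm.eigenvalues_eq_zero_iff]
      funext k
      by_contra hne
      set w : ι → ℝ := ⇑(hherm.eigenvectorBasis k) with hw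
      set ν := hherm.eigenvalues k with hν
      have heig : (P * Λ) *ᵥ w = ν • w := hherm.mulVec_eigenvectorBasis k
      have hw0 : w ≠ 0 := by
        intro h0
        have h1 := hherm.eigenvectorBasis.orthonormal.ne_zero k
        apply h1
        ext t
        exact congrFun h0 t
      have hν0 : ν ≠ 0 := hne
      have hUw : Uᵀ *ᵥ w = 0 := by
        have h1 : Uᵀ *ᵥ (ν • w) = 0 := by
          rw [← heig, Matrix.mulVec_mulVec, ← Matrix.mul_assoc, hUP, Matrix.zero_mul,
            Matrix.zero_mulVec]
        rw [Matrix.mulVec_smul] at h1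
        exact (smul_eq_zero.1 h1).resolve_left hν0
      have hΛw : Λ *ᵥ w = ν • w := by
        rw [← heig, hcomm, ← Matrix.mulVec_mulVec, hPw w hUw]
      have hle := (hmax w ν hw0 hUw hΛw j).trans hj
      have hww : 0 < w ⬝ᵥ w := by
        have := Matrix.dotProduct_star_self_pos_iff.2 hw0
        simpa using this
      have hq : w ⬝ᵥ (Λ *ᵥ w) = c * ∑ i, (z i ⬝ᵥ w) ^ 2 := dotProduct_sum_vecMulVec z c w
      rw [hΛw, dotProduct_smul, smul_eq_mul] at hq
      have hge : 0 ≤ ν * (w ⬝ᵥ w) := by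
        rw [hq]; exact mul_nonneg hc.le (Finset.sum_nonneg fun _ _ => sq_nonneg _)
      have : ν < 0 := lt_of_le_of_ne hle hν0
      nlinarith
    set w : ι → ℝ := P *ᵥ z i with hw
    have hUw : Uᵀ *ᵥ w = 0 := by rw [hw, Matrix.mulVec_mulVec, hUP, Matrix.zero_mulVec]
    have hΛw : Λ *ᵥ w = 0 := by
      rw [hw, Matrix.mulVec_mulVec, ← hcomm, hzero, Matrix.zero_mulVec]
    have hq : w ⬝ᵥ (Λ *ᵥ w) = c * ∑ i, (z i ⬝ᵥ w) ^ 2 := dotProduct_sum_vecMulVec z c w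
    rw [hΛw, dotProduct_zero] at hq
    have hs : ∑ i, (z i ⬝ᵥ w) ^ 2 = 0 := (mul_eq_zero.1 hq.symm).resolve_left hc.ne'
    have hzi : z i ⬝ᵥ w = 0 := by
      have := (Finset.sum_eq_zero_iff_of_nonneg fun _ _ => sq_nonneg _).1 hs i (Finset.mem_univ i)
      exact pow_eq_zero_iff (two_ne_zero) |>.1 this
    have hww : w ⬝ᵥ w = 0 := by
      have h1 : w ⬝ᵥ w = z i ⬝ᵥ (P *ᵥ w) := by
        rw [Matrix.dotProduct_mulVec, ← Matrix.mulVec_transpose, hPt,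
          dotProduct_comm]
      rw [h1, hPw w hUw, hzi]
    have hw0 : w = 0 := dotProduct_self_eq_zero.1 hww
    rw [hw] at hw0
    simp only [P, Matrix.sub_mulVec, Matrix.one_mulVec] at hw0
    exact (sub_eq_zero.1 hw0).symm

end TopEigen

/-! ### Conditioning of the recovered transformation -/

section Conditioning

variable {X E : Type*} [NormedAddCommGroup X] [InnerProductSpace ℝ X]
  [NormedAddCommGroup E] [InnerProductSpace ℝ E]

/-- The Cauchy–Schwarz inequality for the form of a positive map. -/
theorem inner_sq_le_of_isPositive {S : X →ₗ[ℝ] X} (hS : S.IsPositive) (c u : X) :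
    inner ℝ c (S u) ^ 2 ≤ inner ℝ c (S c) * inner ℝ u (S u) := by
  have hsym : inner ℝ u (S c) = inner ℝ c (S u) := by
    rw [← hS.isSymmetric u c, real_inner_comm]
  have key : ∀ t : ℝ, 0 ≤ inner ℝ u (S u) * (t * t) + 2 * inner ℝ c (S u) * t
      + inner ℝ c (S c) := by
    intro t
    have h := hS.inner_nonneg_right (c + t • u)
    simp only [map_add, map_smul, inner_add_left, inner_add_right, inner_smul_left,
      inner_smul_right, conj_trivial, hsym] at h
    linarith
  have := discrim_le_zero key
  rw [discrim] at this
  nlinarith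

theorem norm_le_of_isPositive {S : X →ₗ[ℝ] X} (hS : S.IsPositive) {s : ℝ} (hs : 0 ≤ s)
    (hq : ∀ c, inner ℝ c (S c) ≤ s * ‖c‖ ^ 2) (u : X) : ‖S u‖ ≤ s * ‖u‖ := by
  have h1 := inner_sq_le_of_isPositive hS (S u) u
  rw [real_inner_self_eq_norm_sq] at h1
  have h2 : (‖S u‖ ^ 2) ^ 2 ≤ (s * ‖S u‖ ^ 2) * (s * ‖u‖ ^ 2) :=
    h1.trans (mul_le_mul (hq _) (hq _) (hS.inner_nonneg_right _) (by positivity))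
  rcases (norm_nonneg (S u)).eq_or_lt with h0 | hp
  · rw [← h0]; positivity
  · refine le_of_sq_le_sq ?_ (by positivity)
    have : ‖S u‖ ^ 2 * ‖S u‖ ^ 2 ≤ (s * ‖u‖) ^ 2 * ‖S u‖ ^ 2 := by nlinarith
    exact le_of_mul_le_mul_right this (by positivity)

/-- If the projection orthogonal to the range of the isometry `V` leaves at most a fraction of the
second moment of `Cᵀ S⁻¹ x` (where `x` has covariance `S`), then `Vᵀ Cᵀ S⁻¹` is bounded below. -/
theorem mul_norm_le_norm_adjoint_comp [FiniteDimensional ℝ X] [FiniteDimensional ℝ E]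
    {S Sinv : X →ₗ[ℝ] X} {C : E →ₗ[ℝ] X} {V : X →ₗ[ℝ] E}
    (hS : S.IsPositive) (hSS : ∀ a, S (Sinv a) = a)
    (hV : ∀ x, LinearMap.adjoint V (V x) = x) {s σ τ : ℝ} (hs : 0 < s) (hσ : 0 ≤ σ)
    (hq : ∀ c, inner ℝ c (S c) ≤ s * ‖c‖ ^ 2)
    (hC : ∀ a, σ * ‖a‖ ≤ ‖LinearMap.adjoint C a‖)
    (hp : ∀ p : E, LinearMap.adjoint V p = 0 →
      inner ℝ (Sinv (C p)) (S (Sinv (C p))) ≤ ‖p‖ ^ 2 * τ)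
    (hτ0 : 0 ≤ τ) (hτ : τ ≤ 3 / 4 * σ ^ 2 / s) (a : X) :
    σ / (2 * s) * ‖a‖ ≤ ‖LinearMap.adjoint V (LinearMap.adjoint C (Sinv a))‖ := by
  set u := Sinv a with hu
  set y := LinearMap.adjoint C u with hy
  set w := LinearMap.adjoint V y with hw
  set p := y - V w with hpdef
  have hVp : LinearMap.adjoint V p = 0 := by rw [hpdef, map_sub, hV, ← hw, sub_self]
  have hVw : ‖V w‖ ^ 2 = ‖w‖ ^ 2 := by
    rw [← real_inner_self_eq_norm_sq, ← LinearMap.adjoint_inner_right, hV,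
      real_inner_self_eq_norm_sq]
  have hpV : inner ℝ p (V w) = 0 := by
    rw [← LinearMap.adjoint_inner_left, hVp, inner_zero_left]
  have hpy : inner ℝ p y = ‖p‖ ^ 2 := by
    have : y = p + V w := by rw [hpdef]; abel
    rw [this, inner_add_right, hpV, real_inner_self_eq_norm_sq, add_zero]
  have hpyth : ‖y‖ ^ 2 = ‖p‖ ^ 2 + ‖w‖ ^ 2 := by
    have : y = p + V w := by rw [hpdef]; abel
    rw [this, ← real_inner_self_eq_norm_sq, inner_add_left, inner_add_right, inner_add_right, hpV,
      real_inner_comm p (V w), hpV, real_inner_self_eq_norm_sq, real_inner_self_eq_norm_sq, hVw]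
    ring
  have hqu : 0 ≤ inner ℝ u (S u) := hS.inner_nonneg_right u
  have hcu : inner ℝ (Sinv (C p)) (S u) = ‖p‖ ^ 2 := by
    rw [← hS.isSymmetric, hSS, ← LinearMap.adjoint_inner_right, ← hy, hpy]
  have hcs := inner_sq_le_of_isPositive hS (Sinv (C p)) u
  rw [hcu] at hcs
  have h1 : ‖p‖ ^ 2 ≤ τ * inner ℝ u (S u) := by
    rcases (norm_nonneg p).eq_or_lt with h0 | h0
    · rw [← h0]; have := mul_nonneg hτ0 hqu; simpa using this
    · have h2 := hcs.trans (mul_le_mul_of_nonneg_right (hp p hVp) hqu)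
      have h3 : ‖p‖ ^ 2 * ‖p‖ ^ 2 ≤ ‖p‖ ^ 2 * (τ * inner ℝ u (S u)) := by nlinarith
      exact le_of_mul_le_mul_left h3 (by positivity)
  have hCu : σ * ‖u‖ ≤ ‖y‖ := hC u
  have hCu2 : σ ^ 2 * ‖u‖ ^ 2 ≤ ‖y‖ ^ 2 := by
    rw [← mul_pow]; exact pow_le_pow_left₀ (by positivity) hCu 2
  have h4 : τ * inner ℝ u (S u) ≤ 3 / 4 * (σ ^ 2 * ‖u‖ ^ 2) := by
    calc τ * inner ℝ u (S u) ≤ (3 / 4 * σ ^ 2 / s) * (s * ‖u‖ ^ 2) :=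
          mul_le_mul hτ (hq u) hqu (by positivity)
      _ = _ := by field_simp
  have h5 : σ ^ 2 * ‖u‖ ^ 2 ≤ 4 * ‖w‖ ^ 2 := by nlinarith
  have h6 : ‖a‖ ≤ s * ‖u‖ := by
    have := norm_le_of_isPositive hS hs.le hq u
    rwa [hu, hSS, ← hu] at this
  have h7 : σ * ‖u‖ ≤ 2 * ‖w‖ := by
    refine le_of_sq_le_sq ?_ (by positivity)
    nlinarith
  calc σ / (2 * s) * ‖a‖ ≤ σ / (2 * s) * (s * ‖u‖) :=
        mul_le_mul_of_nonneg_left h6 (by positivity)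
    _ = σ * ‖u‖ / 2 := by field_simp
    _ ≤ ‖w‖ := by linarith

end Conditioning

/-! ### Integrals over independent samples -/

section Sample

variable {Ω : Type*} [MeasurableSpace Ω] (μ : Measure Ω) [IsProbabilityMeasure μ]

theorem lintegral_pi_succ {n : ℕ} {f : (Fin (n + 1) → Ω) → ℝ≥0∞} (hf : Measurable f) :
    ∫⁻ ω, f ω ∂(Measure.pi fun _ : Fin (n + 1) => μ) =
      ∫⁻ t, ∫⁻ ω, f (Fin.cons t ω) ∂(Measure.pi fun _ : Fin n => μ) ∂μ := by
  have hmp := (measurePreserving_piFinSuccAbove (fun _ : Fin (n + 1) => μ) 0).symm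
  rw [← hmp.lintegral_comp hf, lintegral_prod (fun p => f _)
    (hf.comp hmp.measurable).aemeasurable]
  simp only [MeasurableEquiv.piFinSuccAbove_symm_apply, Fin.insertNthEquiv_zero]
  rfl

theorem lintegral_pi_prod {f : Ω → ℝ≥0∞} (hf : Measurable f) (n : ℕ) :
    ∫⁻ ω, ∏ i, f (ω i) ∂(Measure.pi fun _ : Fin n => μ) = (∫⁻ t, f t ∂μ) ^ n := by
  induction n with
  | zero => simp
  | succ n ih =>
    rw [lintegral_pi_succ μ (by fun_prop)]
    simp only [Fin.prod_univ_succ, Fin.cons_zero, Fin.cons_succ]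
    have h (t : Ω) : ∫⁻ ω, f t * ∏ i, f (ω i) ∂(Measure.pi fun _ : Fin n => μ) =
        f t * (∫⁻ t, f t ∂μ) ^ n := by
      rw [lintegral_const_mul _ (by fun_prop), ih]
    simp_rw [h]
    rw [lintegral_mul_const _ hf, pow_succ']

theorem lintegral_pi_eval {f : Ω → ℝ≥0∞} (hf : Measurable f) {n : ℕ} (i : Fin n) :
    ∫⁻ ω, f (ω i) ∂(Measure.pi fun _ : Fin n => μ) = ∫⁻ t, f t ∂μ :=
  (measurePreserving_eval (fun _ : Fin n => μ) i).lintegral_comp hf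

end Sample

/-! ### Spans of random vectors -/

section Span

open Module

variable {Ω : Type*} [MeasurableSpace Ω] {E : Type*} [NormedAddCommGroup E]
  [InnerProductSpace ℝ E] [FiniteDimensional ℝ E]

/-- Membership in `W ⊔ span z` through countably many conditions, for measurability in `z` and `x`. -/
theorem mem_sup_span_range_iff {n : ℕ} (W : Submodule ℝ E) (z : Fin n → E) (x : E) :
    x ∈ W ⊔ Submodule.span ℝ (Set.range z) ↔
      ∀ k : ℕ, ∃ q : Fin n → ℚ,
        Metric.infDist (x - ∑ i, (q i : ℝ) • z i) (W : Set E) < 1 / (k + 1) := by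
  have hWne : (W : Set E).Nonempty := ⟨0, W.zero_mem⟩
  constructor
  · intro hx k
    obtain ⟨w, hw, y, hy, rfl⟩ := Submodule.mem_sup.1 hx
    obtain ⟨c, rfl⟩ := (Submodule.mem_span_range_iff_exists_fun ℝ).1 hy
    have hcont : Continuous fun d : Fin n → ℝ => ‖∑ i, c i • z i - ∑ i, d i • z i‖ := by fun_prop
    have hopen : IsOpen {d : Fin n → ℝ | ‖∑ i, c i • z i - ∑ i, d i • z i‖ < 1 / (k + 1)} :=
      isOpen_lt hcont continuous_const
    have hdense : DenseRange fun q : Fin n → ℚ => fun i => (q i : ℝ) :=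
      DenseRange.piMap fun _ => Rat.denseRange_cast
    obtain ⟨q, hq⟩ := hdense.exists_mem_open hopen ⟨c, by simp; positivity⟩
    refine ⟨q, lt_of_le_of_lt (Metric.infDist_le_dist_of_mem hw) ?_⟩
    rw [dist_eq_norm, show w + ∑ i, c i • z i - ∑ i, (q i : ℝ) • z i - w =
      ∑ i, c i • z i - ∑ i, (q i : ℝ) • z i by abel]
    exact hq
  · intro h
    have hcl : IsClosed ((W ⊔ Submodule.span ℝ (Set.range z) : Submodule ℝ E) : Set E) :=
      Submodule.closed_of_finiteDimensional _
    rw [← SetLike.mem_coe, ← hcl.closure_eq, Metric.mem_closure_iff]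
    intro ε hε
    obtain ⟨k, hk⟩ := exists_nat_one_div_lt hε
    obtain ⟨q, hq⟩ := h k
    obtain ⟨w, hw, hwd⟩ := (Metric.infDist_lt_iff hWne).1 (hq.trans hk)
    refine ⟨w + ∑ i, (q i : ℝ) • z i, ?_, ?_⟩
    · refine Submodule.add_mem_sup hw (Submodule.sum_mem _ fun i _ => Submodule.smul_mem _ _ ?_)
      exact Submodule.subset_span ⟨i, rfl⟩
    · rw [dist_eq_norm] at hwd ⊢
      rwa [show x - (w + ∑ i, (q i : ℝ) • z i) = x - ∑ i, (q i : ℝ) • z i - w by abel]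

variable [MeasurableSpace E] [BorelSpace E]

theorem measurableSet_notMem_sup_span {β : Type*} [MeasurableSpace β] {n : ℕ} (W : Submodule ℝ E)
    {z : β → Fin n → E} {x : β → E} (hz : Measurable z) (hx : Measurable x) :
    MeasurableSet {p | x p ∉ W ⊔ Submodule.span ℝ (Set.range (z p))} := by
  have : {p | x p ∉ W ⊔ Submodule.span ℝ (Set.range (z p))} =
      (⋂ k : ℕ, ⋃ q : Fin n → ℚ,
        {p | Metric.infDist (x p - ∑ i, (q i : ℝ) • z p i) (W : Set E) < 1 / (k + 1)})ᶜ := by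
    ext p
    simp [mem_sup_span_range_iff]
  rw [this]
  refine (MeasurableSet.iInter fun k => MeasurableSet.iUnion fun q =>
    measurableSet_lt ?_ measurable_const).compl
  have : Measurable fun p => x p - ∑ i, (q i : ℝ) • z p i := by
    refine hx.sub (Finset.measurable_sum _ fun i _ => ?_)
    exact ((measurable_pi_apply i).comp hz).const_smul _
  exact (Metric.continuous_infDist_pt _).measurable.comp this

/-- After `n` independent draws of `g`, the probability that the span of the draws (together with
a subspace `W`) still misses a fresh draw with probability more than `r` decays like `exp(-r n / 2)`,
up to a factor `2` for each missing dimension: as long as the span is deficient, each new draw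
increases its dimension with probability at least `r`. -/
theorem measure_span_deficient_le (μ : Measure Ω) [IsProbabilityMeasure μ] {g : Ω → E}
    (hg : Measurable g) {T : Submodule ℝ E} (hT : ∀ t, g t ∈ T) (r : ℝ) (n : ℕ) :
    ∀ (k : ℕ) (W : Submodule ℝ E), W ≤ T → finrank ℝ T ≤ finrank ℝ W + k →
      (Measure.pi fun _ : Fin n => μ) {ω | ENNReal.ofReal r <
        μ {t | g t ∉ W ⊔ Submodule.span ℝ (Set.range fun i => g (ω i))}} ≤
      ENNReal.ofReal (2 ^ k * Real.exp (-r / 2 * n)) := by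
  induction n with
  | zero =>
    intro k W _ _
    refine prob_le_one.trans ?_
    rw [← ENNReal.ofReal_one]
    refine ENNReal.ofReal_le_ofReal ?_
    simp only [Nat.cast_zero, mul_zero, Real.exp_zero, mul_one]
    exact one_le_pow₀ (by norm_num)
  | succ n ih =>
    intro k W hWT hk
    have hWm : MeasurableSet {t | g t ∈ W} :=
      hg (Submodule.closed_of_finiteDimensional W).measurableSet
    by_cases hr : μ {t | g t ∉ W} ≤ ENNReal.ofReal r
    · -- nothing is missing already
      have : {ω : Fin (n + 1) → Ω | ENNReal.ofReal r <
          μ {t | g t ∉ W ⊔ Submodule.span ℝ (Set.range fun i => g (ω i))}} = ∅ := by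
        ext ω
        simp only [Set.mem_ofPred_eq, Set.mem_empty_iff_false, iff_false, not_lt]
        refine (measure_mono ?_).trans hr
        intro t ht hW
        exact ht (Submodule.mem_sup_left hW)
      rw [this, measure_empty]
      exact zero_le
    push Not at hr
    set B : ℝ := 2 ^ k * Real.exp (-r / 2 * n) with hB
    have hB0 : 0 < B := by positivity
    set bad : Set (Fin (n + 1) → Ω) := {ω | ENNReal.ofReal r <
        μ {t | g t ∉ W ⊔ Submodule.span ℝ (Set.range fun i => g (ω i))}} with hbad
    have hbadm : MeasurableSet bad := by
      have h1 : MeasurableSet {p : (Fin (n + 1) → Ω) × Ω |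
          g p.2 ∉ W ⊔ Submodule.span ℝ (Set.range fun i => g (p.1 i))} :=
        measurableSet_notMem_sup_span W (z := fun p : (Fin (n + 1) → Ω) × Ω => fun i => g (p.1 i))
          (by fun_prop) (by fun_prop)
      exact measurableSet_lt measurable_const (measurable_measure_prodMk_left (ν := μ) h1)
    rw [← lintegral_indicator_one hbadm,
      lintegral_pi_succ μ (measurable_one.indicator hbadm)]
    -- conditionally on the first draw, `W` is replaced by `W ⊔ span {g t}`
    have hstep : ∀ t, ∫⁻ ω, bad.indicator 1 (Fin.cons t ω) ∂(Measure.pi fun _ : Fin n => μ) ≤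
        ENNReal.ofReal B * {t | g t ∈ W}.indicator 1 t +
          ENNReal.ofReal (B / 2) * {t | g t ∈ W}ᶜ.indicator 1 t := by
      intro t
      set W' := W ⊔ Submodule.span ℝ {g t} with hW'
      have hset : ∀ ω : Fin n → Ω,
          W ⊔ Submodule.span ℝ (Set.range fun i : Fin (n + 1) => g ((Fin.cons t ω : _ → Ω) i)) =
          W' ⊔ Submodule.span ℝ (Set.range fun i => g (ω i)) := by
        intro ω
        have : (Set.range fun i : Fin (n + 1) => g ((Fin.cons t ω : _ → Ω) i)) =
            {g t} ∪ Set.range fun i => g (ω i) := by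
          ext y
          simp [Fin.exists_fin_succ, eq_comm]
        rw [this, Submodule.span_union, hW', sup_assoc]
      have hpre : (fun ω : Fin n → Ω => bad.indicator (1 : (Fin (n + 1) → Ω) → ℝ≥0∞) (Fin.cons t ω)) =
          {ω : Fin n → Ω | ENNReal.ofReal r <
            μ {t | g t ∉ W' ⊔ Submodule.span ℝ (Set.range fun i => g (ω i))}}.indicator 1 := by
        funext ω
        simp only [Set.indicator_apply, hbad, Set.mem_ofPred_eq, Pi.one_apply, hset]
      have hle : ∫⁻ ω, bad.indicator 1 (Fin.cons t ω) ∂(Measure.pi fun _ : Fin n => μ) ≤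
          (Measure.pi fun _ : Fin n => μ) {ω : Fin n → Ω | ENNReal.ofReal r <
            μ {t | g t ∉ W' ⊔ Submodule.span ℝ (Set.range fun i => g (ω i))}} := by
        rw [hpre]; exact lintegral_indicator_one_le _
      have hW'T : W' ≤ T := sup_le hWT (by
        rw [Submodule.span_le]; simpa using hT t)
      refine hle.trans ?_
      by_cases ht : g t ∈ W
      · have : W' = W := by
          rw [hW', sup_eq_left, Submodule.span_le]; simpa using ht
        have h1 := ih k W' hW'T (by rw [this]; exact hk)
        rw [← hB] at h1
        simpa [ht] using h1
      · have hlt : W < W' := lt_of_le_of_ne le_sup_left fun h => ht (by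
          rw [h]; exact Submodule.mem_sup_right (Submodule.mem_span_singleton_self _))
        have hfr := Submodule.finrank_lt_finrank_of_lt hlt
        have hfr' := Submodule.finrank_mono hW'T
        obtain ⟨k', rfl⟩ : ∃ k', k = k' + 1 := ⟨k - 1, by omega⟩
        have h1 := ih k' W' hW'T (by omega)
        have h2 : B / 2 = 2 ^ k' * Real.exp (-r / 2 * n) := by rw [hB, pow_succ]; ring
        rw [← h2] at h1
        simpa [ht] using h1
    refine (lintegral_mono hstep).trans ?_
    rw [lintegral_add_left ((measurable_one.indicator hWm).const_mul _),
      lintegral_const_mul _ (measurable_one.indicator hWm),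
      lintegral_const_mul _ (measurable_one.indicator hWm.compl), lintegral_indicator_one hWm,
      lintegral_indicator_one hWm.compl]
    set p := μ.real {t | g t ∈ W}ᶜ with hp
    have hp1 : p ≤ 1 := measureReal_le_one
    have hp0 : 0 ≤ p := measureReal_nonneg
    have hrp : r ≤ p := by
      have : ENNReal.ofReal r ≤ ENNReal.ofReal p := by
        rw [hp, ofReal_measureReal]; exact hr.le
      rcases le_or_gt r 0 with h | h
      · exact h.trans hp0
      · exact (ENNReal.ofReal_le_ofReal_iff hp0).1 this
    have e1 : μ {t | g t ∈ W}ᶜ = ENNReal.ofReal p := (ofReal_measureReal).symm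
    have e2 : μ {t | g t ∈ W} = ENNReal.ofReal (1 - p) := by
      rw [hp, probReal_compl_eq_one_sub hWm, sub_sub_cancel, ofReal_measureReal]
    rw [e1, e2, ← ENNReal.ofReal_mul hB0.le, ← ENNReal.ofReal_mul (by positivity),
      ← ENNReal.ofReal_add (by nlinarith) (by positivity)]
    refine ENNReal.ofReal_le_ofReal ?_
    have h1 : (1 - p / 2) ≤ Real.exp (-r / 2) := by
      have := Real.add_one_le_exp (-r / 2)
      linarith
    have h2 : 2 ^ k * Real.exp (-r / 2 * ((n + 1 : ℕ) : ℝ)) = B * Real.exp (-r / 2) := by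
      rw [hB, mul_assoc, ← Real.exp_add]; push_cast; ring_nf
    rw [h2]
    nlinarith [mul_le_mul_of_nonneg_left h1 hB0.le]

end Span

/-! ### Exponential tail bounds for independent samples -/

section Tail

variable {Ω : Type*} [MeasurableSpace Ω] (μ : Measure Ω) [IsProbabilityMeasure μ]

/-- The Chernoff bound for the lower tail of a sum of independent copies of `G`. -/
theorem measure_sum_lt_le_exp {G : Ω → ℝ} (hG : Measurable G) {l a : ℝ} (hl : 0 < l)
    (h : ∫⁻ t, ENNReal.ofReal (Real.exp (-l * G t)) ∂μ ≤ ENNReal.ofReal (Real.exp (-l * a)))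
    (n : ℕ) (τ : ℝ) :
    (Measure.pi fun _ : Fin n => μ) {ω | ∑ i, G (ω i) < n * a - τ / l} ≤
      ENNReal.ofReal (Real.exp (-τ)) := by
  set ε := ENNReal.ofReal (Real.exp (-l * (n * a) + τ)) with hε
  have hε0 : ε ≠ 0 := by simp [hε, Real.exp_pos]
  have hsub : {ω : Fin n → Ω | ∑ i, G (ω i) < n * a - τ / l} ⊆
      {ω | ε ≤ ∏ i, ENNReal.ofReal (Real.exp (-l * G (ω i)))} := by
    intro ω hω
    simp only [Set.mem_ofPred_eq] at hω ⊢
    rw [← ENNReal.ofReal_prod_of_nonneg fun i _ => (Real.exp_pos _).le, ← Real.exp_sum]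
    refine ENNReal.ofReal_le_ofReal (Real.exp_le_exp.2 ?_)
    rw [← Finset.mul_sum]
    have h1 := mul_lt_mul_of_pos_left hω hl
    have h2 : l * (n * a - τ / l) = l * (n * a) - τ := by field_simp
    linarith
  refine (measure_mono hsub).trans ?_
  have hmeas : Measurable fun t => ENNReal.ofReal (Real.exp (-l * G t)) := by fun_prop
  have h1 := mul_meas_ge_le_lintegral (μ := Measure.pi fun _ : Fin n => μ)
    (f := fun ω => ∏ i, ENNReal.ofReal (Real.exp (-l * G (ω i)))) (by fun_prop) ε
  rw [lintegral_pi_prod μ hmeas] at h1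
  have h2 : ε * (Measure.pi fun _ : Fin n => μ)
      {ω | ε ≤ ∏ i, ENNReal.ofReal (Real.exp (-l * G (ω i)))} ≤
      ε * ENNReal.ofReal (Real.exp (-τ)) := by
    refine (h1.trans (pow_le_pow_left' h n)).trans (le_of_eq ?_)
    rw [hε, ← ENNReal.ofReal_mul (Real.exp_pos _).le, ← ENNReal.ofReal_pow (Real.exp_pos _).le,
      ← Real.exp_add, ← Real.exp_nat_mul]
    congr 2; ring
  exact (ENNReal.mul_le_mul_iff_right hε0 ENNReal.ofReal_ne_top).1 h2

/-- An empirical mean inherits the exponential tail of a single summand, by convexity. -/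
theorem measure_log_lt_mean_le {Z : Ω → ℝ} (hZ : Measurable Z)
    (h : ∫⁻ t, ENNReal.ofReal (Real.exp (Z t)) ∂μ ≤ 2) {n : ℕ} (hn : 0 < n) {δ : ℝ} (hδ : 0 < δ) :
    (Measure.pi fun _ : Fin n => μ) {ω | Real.log (2 / δ) < (n : ℝ)⁻¹ * ∑ i, Z (ω i)} ≤
      ENNReal.ofReal δ := by
  have hn' : (0 : ℝ) < n := by exact_mod_cast hn
  set ε := ENNReal.ofReal (2 / δ) with hε
  have hpos : 0 < 2 / δ := by positivity
  have hε0 : ε ≠ 0 := by simpa [hε] using hpos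
  have hsub : {ω : Fin n → Ω | Real.log (2 / δ) < (n : ℝ)⁻¹ * ∑ i, Z (ω i)} ⊆
      {ω | ε ≤ ∑ i, ENNReal.ofReal (n : ℝ)⁻¹ * ENNReal.ofReal (Real.exp (Z (ω i)))} := by
    intro ω hω
    simp only [Set.mem_ofPred_eq] at hω ⊢
    simp_rw [← ENNReal.ofReal_mul (inv_nonneg.2 hn'.le)]
    rw [← ENNReal.ofReal_sum_of_nonneg fun i _ => by positivity]
    refine ENNReal.ofReal_le_ofReal ?_
    have h1 : 2 / δ ≤ Real.exp ((n : ℝ)⁻¹ * ∑ i, Z (ω i)) := by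
      rw [← Real.log_le_iff_le_exp hpos]; exact hω.le
    refine h1.trans ?_
    have h2 := convexOn_exp.map_sum_le (t := Finset.univ) (w := fun _ : Fin n => (n : ℝ)⁻¹)
      (p := fun i => Z (ω i)) (fun _ _ => by positivity) (by simp [hn'.ne'])
      (fun _ _ => Set.mem_univ _)
    simpa only [smul_eq_mul, ← Finset.mul_sum] using h2
  refine (measure_mono hsub).trans ?_
  have hmeas : Measurable fun t => ENNReal.ofReal (Real.exp (Z t)) := by fun_prop
  have h1 := mul_meas_ge_le_lintegral (μ := Measure.pi fun _ : Fin n => μ)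
    (f := fun ω => ∑ i, ENNReal.ofReal (n : ℝ)⁻¹ * ENNReal.ofReal (Real.exp (Z (ω i))))
    (by fun_prop) ε
  rw [lintegral_finsetSum _ (fun i _ => by fun_prop)] at h1
  have h2 : ∀ i : Fin n, ∫⁻ ω, ENNReal.ofReal (n : ℝ)⁻¹ * ENNReal.ofReal (Real.exp (Z (ω i)))
      ∂(Measure.pi fun _ : Fin n => μ) ≤ ENNReal.ofReal (n : ℝ)⁻¹ * 2 := by
    intro i
    rw [lintegral_const_mul _ (by fun_prop), lintegral_pi_eval μ hmeas]
    exact mul_le_mul_right h _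
  have h3 : ε * (Measure.pi fun _ : Fin n => μ)
      {ω | ε ≤ ∑ i, ENNReal.ofReal (n : ℝ)⁻¹ * ENNReal.ofReal (Real.exp (Z (ω i)))} ≤
      ε * ENNReal.ofReal δ := by
    refine (h1.trans (Finset.sum_le_sum fun i _ => h2 i)).trans (le_of_eq ?_)
    rw [Finset.sum_const, Finset.card_univ, Fintype.card_fin, nsmul_eq_mul, hε,
      ← ENNReal.ofReal_mul hpos.le, ← mul_assoc, ← ENNReal.ofReal_natCast,
      ← ENNReal.ofReal_mul hn'.le, mul_inv_cancel₀ hn'.ne', div_mul_cancel₀ _ hδ.ne']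
    simp
  exact (ENNReal.mul_le_mul_iff_right hε0 ENNReal.ofReal_ne_top).1 h3

end Tail

theorem exp_neg_le_one_sub_half {x : ℝ} (h0 : 0 ≤ x) (h1 : x ≤ 1) :
    Real.exp (-x) ≤ 1 - x / 2 := by
  have h2 : 1 + x ≤ Real.exp x := by linarith [Real.add_one_le_exp x]
  rw [Real.exp_neg]
  calc (Real.exp x)⁻¹ ≤ (1 + x)⁻¹ := inv_anti₀ (by linarith) h2
    _ ≤ 1 - x / 2 := by
      rw [inv_le_iff_one_le_mul₀ (by linarith)]
      nlinarith

/-! ### Least squares over a class with an exponentially integrable envelope -/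

section Regression

variable {E Y : Type*} [NormedAddCommGroup E] [MeasurableSpace E] [MeasurableSpace Y]

/-- The mean squared distance of `h` to `hstar`, truncated at the level `R`. -/
noncomputable def truncDist (μ : Measure (E × Y)) (hstar h : Y → E) (R : ℝ) : ℝ :=
  ∫ t, min (‖h t.2 - hstar t.2‖ ^ 2) R ∂μ

theorem integrable_trunc [BorelSpace E] [SecondCountableTopology E] {μ : Measure (E × Y)}
    [IsFiniteMeasure μ] {hstar h : Y → E} (hh : Measurable h) (hs : Measurable hstar) {R : ℝ}
    (hR : 0 ≤ R) : Integrable (fun t : E × Y => min (‖h t.2 - hstar t.2‖ ^ 2) R) μ := by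
  refine Integrable.of_bound (C := R) ?_ ?_
  · exact Measurable.aestronglyMeasurable (by fun_prop)
  · refine Filter.Eventually.of_forall fun t => ?_
    rw [Real.norm_of_nonneg (le_min (sq_nonneg _) hR)]
    exact min_le_right _ _

variable [InnerProductSpace ℝ E]

/-- A regression problem with Bayes predictor `hstar` and sub-Gaussian noise `v - hstar y`; the
predictors are bounded by the envelope `H`, in the sense that `‖h y‖² ≤ H y`, and `b` and `N` are the
scales of `H` and of `‖v‖²`. The noise condition is stated in the integrated form in which it is
used: the exponential moment of the negative excess loss of `hstar + Δ` is controlled by that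
of `-‖Δ‖²`. -/
structure IsRegressionModel (μ : Measure (E × Y)) (hstar : Y → E) (H : Y → ℝ) (b N : ℝ) :
    Prop where
  hstar_measurable : Measurable hstar
  H_measurable : Measurable H
  norm_hstar : ∀ y, ‖hstar y‖ ^ 2 ≤ H y
  one_le_b : 1 ≤ b
  N_pos : 0 < N
  exp_H : ∫⁻ t, ENNReal.ofReal (Real.exp (H t.2 / b)) ∂μ ≤ 2
  exp_v : ∫⁻ t, ENNReal.ofReal (Real.exp (‖t.1‖ ^ 2 / (4 * N))) ∂μ ≤ 2
  subgaussian : ∀ Δ : Y → E, Measurable Δ → ∀ l : ℝ, 0 ≤ l → l ≤ 1 / 4 →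
    ∫⁻ t, ENNReal.ofReal (Real.exp (-l * (‖Δ t.2‖ ^ 2 - 2 * inner ℝ (t.1 - hstar t.2) (Δ t.2))))
      ∂μ ≤ ∫⁻ t, ENNReal.ofReal (Real.exp (-(l / 2) * ‖Δ t.2‖ ^ 2)) ∂μ

variable [BorelSpace E] [SecondCountableTopology E] {μ : Measure (E × Y)} [IsProbabilityMeasure μ]
  {hstar : Y → E} {H : Y → ℝ} {b N : ℝ}

/-- The Laplace transform of the excess loss of `h` at `1 / R`: the quadratic noise condition is
linearized by truncating the distance at the level `R`. -/
theorem IsRegressionModel.lintegral_exp_excess_le (hM : IsRegressionModel μ hstar H b N)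
    {h : Y → E} (hh : Measurable h) {R : ℝ} (hR : 4 ≤ R) :
    ∫⁻ t, ENNReal.ofReal (Real.exp (-(1 / R) *
      (‖h t.2 - t.1‖ ^ 2 - ‖hstar t.2 - t.1‖ ^ 2))) ∂μ ≤
      ENNReal.ofReal (Real.exp (-(1 / R) * (truncDist μ hstar h R / 4))) := by
  have hR0 : 0 < R := by linarith
  have hs := hM.hstar_measurable
  have hΔ : Measurable fun y => h y - hstar y := hh.sub hs
  have h1 := hM.subgaussian _ hΔ (1 / R) (by positivity)
    (one_div_le_one_div_of_le (by norm_num) hR)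
  have heq : ∀ t : E × Y, ‖h t.2 - t.1‖ ^ 2 - ‖hstar t.2 - t.1‖ ^ 2 =
      ‖h t.2 - hstar t.2‖ ^ 2 - 2 * inner ℝ (t.1 - hstar t.2) (h t.2 - hstar t.2) := by
    intro t
    have : h t.2 - t.1 = (h t.2 - hstar t.2) - (t.1 - hstar t.2) := by abel
    rw [this, norm_sub_sq_real, real_inner_comm, ← norm_neg (hstar t.2 - t.1), neg_sub]
    ring
  simp_rw [heq]
  refine h1.trans ?_
  have hint := integrable_trunc (μ := μ) hh hs hR0.le
  have hint' : Integrable (fun t : E × Y =>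
      1 - 1 / (4 * R) * min (‖h t.2 - hstar t.2‖ ^ 2) R) μ :=
    (integrable_const 1).sub (hint.const_mul _)
  have hm : ∀ t : E × Y, 0 ≤ min (‖h t.2 - hstar t.2‖ ^ 2) R := fun t =>
    le_min (sq_nonneg _) hR0.le
  have hm' : ∀ t : E × Y, 1 / (2 * R) * min (‖h t.2 - hstar t.2‖ ^ 2) R ≤ 1 := by
    intro t
    calc 1 / (2 * R) * min (‖h t.2 - hstar t.2‖ ^ 2) R ≤ 1 / (2 * R) * R :=
          mul_le_mul_of_nonneg_left (min_le_right _ _) (by positivity)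
      _ ≤ 1 := by field_simp; norm_num
  calc ∫⁻ t, ENNReal.ofReal (Real.exp (-(1 / R / 2) * ‖h t.2 - hstar t.2‖ ^ 2)) ∂μ
      ≤ ∫⁻ t, ENNReal.ofReal (1 - 1 / (4 * R) * min (‖h t.2 - hstar t.2‖ ^ 2) R) ∂μ := by
        refine lintegral_mono fun t => ENNReal.ofReal_le_ofReal ?_
        have h2 := exp_neg_le_one_sub_half (mul_nonneg (by positivity) (hm t)) (hm' t)
        refine le_trans (Real.exp_le_exp.2 ?_) (h2.trans (le_of_eq (by ring)))
        have : 1 / (2 * R) * min (‖h t.2 - hstar t.2‖ ^ 2) R ≤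
            1 / (2 * R) * ‖h t.2 - hstar t.2‖ ^ 2 :=
          mul_le_mul_of_nonneg_left (min_le_left _ _) (by positivity)
        have e : 1 / R / 2 = 1 / (2 * R) := by field_simp
        rw [e]; linarith
    _ = ENNReal.ofReal (1 - 1 / (4 * R) * truncDist μ hstar h R) := by
        rw [← ofReal_integral_eq_lintegral_ofReal hint', integral_sub (integrable_const 1)
          (hint.const_mul _), integral_const_mul]
        · simp [truncDist]
        · refine Filter.Eventually.of_forall fun t => ?_
          have h3 := hm' t
          have e : 1 / (4 * R) * min (‖h t.2 - hstar t.2‖ ^ 2) R =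
            1 / (2 * R) * min (‖h t.2 - hstar t.2‖ ^ 2) R / 2 := by ring
          simp only [Pi.zero_apply]
          rw [e]; linarith
    _ ≤ _ := by
        refine ENNReal.ofReal_le_ofReal ?_
        have h4 := Real.add_one_le_exp (-(1 / R) * (truncDist μ hstar h R / 4))
        refine le_trans (le_of_eq ?_) h4
        field_simp; ring

/-- The truncation at level `4 b log n` costs only `O(b / n)`. -/
theorem IsRegressionModel.lintegral_sq_le (hM : IsRegressionModel μ hstar H b N) {n : ℕ}
    (hn : 3 ≤ n) {h g : Y → E} (hg : Measurable g) (hgH : ∀ y, ‖g y‖ ^ 2 ≤ H y)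
    (hgh : ∀ y, ‖h y - g y‖ ^ 2 ≤ H y / n ^ 2) :
    ∫⁻ t, ENNReal.ofReal (‖h t.2 - hstar t.2‖ ^ 2) ∂μ ≤
      ENNReal.ofReal (2 * truncDist μ hstar g (4 * b * Real.log n) + 20 * b / n) := by
  have hb : 0 < b := by linarith [hM.one_le_b]
  have hn3 : (3 : ℝ) ≤ n := by exact_mod_cast hn
  have hn0 : (0 : ℝ) < n := by linarith
  have hlog : 0 ≤ Real.log n := Real.log_nonneg (by linarith)
  set R := 4 * b * Real.log n with hRdef
  have hR : 0 ≤ R := by positivity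
  have hs := hM.hstar_measurable
  have hH := hM.H_measurable
  have hint := integrable_trunc (μ := μ) hg hs hR
  have key : ∀ t : E × Y, ‖h t.2 - hstar t.2‖ ^ 2 ≤
      2 * min (‖g t.2 - hstar t.2‖ ^ 2) R + 10 * b / n * Real.exp (H t.2 / b) := by
    intro t
    have hH0 : 0 ≤ H t.2 := (sq_nonneg _).trans (hM.norm_hstar t.2)
    have h1 : ‖h t.2 - hstar t.2‖ ^ 2 ≤
        2 * ‖g t.2 - hstar t.2‖ ^ 2 + 2 * ‖h t.2 - g t.2‖ ^ 2 := by
      have e : h t.2 - hstar t.2 = (g t.2 - hstar t.2) + (h t.2 - g t.2) := by abel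
      have := norm_add_le (g t.2 - hstar t.2) (h t.2 - g t.2)
      rw [e]
      nlinarith [norm_nonneg (g t.2 - hstar t.2 + (h t.2 - g t.2)),
        sq_nonneg (‖g t.2 - hstar t.2‖ - ‖h t.2 - g t.2‖)]
    have h2 : ‖g t.2 - hstar t.2‖ ^ 2 ≤ 4 * H t.2 := by
      have := norm_sub_le (g t.2) (hstar t.2)
      nlinarith [norm_nonneg (g t.2 - hstar t.2), sq_nonneg (‖g t.2‖ - ‖hstar t.2‖), hgH t.2,
        hM.norm_hstar t.2]
    -- `exp (H / b) / n = exp (H / b - log n)`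
    have hexp : Real.exp (H t.2 / b) = n * Real.exp (H t.2 / b - Real.log n) := by
      rw [Real.exp_sub, Real.exp_log hn0]; field_simp
    have h3 : ‖g t.2 - hstar t.2‖ ^ 2 ≤ min (‖g t.2 - hstar t.2‖ ^ 2) R +
        4 * b / n * Real.exp (H t.2 / b) := by
      rcases le_total (‖g t.2 - hstar t.2‖ ^ 2) R with h | h
      · rw [min_eq_left h]
        have : 0 ≤ 4 * b / n * Real.exp (H t.2 / b) := by positivity
        linarith
      · rw [min_eq_right h, hexp]
        have h4 := Real.add_one_le_exp (H t.2 / b - Real.log n)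
        have h5 : H t.2 ≤ b * Real.log n + b * Real.exp (H t.2 / b - Real.log n) := by
          have h6 : H t.2 = b * (H t.2 / b) := by field_simp
          rw [← mul_add]
          nth_rewrite 1 [h6]
          exact mul_le_mul_of_nonneg_left (by linarith) hb.le
        have h7 : 4 * b / n * (n * Real.exp (H t.2 / b - Real.log n)) =
          4 * b * Real.exp (H t.2 / b - Real.log n) := by field_simp
        rw [h7, hRdef]
        linarith
    have h8 : ‖h t.2 - g t.2‖ ^ 2 ≤ b / n * Real.exp (H t.2 / b) := by
      refine (hgh t.2).trans ?_
      have h9 : H t.2 / b ≤ Real.exp (H t.2 / b) := by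
        linarith [Real.add_one_le_exp (H t.2 / b)]
      calc H t.2 / n ^ 2 = b / n ^ 2 * (H t.2 / b) := by field_simp
        _ ≤ b / n * Real.exp (H t.2 / b) := by
          refine mul_le_mul ?_ h9 (by positivity) (by positivity)
          refine div_le_div_of_nonneg_left hb.le hn0 ?_
          nlinarith
    have e : 10 * b / n * Real.exp (H t.2 / b) =
      2 * (4 * b / n * Real.exp (H t.2 / b)) + 2 * (b / n * Real.exp (H t.2 / b)) := by ring
    rw [e]; linarith
  calc ∫⁻ t, ENNReal.ofReal (‖h t.2 - hstar t.2‖ ^ 2) ∂μ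
      ≤ ∫⁻ t, (ENNReal.ofReal (2 * min (‖g t.2 - hstar t.2‖ ^ 2) R) +
          ENNReal.ofReal (10 * b / n) * ENNReal.ofReal (Real.exp (H t.2 / b))) ∂μ := by
        refine lintegral_mono fun t => ?_
        rw [← ENNReal.ofReal_mul (by positivity), ← ENNReal.ofReal_add
          (mul_nonneg zero_le_two (le_min (sq_nonneg _) hR)) (by positivity)]
        exact ENNReal.ofReal_le_ofReal (key t)
    _ = ENNReal.ofReal (2 * truncDist μ hstar g R) +
          ENNReal.ofReal (10 * b / n) * ∫⁻ t, ENNReal.ofReal (Real.exp (H t.2 / b)) ∂μ := by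
        rw [lintegral_add_right _ (by fun_prop), lintegral_const_mul _ (by fun_prop),
          ← ofReal_integral_eq_lintegral_ofReal (hint.const_mul 2)
            (Filter.Eventually.of_forall fun t =>
              mul_nonneg zero_le_two (le_min (sq_nonneg _) hR)), integral_const_mul]
        rfl
    _ ≤ ENNReal.ofReal (2 * truncDist μ hstar g R) + ENNReal.ofReal (10 * b / n) * 2 := by
        gcongr; exact hM.exp_H
    _ = _ := by
        have h2 : (2 : ℝ≥0∞) = ENNReal.ofReal 2 := by simp
        rw [h2, ← ENNReal.ofReal_mul (by positivity), ← ENNReal.ofReal_add _ (by positivity)]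
        · congr 1; ring
        · exact mul_nonneg zero_le_two (integral_nonneg fun t => le_min (sq_nonneg _) hR)

/-- With probability at least `1 - 2δ`, every predictor near the finite family `hj` whose empirical
loss is at most that of `hstar` is close to `hstar` in mean square. -/
theorem IsRegressionModel.exists_event (hM : IsRegressionModel μ hstar H b N) {J : Type*}
    [Fintype J] [Nonempty J] {hj : J → Y → E} (hjm : ∀ j, Measurable (hj j))
    (hjH : ∀ j y, ‖hj j y‖ ^ 2 ≤ H y) {n : ℕ} (hn : 3 ≤ n) {δ : ℝ} (hδ : 0 < δ) :
    ∃ G : Set (Fin n → E × Y), MeasurableSet G ∧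
      (Measure.pi fun _ : Fin n => μ) Gᶜ ≤ ENNReal.ofReal (2 * δ) ∧
      ∀ s ∈ G, ∀ h : Y → E, (∀ y, ‖h y‖ ^ 2 ≤ H y) →
        ∑ i, ‖h (s i).2 - (s i).1‖ ^ 2 ≤ ∑ i, ‖hstar (s i).2 - (s i).1‖ ^ 2 →
        (∃ j, ∀ y, ‖h y - hj j y‖ ^ 2 ≤ H y / n ^ 2) →
        ∫⁻ t, ENNReal.ofReal (‖h t.2 - hstar t.2‖ ^ 2) ∂μ ≤
          ENNReal.ofReal (8 / n * ((3 * b + 4 * N) * Real.log (4 / δ) +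
            4 * b * Real.log n * (Real.log (Fintype.card J) + Real.log (1 / δ))) + 20 * b / n) := by
  have hb : 0 < b := by linarith [hM.one_le_b]
  have hN := hM.N_pos
  have hn3 : (3 : ℝ) ≤ n := by exact_mod_cast hn
  have hn0 : (0 : ℝ) < n := by linarith
  have hlog : 1 ≤ Real.log n := by
    rw [Real.le_log_iff_exp_le hn0]
    linarith [Real.exp_one_lt_d9]
  have hs := hM.hstar_measurable
  have hH := hM.H_measurable
  set R := 4 * b * Real.log n with hRdef
  have hR4 : 4 ≤ R := by
    have := mul_le_mul hM.one_le_b hlog zero_le_one hb.le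
    rw [hRdef]; linarith
  have hR0 : 0 < R := by linarith
  have hJ : (0 : ℝ) < Fintype.card J := by exact_mod_cast Fintype.card_pos
  set τ := Real.log (Fintype.card J) + Real.log (1 / δ) with hτ
  set P := Measure.pi fun _ : Fin n => μ with hP
  let T : J → ℝ := fun j => truncDist μ hstar (hj j) R
  let g : J → E × Y → ℝ := fun j t => ‖hj j t.2 - t.1‖ ^ 2 - ‖hstar t.2 - t.1‖ ^ 2
  let B : J → Set (Fin n → E × Y) := fun j =>
    {ω | ∑ i, g j (ω i) < n * (T j / 4) - τ / (1 / R)}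
  let BH : Set (Fin n → E × Y) :=
    {ω | Real.log (2 / (δ / 2)) < (n : ℝ)⁻¹ * ∑ i, H (ω i).2 / b}
  let Bv : Set (Fin n → E × Y) :=
    {ω | Real.log (2 / (δ / 2)) < (n : ℝ)⁻¹ * ∑ i, ‖(ω i).1‖ ^ 2 / (4 * N)}
  have hB : ∀ j, P (B j) ≤ ENNReal.ofReal (δ / Fintype.card J) := by
    intro j
    have hjm' := hjm j
    have h1 := measure_sum_lt_le_exp μ (G := g j) (by fun_prop) (l := 1 / R) (a := T j / 4)
      (by positivity) (hM.lintegral_exp_excess_le (hjm j) hR4) n τ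
    refine h1.trans (le_of_eq ?_)
    rw [hτ, neg_add, Real.exp_add, Real.exp_neg, Real.exp_neg, Real.exp_log hJ,
      Real.exp_log (by positivity)]
    congr 1; field_simp
  have hBH : P BH ≤ ENNReal.ofReal (δ / 2) :=
    measure_log_lt_mean_le μ (Z := fun t : E × Y => H t.2 / b) (by fun_prop) hM.exp_H
      (by omega) (by positivity)
  have hBv : P Bv ≤ ENNReal.ofReal (δ / 2) :=
    measure_log_lt_mean_le μ (Z := fun t : E × Y => ‖t.1‖ ^ 2 / (4 * N)) (by fun_prop) hM.exp_v
      (by omega) (by positivity)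
  refine ⟨(toMeasurable P ((⋃ j, B j) ∪ (BH ∪ Bv)))ᶜ, (measurableSet_toMeasurable _ _).compl, ?_, ?_⟩
  · rw [compl_compl, measure_toMeasurable]
    calc P ((⋃ j, B j) ∪ (BH ∪ Bv)) ≤ P (⋃ j, B j) + (P BH + P Bv) :=
          (measure_union_le _ _).trans (add_le_add le_rfl (measure_union_le _ _))
      _ ≤ ∑ _j : J, ENNReal.ofReal (δ / Fintype.card J) +
            (ENNReal.ofReal (δ / 2) + ENNReal.ofReal (δ / 2)) :=
          add_le_add ((measure_iUnion_fintype_le _ _).trans (Finset.sum_le_sum fun j _ => hB j))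
            (add_le_add hBH hBv)
      _ = ENNReal.ofReal (2 * δ) := by
          rw [Finset.sum_const, Finset.card_univ, nsmul_eq_mul, ← ENNReal.ofReal_natCast,
            ← ENNReal.ofReal_mul hJ.le, ← ENNReal.ofReal_add (by positivity) (by positivity),
            ← ENNReal.ofReal_add (by positivity) (by positivity)]
          congr 1; field_simp; ring
  · rintro s hsG h hhH hERM ⟨j, hj'⟩
    have hsG' : s ∉ (⋃ j, B j) ∪ (BH ∪ Bv) := fun hmem => hsG (subset_toMeasurable _ _ hmem)
    simp only [Set.mem_union, Set.mem_iUnion, not_or, not_exists] at hsG'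
    obtain ⟨hsB, hsH, hsv⟩ := hsG'
    have hsB := hsB j
    simp only [B, BH, Bv, Set.mem_ofPred_eq, not_lt] at hsB hsH hsv
    have e4 : 2 / (δ / 2) = 4 / δ := by field_simp; norm_num
    rw [e4] at hsH hsv
    refine (hM.lintegral_sq_le hn (hjm j) (hjH j) hj').trans (ENNReal.ofReal_le_ofReal ?_)
    -- replacing the net point by `h` changes each loss by at most `(3 H + ‖v‖²) / n`
    have hterm : ∀ i, ‖hj j (s i).2 - (s i).1‖ ^ 2 - ‖h (s i).2 - (s i).1‖ ^ 2 ≤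
        (n : ℝ)⁻¹ * (3 * b * (H (s i).2 / b) + 4 * N * (‖(s i).1‖ ^ 2 / (4 * N))) := by
      intro i
      set y := (s i).2
      set v := (s i).1
      have e1 : 3 * b * (H y / b) + 4 * N * (‖v‖ ^ 2 / (4 * N)) = 3 * H y + ‖v‖ ^ 2 := by
        field_simp
      rw [e1]
      have hHy : 0 ≤ H y := (sq_nonneg _).trans (hM.norm_hstar y)
      set r := √(H y) with hr
      have hr2 : r ^ 2 = H y := Real.sq_sqrt hHy
      have hr0 : 0 ≤ r := Real.sqrt_nonneg _
      have h1 : ‖hj j y‖ ≤ r := Real.le_sqrt_of_sq_le (hjH j y)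
      have h2 : ‖h y‖ ≤ r := Real.le_sqrt_of_sq_le (hhH y)
      have h3 : ‖h y - hj j y‖ ≤ r / n := by
        refine le_of_sq_le_sq ?_ (by positivity)
        rw [div_pow, hr2]; exact hj' y
      have h4 : ‖hj j y - v‖ - ‖h y - v‖ ≤ ‖h y - hj j y‖ := by
        rw [norm_sub_rev (h y) (hj j y)]
        have := norm_sub_norm_le (hj j y - v) (h y - v)
        rwa [sub_sub_sub_cancel_right] at this
      have h5 : ‖hj j y - v‖ + ‖h y - v‖ ≤ 2 * r + 2 * ‖v‖ := by
        linarith [norm_sub_le (hj j y) v, norm_sub_le (h y) v]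
      have h6 : ‖hj j y - v‖ ^ 2 - ‖h y - v‖ ^ 2 ≤ r / n * (2 * r + 2 * ‖v‖) := by
        have e2 : ‖hj j y - v‖ ^ 2 - ‖h y - v‖ ^ 2 =
          (‖hj j y - v‖ - ‖h y - v‖) * (‖hj j y - v‖ + ‖h y - v‖) := by ring
        rw [e2]
        calc _ ≤ r / n * (‖hj j y - v‖ + ‖h y - v‖) :=
              mul_le_mul_of_nonneg_right (h4.trans h3) (by positivity)
          _ ≤ _ := mul_le_mul_of_nonneg_left h5 (by positivity)
      refine h6.trans ?_
      rw [div_mul_eq_mul_div, div_eq_inv_mul]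
      refine mul_le_mul_of_nonneg_left ?_ (by positivity)
      rw [← hr2]
      nlinarith [sq_nonneg (r - ‖v‖)]
    have hsum := Finset.sum_le_sum fun i (_ : i ∈ Finset.univ) => hterm i
    rw [Finset.sum_sub_distrib, ← Finset.mul_sum, Finset.sum_add_distrib, ← Finset.mul_sum,
      ← Finset.mul_sum] at hsum
    have hgsum : ∑ i, g j (s i) = ∑ i, ‖hj j (s i).2 - (s i).1‖ ^ 2 -
        ∑ i, ‖hstar (s i).2 - (s i).1‖ ^ 2 := by
      simp only [g, Finset.sum_sub_distrib]
    rw [hgsum] at hsB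
    have hτR : τ / (1 / R) = R * τ := by field_simp
    rw [hτR] at hsB
    have h7 : (n : ℝ)⁻¹ * (3 * b * ∑ i, H (s i).2 / b + 4 * N * ∑ i, ‖(s i).1‖ ^ 2 / (4 * N)) ≤
        (3 * b + 4 * N) * Real.log (4 / δ) := by
      have h8 := mul_le_mul_of_nonneg_left hsH (by positivity : 0 ≤ 3 * b)
      have h9 := mul_le_mul_of_nonneg_left hsv (by positivity : 0 ≤ 4 * N)
      linarith
    have h10 : n * (T j / 4) ≤ (3 * b + 4 * N) * Real.log (4 / δ) + R * τ := by linarith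
    have h11 : 2 * T j ≤ 8 / n * ((3 * b + 4 * N) * Real.log (4 / δ) + R * τ) := by
      calc 2 * T j = 8 / n * (n * (T j / 4)) := by field_simp; ring
        _ ≤ _ := mul_le_mul_of_nonneg_left h10 (by positivity)
    exact add_le_add h11 le_rfl

end Regression

/-! ### Linear functionals of the noise -/

section GaussianSums

theorem map_inner_multivariateGaussian {ι : Type*} [Fintype ι] [DecidableEq ι] {S : Matrix ι ι ℝ}
    (hS : S.PosSemidef) (a : EuclideanSpace ℝ ι) :
    (multivariateGaussian 0 S).map (fun x => inner ℝ a x) =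
      gaussianReal 0 (Real.toNNReal (inner ℝ a (Matrix.toEuclideanLin S a))) := by
  have h := IsGaussian.map_eq_gaussianReal (μ := multivariateGaussian 0 S) (innerSL ℝ a)
  have hvar : Var[⇑(innerSL ℝ a); multivariateGaussian 0 S] =
      inner ℝ a (Matrix.toEuclideanLin S a) := by
    have h1 := covarianceBilin_self (μ := multivariateGaussian 0 S) IsGaussian.memLp_two_id a
    rw [covarianceBilin_multivariateGaussian hS] at h1
    have h2 : (⇑(innerSL ℝ a) : EuclideanSpace ℝ ι → ℝ) = fun u => inner ℝ a u := rfl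
    rw [h2, ← h1]
    simp [EuclideanSpace.inner_eq_star_dotProduct, Matrix.toLpLin_apply, dotProduct_comm]
  have hmean : ∫ x, innerSL ℝ a x ∂(multivariateGaussian 0 S) = 0 := by
    rw [ContinuousLinearMap.integral_comp_id_comm IsGaussian.integrable_id]
    simp
  rw [hvar, hmean] at h
  exact h

theorem map_sum_range_infinitePi {𝓧 : Type*} [MeasurableSpace 𝓧] (P : Measure 𝓧)
    [IsProbabilityMeasure P] {f : ℕ → 𝓧 → ℝ} (hf : ∀ t, Measurable (f t)) {v : ℕ → ℝ}
    (hv0 : ∀ t, 0 ≤ v t) (hv : ∀ t, P.map (f t) = gaussianReal 0 (v t).toNNReal) (T : ℕ) :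
    (Measure.infinitePi fun _ : ℕ => P).map (fun ω => ∑ t ∈ Finset.range T, f t (ω t)) =
      gaussianReal 0 (∑ t ∈ Finset.range T, v t).toNNReal := by
  have hind : iIndepFun (fun t (ω : ℕ → 𝓧) => f t (ω t)) (Measure.infinitePi fun _ : ℕ => P) :=
    iIndepFun_infinitePi hf
  have hm : ∀ t, Measurable fun ω : ℕ → 𝓧 => f t (ω t) := fun t =>
    (hf t).comp (measurable_pi_apply t)
  have hlaw : ∀ t, (Measure.infinitePi fun _ : ℕ => P).map (fun ω => f t (ω t)) =
      gaussianReal 0 (v t).toNNReal := by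
    intro t
    have h1 : (fun ω : ℕ → 𝓧 => f t (ω t)) = f t ∘ fun ω => ω t := rfl
    rw [h1, ← Measure.map_map (hf t) (measurable_pi_apply t), Measure.infinitePi_map_eval, hv]
  induction T with
  | zero => simp
  | succ T ih =>
    have h1 := hind.indepFun_finsetSum_of_notMem hm (Finset.notMem_range_self (n := T))
    have hsum : (∑ j ∈ Finset.range T, fun ω : ℕ → 𝓧 => f j (ω j)) =
        fun ω => ∑ t ∈ Finset.range T, f t (ω t) := by
      funext ω; simp
    rw [hsum] at h1
    have h2 := gaussianReal_add_gaussianReal_of_indepFun h1 ih (hlaw T)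
    rw [Finset.sum_range_succ v, Real.toNNReal_add (Finset.sum_nonneg fun t _ => hv0 t) (hv0 T)]
    rw [add_zero] at h2
    rw [← h2]
    congr 1
    funext ω
    simp [Finset.sum_range_succ]

variable {dx du : ℕ} {Y : Type*} [MeasurableSpace Y] (S : System dx du Y)

instance : IsProbabilityMeasure (noiseLaw S) := by
  unfold noiseLaw; infer_instance

theorem inner_toEuclideanLin_self_nonneg {ι : Type*} [Fintype ι] [DecidableEq ι]
    {Q : Matrix ι ι ℝ} (hQ : Q.PosSemidef) (a : EuclideanSpace ℝ ι) :
    0 ≤ inner ℝ a (Matrix.toEuclideanLin Q a) :=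
  (Matrix.isPositive_toEuclideanLin_iff.2 hQ).inner_nonneg_right a

theorem map_prod_fst {α β γ : Type*} [MeasurableSpace α] [MeasurableSpace β] [MeasurableSpace γ]
    (P : Measure α) (Q : Measure β) [IsProbabilityMeasure Q] {f : α → γ} (hf : Measurable f) :
    (P.prod Q).map (fun z => f z.1) = P.map f := by
  rw [show (fun z : α × β => f z.1) = f ∘ Prod.fst from rfl, ← Measure.map_map hf measurable_fst,
    Measure.map_fst_prod]
  simp

theorem map_prod_snd {α β γ : Type*} [MeasurableSpace α] [MeasurableSpace β] [MeasurableSpace γ]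
    (P : Measure α) (Q : Measure β) [IsProbabilityMeasure P] [SFinite Q] {f : β → γ}
    (hf : Measurable f) : (P.prod Q).map (fun z => f z.2) = Q.map f := by
  rw [show (fun z : α × β => f z.2) = f ∘ Prod.snd from rfl, ← Measure.map_map hf measurable_snd,
    Measure.map_snd_prod]
  simp

/-- The law of a linear functional of the initial state, the inputs and the process noise. -/
theorem map_functional_noiseLaw (h0 : S.Sigma0.PosSemidef) (hw : S.SigmaW.PosSemidef)
    (a : Vec dx) (b : ℕ → Vec du) (c : ℕ → Vec dx) (T : ℕ) :
    (noiseLaw S).map (fun z => inner ℝ a z.1 + (∑ t ∈ Finset.range T, inner ℝ (b t) (z.2.1 t) +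
      ∑ t ∈ Finset.range T, inner ℝ (c t) (z.2.2 t))) =
    gaussianReal 0 (Real.toNNReal (inner ℝ a (Matrix.toEuclideanLin S.Sigma0 a) +
      (∑ t ∈ Finset.range T, ‖b t‖ ^ 2 +
        ∑ t ∈ Finset.range T, inner ℝ (c t) (Matrix.toEuclideanLin S.SigmaW (c t))))) := by
  set P0 := multivariateGaussian (0 : Vec dx) S.Sigma0
  set Pu := Measure.infinitePi fun _ : ℕ =>
    multivariateGaussian 0 (1 : Matrix (Fin du) (Fin du) ℝ)
  set Pw := Measure.infinitePi fun _ : ℕ => multivariateGaussian (0 : Vec dx) S.SigmaW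
  have hlu : Pu.map (fun ω => ∑ t ∈ Finset.range T, inner ℝ (b t) (ω t)) =
      gaussianReal 0 (∑ t ∈ Finset.range T, ‖b t‖ ^ 2).toNNReal := by
    refine map_sum_range_infinitePi _ (f := fun t x => inner ℝ (b t) x)
      (fun t => by fun_prop) (fun t => by positivity) (fun t => ?_) T
    rw [map_inner_multivariateGaussian Matrix.PosSemidef.one]
    congr 2
    rw [Matrix.toLpLin_one]
    simp
  have hlw : Pw.map (fun ω => ∑ t ∈ Finset.range T, inner ℝ (c t) (ω t)) =
      gaussianReal 0 (∑ t ∈ Finset.range T,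
        inner ℝ (c t) (Matrix.toEuclideanLin S.SigmaW (c t))).toNNReal :=
    map_sum_range_infinitePi _ (f := fun t x => inner ℝ (c t) x)
      (fun t => by fun_prop) (fun t => inner_toEuclideanLin_self_nonneg hw _)
      (fun t => map_inner_multivariateGaussian hw _) T
  have hmu : Measurable fun ω : ℕ → Vec du => ∑ t ∈ Finset.range T, inner ℝ (b t) (ω t) := by
    fun_prop
  have hmw : Measurable fun ω : ℕ → Vec dx => ∑ t ∈ Finset.range T, inner ℝ (c t) (ω t) := by
    fun_prop
  have huw : (Pu.prod Pw).map (fun z => ∑ t ∈ Finset.range T, inner ℝ (b t) (z.1 t) +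
      ∑ t ∈ Finset.range T, inner ℝ (c t) (z.2 t)) =
      gaussianReal 0 (∑ t ∈ Finset.range T, ‖b t‖ ^ 2 + ∑ t ∈ Finset.range T,
        inner ℝ (c t) (Matrix.toEuclideanLin S.SigmaW (c t))).toNNReal := by
    have h1 := gaussianReal_add_gaussianReal_of_indepFun
      (indepFun_prod (μ := Pu) (ν := Pw) hmu hmw) (m₁ := 0) (m₂ := 0)
      ((map_prod_fst _ _ hmu).trans hlu)
      ((map_prod_snd _ _ hmw).trans hlw)
    rw [Real.toNNReal_add (Finset.sum_nonneg fun t _ => by positivity)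
      (Finset.sum_nonneg fun t _ => inner_toEuclideanLin_self_nonneg hw _)]
    rw [add_zero] at h1
    exact h1
  have hm0 : Measurable fun x : Vec dx => inner ℝ a x := by fun_prop
  have hmuw : Measurable fun z : (ℕ → Vec du) × (ℕ → Vec dx) =>
      ∑ t ∈ Finset.range T, inner ℝ (b t) (z.1 t) +
        ∑ t ∈ Finset.range T, inner ℝ (c t) (z.2 t) :=
    (hmu.comp measurable_fst).add (hmw.comp measurable_snd)
  have h2 := gaussianReal_add_gaussianReal_of_indepFun
      (indepFun_prod (μ := P0) (ν := Pu.prod Pw) hm0 hmuw) (m₁ := 0) (m₂ := 0)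
      ((map_prod_fst _ _ hm0).trans (map_inner_multivariateGaussian h0 a))
      ((map_prod_snd _ _ hmuw).trans huw)
  rw [Real.toNNReal_add (inner_toEuclideanLin_self_nonneg h0 _)
    (add_nonneg (Finset.sum_nonneg fun t _ => by positivity)
      (Finset.sum_nonneg fun t _ => inner_toEuclideanLin_self_nonneg hw _))]
  rw [add_zero] at h2
  exact h2

end GaussianSums

/-! ### The joint law of the inputs and the state -/

section JointLaw

variable {dx du : ℕ} {Y : Type*} [MeasurableSpace Y] (S : System dx du Y)

theorem state_eq (z : Noise dx du) (T : ℕ) :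
    state S z T = Matrix.toEuclideanLin (S.A ^ T) z.1 + ∑ t ∈ Finset.range T,
      Matrix.toEuclideanLin (S.A ^ (T - 1 - t)) (Matrix.toEuclideanLin S.B (z.2.1 t) + z.2.2 t) := by
  induction T with
  | zero => simp [state, Matrix.toLpLin_one]
  | succ T ih =>
    rw [state, ih, map_add, map_sum, Finset.sum_range_succ, ← toEuclideanLin_mul, ← pow_succ']
    have h1 : ∑ t ∈ Finset.range T, Matrix.toEuclideanLin S.A (Matrix.toEuclideanLin
          (S.A ^ (T - 1 - t)) (Matrix.toEuclideanLin S.B (z.2.1 t) + z.2.2 t)) =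
        ∑ t ∈ Finset.range T, Matrix.toEuclideanLin (S.A ^ (T + 1 - 1 - t))
          (Matrix.toEuclideanLin S.B (z.2.1 t) + z.2.2 t) := by
      refine Finset.sum_congr rfl fun t ht => ?_
      rw [← toEuclideanLin_mul, ← pow_succ']
      have := Finset.mem_range.1 ht
      congr 3; omega
    rw [h1]
    simp [Matrix.toLpLin_one, add_assoc]

theorem measurable_state (T : ℕ) : Measurable fun z : Noise dx du => state S z T := by
  induction T with
  | zero => exact measurable_fst
  | succ T ih =>
    have hA : Continuous (Matrix.toEuclideanLin S.A) := LinearMap.continuous_of_finiteDimensional _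
    have hB : Continuous (Matrix.toEuclideanLin S.B) := LinearMap.continuous_of_finiteDimensional _
    have h1 : Measurable fun z : Noise dx du => z.2.1 T := by fun_prop
    have h2 : Measurable fun z : Noise dx du => z.2.2 T := by fun_prop
    exact ((hA.measurable.comp ih).add (hB.measurable.comp h1)).add h2

theorem measurable_inputStack (κ₀ κ : ℕ) :
    Measurable fun z : Noise dx du => inputStack κ₀ κ z := by
  unfold inputStack
  refine (WithLp.measurable_toLp 2 _).comp (measurable_pi_lambda _ fun jb => ?_)
  fun_prop

/-- The covariance matrix of the state `x_T`. -/
noncomputable def stateCov (T : ℕ) : Matrix (Fin dx) (Fin dx) ℝ :=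
  S.A ^ T * S.Sigma0 * (S.A ^ T)ᵀ + ∑ t ∈ Finset.range T,
    (S.A ^ (T - 1 - t) * (S.B * S.Bᵀ + S.SigmaW) * (S.A ^ (T - 1 - t))ᵀ)

theorem inner_stateCov (T : ℕ) (a : Vec dx) :
    inner ℝ a (Matrix.toEuclideanLin (stateCov S T) a) =
      inner ℝ (Matrix.toEuclideanLin (S.A ^ T)ᵀ a)
        (Matrix.toEuclideanLin S.Sigma0 (Matrix.toEuclideanLin (S.A ^ T)ᵀ a)) +
      (∑ t ∈ Finset.range T, ‖Matrix.toEuclideanLin S.Bᵀ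
          (Matrix.toEuclideanLin (S.A ^ (T - 1 - t))ᵀ a)‖ ^ 2 +
        ∑ t ∈ Finset.range T, inner ℝ (Matrix.toEuclideanLin (S.A ^ (T - 1 - t))ᵀ a)
          (Matrix.toEuclideanLin S.SigmaW (Matrix.toEuclideanLin (S.A ^ (T - 1 - t))ᵀ a))) := by
  have hadj : ∀ (M : Matrix (Fin dx) (Fin dx) ℝ) (x y : Vec dx),
      inner ℝ x (Matrix.toEuclideanLin M y) = inner ℝ (Matrix.toEuclideanLin Mᵀ x) y := by
    intro M x y
    rw [← inner_toEuclideanLin_transpose, Matrix.transpose_transpose]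
  have hB : ∀ x : Vec dx, inner ℝ x (Matrix.toEuclideanLin (S.B * S.Bᵀ) x) =
      ‖Matrix.toEuclideanLin S.Bᵀ x‖ ^ 2 := by
    intro x
    rw [toEuclideanLin_mul, ← real_inner_self_eq_norm_sq, ← inner_toEuclideanLin_transpose,
      Matrix.transpose_transpose]
  rw [stateCov, map_add, map_sum, LinearMap.add_apply, LinearMap.sum_apply, inner_add_right,
    inner_sum, ← Finset.sum_add_distrib]
  congr 1
  · rw [toEuclideanLin_mul, toEuclideanLin_mul, hadj]
  · refine Finset.sum_congr rfl fun t _ => ?_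
    rw [toEuclideanLin_mul, toEuclideanLin_mul, hadj, map_add, LinearMap.add_apply,
      inner_add_right, hB]

theorem isSymm_stateCov (h0 : S.Sigma0.PosSemidef) (hw : S.SigmaW.PosSemidef) (T : ℕ) :
    (stateCov S T)ᵀ = stateCov S T := by
  have e0 : S.Sigma0ᵀ = S.Sigma0 := by
    have := h0.isHermitian; rwa [Matrix.IsHermitian,
      Matrix.conjTranspose_eq_transpose_of_trivial] at this
  have ew : S.SigmaWᵀ = S.SigmaW := by
    have := hw.isHermitian; rwa [Matrix.IsHermitian,
      Matrix.conjTranspose_eq_transpose_of_trivial] at this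
  simp only [stateCov, Matrix.transpose_add, Matrix.transpose_sum, Matrix.transpose_mul,
    Matrix.transpose_transpose, e0, ew, Matrix.mul_assoc]

/-- The coefficient of the input `u_t` in `⟪r, v⟫`, where `v` stacks the inputs from time `κ₀`. -/
noncomputable def stackCoeff {κ : ℕ} (κ₀ : ℕ) (r : Stack κ du) (t : ℕ) : Vec du :=
  WithLp.toLp 2 fun b => if h : κ₀ ≤ t ∧ t - κ₀ < κ then r (⟨t - κ₀, h.2⟩, b) else 0

theorem stackCoeff_of_lt {κ κ₀ : ℕ} (r : Stack κ du) {t : ℕ} (h : t < κ₀) :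
    stackCoeff κ₀ r t = 0 := by
  ext b
  simp only [stackCoeff, PiLp.zero_apply]
  rw [dif_neg (by omega)]

theorem stackCoeff_add {κ κ₀ : ℕ} (r : Stack κ du) (j : Fin κ) (b : Fin du) :
    stackCoeff κ₀ r (κ₀ + j) b = r (j, b) := by
  simp only [stackCoeff]
  rw [dif_pos ⟨by omega, by omega⟩]
  simp

/-- Sums against the coefficients of a stacked vector are inner products of stacked vectors. -/
theorem sum_inner_stackCoeff {κ κ₀ : ℕ} (r : Stack κ du) (g : ℕ → Vec du) :
    ∑ t ∈ Finset.range (κ₀ + κ), inner ℝ (stackCoeff κ₀ r t) (g t) =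
      inner ℝ r (WithLp.toLp 2 fun jb => g (κ₀ + (jb.1 : ℕ)) jb.2 : Stack κ du) := by
  rw [Finset.sum_range_add, Finset.sum_eq_zero, zero_add, Finset.sum_range]
  · simp only [PiLp.inner_apply, stackCoeff_add, Fintype.sum_prod_type]
  · intro t ht
    rw [stackCoeff_of_lt r (Finset.mem_range.1 ht), inner_zero_left]

theorem sum_norm_stackCoeff {κ κ₀ : ℕ} (r : Stack κ du) :
    ∑ t ∈ Finset.range (κ₀ + κ), ‖stackCoeff κ₀ r t‖ ^ 2 = ‖r‖ ^ 2 := by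
  simp_rw [← real_inner_self_eq_norm_sq]
  rw [sum_inner_stackCoeff]
  congr 1
  ext jb
  exact stackCoeff_add r jb.1 jb.2

theorem toLp_ctrb_transpose (κ₀ κ : ℕ) (a : Vec dx) :
    (WithLp.toLp 2 fun jb => Matrix.toEuclideanLin S.Bᵀ (Matrix.toEuclideanLin
      (S.A ^ (κ₀ + κ - 1 - (κ₀ + (jb.1 : ℕ))))ᵀ a) jb.2 : Stack κ du) =
      Matrix.toEuclideanLin (ctrb S.A S.B κ)ᵀ a := by
  ext jb
  change Matrix.toEuclideanLin S.Bᵀ (Matrix.toEuclideanLin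
      (S.A ^ (κ₀ + κ - 1 - (κ₀ + (jb.1 : ℕ))))ᵀ a) jb.2 = _
  rw [← toEuclideanLin_mul, ← Matrix.transpose_mul,
    show κ₀ + κ - 1 - (κ₀ + (jb.1 : ℕ)) = κ - 1 - jb.1 by omega]
  rfl

/-- The law of every linear functional of `(v, x_{κ₀ + κ})`. -/
theorem map_inner_add_inner (h0 : S.Sigma0.PosSemidef) (hw : S.SigmaW.PosSemidef) (κ₀ κ : ℕ)
    (r : Stack κ du) (a : Vec dx) :
    (noiseLaw S).map (fun z => inner ℝ r (inputStack κ₀ κ z) + inner ℝ a (state S z (κ₀ + κ))) =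
      gaussianReal 0 (Real.toNNReal (inner ℝ a (Matrix.toEuclideanLin (stateCov S (κ₀ + κ)) a) +
        ‖r‖ ^ 2 + 2 * inner ℝ r (Matrix.toEuclideanLin (ctrb S.A S.B κ)ᵀ a))) := by
  set T := κ₀ + κ with hT
  set c : ℕ → Vec dx := fun t => Matrix.toEuclideanLin (S.A ^ (T - 1 - t))ᵀ a with hc
  set b : ℕ → Vec du := fun t => Matrix.toEuclideanLin S.Bᵀ (c t) + stackCoeff κ₀ r t with hb
  have h := map_functional_noiseLaw S h0 hw (Matrix.toEuclideanLin (S.A ^ T)ᵀ a) b c T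
  have hadj : ∀ (M : Matrix (Fin dx) (Fin dx) ℝ) (x y : Vec dx),
      inner ℝ x (Matrix.toEuclideanLin M y) = inner ℝ (Matrix.toEuclideanLin Mᵀ x) y := by
    intro M x y
    rw [← inner_toEuclideanLin_transpose, Matrix.transpose_transpose]
  have hadjB : ∀ (x : Vec dx) (y : Vec du),
      inner ℝ x (Matrix.toEuclideanLin S.B y) = inner ℝ (Matrix.toEuclideanLin S.Bᵀ x) y := by
    intro x y
    rw [← inner_toEuclideanLin_transpose, Matrix.transpose_transpose]
  have e1 : (fun z : Noise dx du => inner ℝ r (inputStack κ₀ κ z) + inner ℝ a (state S z T)) =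
      fun z => inner ℝ (Matrix.toEuclideanLin (S.A ^ T)ᵀ a) z.1 +
        (∑ t ∈ Finset.range T, inner ℝ (b t) (z.2.1 t) +
          ∑ t ∈ Finset.range T, inner ℝ (c t) (z.2.2 t)) := by
    funext z
    have h1 := sum_inner_stackCoeff (κ₀ := κ₀) r z.2.1
    rw [state_eq, inner_add_right, inner_sum, inputStack, ← h1, hadj]
    simp_rw [hadj, inner_add_right, hadjB, Finset.sum_add_distrib, hb, inner_add_left,
      Finset.sum_add_distrib, hc]
    ring
  have e2 : inner ℝ (Matrix.toEuclideanLin (S.A ^ T)ᵀ a)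
        (Matrix.toEuclideanLin S.Sigma0 (Matrix.toEuclideanLin (S.A ^ T)ᵀ a)) +
      (∑ t ∈ Finset.range T, ‖b t‖ ^ 2 +
        ∑ t ∈ Finset.range T, inner ℝ (c t) (Matrix.toEuclideanLin S.SigmaW (c t))) =
      inner ℝ a (Matrix.toEuclideanLin (stateCov S T) a) +
        ‖r‖ ^ 2 + 2 * inner ℝ r (Matrix.toEuclideanLin (ctrb S.A S.B κ)ᵀ a) := by
    rw [inner_stateCov]
    have h1 := sum_inner_stackCoeff (κ₀ := κ₀) r fun t => Matrix.toEuclideanLin S.Bᵀ (c t)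
    have h2 := toLp_ctrb_transpose S κ₀ κ a
    simp only [hc, hT] at h1
    rw [h2] at h1
    have h3 : ∑ t ∈ Finset.range T, ‖b t‖ ^ 2 = ∑ t ∈ Finset.range T,
        ‖Matrix.toEuclideanLin S.Bᵀ (c t)‖ ^ 2 + ‖r‖ ^ 2 +
        2 * inner ℝ r (Matrix.toEuclideanLin (ctrb S.A S.B κ)ᵀ a) := by
      rw [← h1, ← sum_norm_stackCoeff (κ₀ := κ₀) r, Finset.mul_sum, ← Finset.sum_add_distrib,
        ← Finset.sum_add_distrib]
      refine Finset.sum_congr rfl fun t _ => ?_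
      simp only [hb, norm_add_sq_real, hc, hT, real_inner_comm (stackCoeff κ₀ r t)]
      ring
    rw [h3]
    ring
  rw [e1, h, e2]

/-- The part of the state covariance due to the stacked inputs and the last process noise. -/
theorem norm_ctrb_add_le_inner_stateCov (h0 : S.Sigma0.PosSemidef) (hw : S.SigmaW.PosSemidef)
    (κ₀ : ℕ) {κ : ℕ} (hκ : 0 < κ) (a : Vec dx) :
    ‖Matrix.toEuclideanLin (ctrb S.A S.B κ)ᵀ a‖ ^ 2 +
      inner ℝ a (Matrix.toEuclideanLin S.SigmaW a) ≤
      inner ℝ a (Matrix.toEuclideanLin (stateCov S (κ₀ + κ)) a) := by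
  rw [inner_stateCov]
  set T := κ₀ + κ with hT
  have h1 := inner_toEuclideanLin_self_nonneg h0 (Matrix.toEuclideanLin (S.A ^ T)ᵀ a)
  have h2 : ‖Matrix.toEuclideanLin (ctrb S.A S.B κ)ᵀ a‖ ^ 2 ≤ ∑ t ∈ Finset.range T,
      ‖Matrix.toEuclideanLin S.Bᵀ (Matrix.toEuclideanLin (S.A ^ (T - 1 - t))ᵀ a)‖ ^ 2 := by
    rw [← toLp_ctrb_transpose S κ₀ κ a, hT, Finset.sum_range_add, EuclideanSpace.norm_sq_eq,
      Fintype.sum_prod_type]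
    refine le_add_of_nonneg_of_le (Finset.sum_nonneg fun _ _ => sq_nonneg _) (le_of_eq ?_)
    rw [Finset.sum_range]
    refine Finset.sum_congr rfl fun j _ => ?_
    rw [EuclideanSpace.norm_sq_eq]
  have h3 : inner ℝ a (Matrix.toEuclideanLin S.SigmaW a) ≤ ∑ t ∈ Finset.range T,
      inner ℝ (Matrix.toEuclideanLin (S.A ^ (T - 1 - t))ᵀ a)
        (Matrix.toEuclideanLin S.SigmaW (Matrix.toEuclideanLin (S.A ^ (T - 1 - t))ᵀ a)) := by
    have h4 := Finset.single_le_sum (f := fun t =>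
      inner ℝ (Matrix.toEuclideanLin (S.A ^ (T - 1 - t))ᵀ a)
        (Matrix.toEuclideanLin S.SigmaW (Matrix.toEuclideanLin (S.A ^ (T - 1 - t))ᵀ a)))
      (fun t _ => inner_toEuclideanLin_self_nonneg hw _)
      (Finset.mem_range.2 (by omega : T - 1 < T))
    simpa [Matrix.toLpLin_one] using h4
  linarith

/-- Strong stability: powers of `A` decay geometrically. -/
theorem StronglyStable.norm_pow_le {A : Matrix (Fin dx) (Fin dx) ℝ} {α γ : ℝ}
    (h : StronglyStable A α γ) (hα : 0 ≤ α) (hdx : 0 < dx) (k : ℕ) :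
    ‖A ^ k‖ ≤ α * γ ^ k := by
  obtain ⟨-, Q, hQ, hα', hγ'⟩ := h
  have hdet : IsUnit Q.det := (Matrix.isUnit_iff_isUnit_det Q).1 hQ
  have hQ1 : Q * Q⁻¹ = 1 := Matrix.mul_nonsing_inv Q hdet
  have hQ2 : Q⁻¹ * Q = 1 := Matrix.nonsing_inv_mul Q hdet
  have hpow : A ^ k = Q * (Q⁻¹ * A * Q) ^ k * Q⁻¹ := by
    induction k with
    | zero => simp [hQ1]
    | succ k ih =>
      rw [pow_succ, ih, pow_succ]
      simp only [Matrix.mul_assoc, hQ1, Matrix.mul_one]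
  have : NeZero dx := ⟨hdx.ne'⟩
  have hX : ‖(Q⁻¹ * A * Q) ^ k‖ ≤ γ ^ k :=
    (_root_.norm_pow_le _ k).trans (pow_le_pow_left₀ (norm_nonneg _) hγ' k)
  rw [hpow]
  calc ‖Q * (Q⁻¹ * A * Q) ^ k * Q⁻¹‖ ≤ ‖Q‖ * ‖(Q⁻¹ * A * Q) ^ k‖ * ‖Q⁻¹‖ :=
        (norm_mul_le _ _).trans (mul_le_mul_of_nonneg_right (norm_mul_le _ _) (norm_nonneg _))
    _ = (‖Q‖ * ‖Q⁻¹‖) * ‖(Q⁻¹ * A * Q) ^ k‖ := by ring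
    _ ≤ α * γ ^ k := mul_le_mul hα' hX (norm_nonneg _) hα

theorem norm_transpose_eq {m n : Type*} [Fintype m] [Fintype n] [DecidableEq m] [DecidableEq n]
    (M : Matrix m n ℝ) : ‖Mᵀ‖ = ‖M‖ := by
  rw [← Matrix.conjTranspose_eq_transpose_of_trivial, Matrix.l2_opNorm_conjTranspose]

theorem inner_toEuclideanLin_self_le {ι : Type*} [Fintype ι] [DecidableEq ι] (Q : Matrix ι ι ℝ)
    (a : EuclideanSpace ℝ ι) : inner ℝ a (Matrix.toEuclideanLin Q a) ≤ ‖Q‖ * ‖a‖ ^ 2 := by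
  calc inner ℝ a (Matrix.toEuclideanLin Q a) ≤ ‖a‖ * ‖Matrix.toEuclideanLin Q a‖ :=
        real_inner_le_norm _ _
    _ ≤ ‖a‖ * (‖Q‖ * ‖a‖) :=
        mul_le_mul_of_nonneg_left (norm_toEuclideanLin_le _ _) (norm_nonneg _)
    _ = _ := by ring

theorem inner_stateCov_le {p : Params} {fstar : Y → Vec dx} {F : Finset (Y → Vec dx)}
    (h : Assumptions S p fstar F) (T : ℕ) (a : Vec dx) :
    inner ℝ a (Matrix.toEuclideanLin (stateCov S T) a) ≤
      2 * p.Psi ^ 2 * p.alpha ^ 2 / (1 - p.gamma) * ‖a‖ ^ 2 := by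
  have hγ := h.gamma_mem
  have hΨ := h.one_le_Psi
  have hα := h.one_le_alpha
  have hγ0 : 0 ≤ p.gamma := hγ.1.le
  have hγ1 : 0 < 1 - p.gamma := by linarith [hγ.2]
  have hpow : ∀ k, ‖Matrix.toEuclideanLin (S.A ^ k)ᵀ a‖ ^ 2 ≤
      p.alpha ^ 2 * ‖a‖ ^ 2 * p.gamma ^ k := by
    intro k
    have h1 : ‖Matrix.toEuclideanLin (S.A ^ k)ᵀ a‖ ≤ p.alpha * p.gamma ^ k * ‖a‖ := by
      refine (norm_toEuclideanLin_le _ _).trans (mul_le_mul_of_nonneg_right ?_ (norm_nonneg _))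
      rw [norm_transpose_eq]
      exact h.stable.norm_pow_le (by linarith) h.dx_pos k
    have h2 : p.gamma ^ k * p.gamma ^ k ≤ p.gamma ^ k := by
      have := pow_le_one₀ (n := k) hγ0 hγ.2.le
      have h0 := pow_nonneg hγ0 k
      nlinarith
    calc _ ≤ (p.alpha * p.gamma ^ k * ‖a‖) ^ 2 := pow_le_pow_left₀ (norm_nonneg _) h1 2
      _ = p.alpha ^ 2 * ‖a‖ ^ 2 * (p.gamma ^ k * p.gamma ^ k) := by ring
      _ ≤ _ := mul_le_mul_of_nonneg_left h2 (by positivity)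
  rw [inner_stateCov]
  set D := p.alpha ^ 2 * ‖a‖ ^ 2 with hD
  have hD0 : 0 ≤ D := by positivity
  have hΨ2 : p.Psi ≤ p.Psi ^ 2 := by nlinarith
  have t0 : inner ℝ (Matrix.toEuclideanLin (S.A ^ T)ᵀ a)
        (Matrix.toEuclideanLin S.Sigma0 (Matrix.toEuclideanLin (S.A ^ T)ᵀ a)) ≤
      2 * p.Psi ^ 2 * D * p.gamma ^ T := by
    refine (inner_toEuclideanLin_self_le _ _).trans ?_
    calc _ ≤ p.Psi * (D * p.gamma ^ T) :=
          mul_le_mul h.norm_Sigma0 (hpow T) (by positivity) (by linarith)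
      _ ≤ 2 * p.Psi ^ 2 * (D * p.gamma ^ T) :=
          mul_le_mul_of_nonneg_right (by linarith [sq_nonneg p.Psi]) (by positivity)
      _ = _ := by ring
  have t1 : ∀ t ∈ Finset.range T, ‖Matrix.toEuclideanLin S.Bᵀ
      (Matrix.toEuclideanLin (S.A ^ (T - 1 - t))ᵀ a)‖ ^ 2 +
      inner ℝ (Matrix.toEuclideanLin (S.A ^ (T - 1 - t))ᵀ a)
          (Matrix.toEuclideanLin S.SigmaW (Matrix.toEuclideanLin (S.A ^ (T - 1 - t))ᵀ a)) ≤
      2 * p.Psi ^ 2 * D * p.gamma ^ (T - 1 - t) := by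
    intro t _
    set w := Matrix.toEuclideanLin (S.A ^ (T - 1 - t))ᵀ a with hw
    have h1 : ‖Matrix.toEuclideanLin S.Bᵀ w‖ ≤ p.Psi * ‖w‖ := by
      refine (norm_toEuclideanLin_le _ _).trans (mul_le_mul_of_nonneg_right ?_ (norm_nonneg _))
      rw [norm_transpose_eq]; exact h.norm_B
    have h2 : ‖Matrix.toEuclideanLin S.Bᵀ w‖ ^ 2 ≤ p.Psi ^ 2 * ‖w‖ ^ 2 := by
      rw [← mul_pow]; exact pow_le_pow_left₀ (norm_nonneg _) h1 2
    have h3 : inner ℝ w (Matrix.toEuclideanLin S.SigmaW w) ≤ p.Psi ^ 2 * ‖w‖ ^ 2 :=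
      (inner_toEuclideanLin_self_le _ _).trans
        (mul_le_mul_of_nonneg_right (h.norm_SigmaW.trans hΨ2) (by positivity))
    have h4 := mul_le_mul_of_nonneg_left (hpow (T - 1 - t))
      (by positivity : 0 ≤ 2 * p.Psi ^ 2)
    rw [← hw] at h4
    linarith
  have t2 := Finset.sum_le_sum t1
  rw [Finset.sum_add_distrib, ← Finset.mul_sum,
    Finset.sum_range_reflect (fun k => p.gamma ^ k) T] at t2
  -- the geometric series `1 + γ + ⋯ + γ ^ T`
  have t3 : ∑ k ∈ Finset.range T, p.gamma ^ k + p.gamma ^ T ≤ (1 - p.gamma)⁻¹ := by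
    rw [← Finset.sum_range_succ, ← one_div, le_div_iff₀ hγ1, geom_sum_mul_neg]
    linarith [pow_nonneg hγ0 (T + 1)]
  have t4 := mul_le_mul_of_nonneg_left t3 (by positivity : 0 ≤ 2 * p.Psi ^ 2 * D)
  have e : 2 * p.Psi ^ 2 * p.alpha ^ 2 / (1 - p.gamma) * ‖a‖ ^ 2 =
      2 * p.Psi ^ 2 * D * (1 - p.gamma)⁻¹ := by rw [hD]; ring
  rw [e]
  linarith

end JointLaw

/-! ### Exponential moments of Gaussian vectors -/

section GaussianMoments

theorem lintegral_exp_sq_gaussianReal_le {v s : ℝ} (hv : 0 ≤ v) (hvs : v ≤ s) :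
    ∫⁻ x, ENNReal.ofReal (Real.exp (x ^ 2 / (4 * s))) ∂(gaussianReal 0 v.toNNReal) ≤
      ENNReal.ofReal √2 := by
  rcases hv.eq_or_lt with rfl | hv0
  · rw [Real.toNNReal_zero, gaussianReal_zero_var, lintegral_dirac' _ (by fun_prop)]
    refine ENNReal.ofReal_le_ofReal ?_
    simp only [ne_eq, OfNat.ofNat_ne_zero, not_false_eq_true, zero_pow, zero_div, Real.exp_zero]
    rw [Real.one_le_sqrt]; norm_num
  · have hne : v.toNNReal ≠ 0 := by simpa using hv0
    rw [gaussianReal_of_var_ne_zero 0 hne,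
      lintegral_withDensity_eq_lintegral_mul _ (measurable_gaussianPDF _ _) (by fun_prop)]
    have hint : Integrable (fun x : ℝ => (√(2 * Real.pi * v))⁻¹ *
        Real.exp (-(1 / (4 * v)) * x ^ 2)) :=
      (integrable_exp_neg_mul_sq (by positivity)).const_mul _
    calc ∫⁻ x, (gaussianPDF 0 v.toNNReal *
          fun x => ENNReal.ofReal (Real.exp (x ^ 2 / (4 * s)))) x
        ≤ ∫⁻ x, ENNReal.ofReal ((√(2 * Real.pi * v))⁻¹ *
            Real.exp (-(1 / (4 * v)) * x ^ 2)) := by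
          refine lintegral_mono fun x => ?_
          rw [Pi.mul_apply, gaussianPDF, ← ENNReal.ofReal_mul (gaussianPDFReal_nonneg _ _ _)]
          refine ENNReal.ofReal_le_ofReal ?_
          rw [gaussianPDFReal_def, Real.coe_toNNReal _ hv, mul_assoc, ← Real.exp_add]
          refine mul_le_mul_of_nonneg_left (Real.exp_le_exp.2 ?_) (by positivity)
          have h1 : x ^ 2 / (4 * s) ≤ x ^ 2 / (4 * v) :=
            div_le_div_of_nonneg_left (sq_nonneg x) (by positivity) (by linarith)
          have h2 : -(x - 0) ^ 2 / (2 * v) + x ^ 2 / (4 * v) = -(1 / (4 * v)) * x ^ 2 := by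
            field_simp; ring
          linarith
      _ = ENNReal.ofReal √2 := by
          rw [← ofReal_integral_eq_lintegral_ofReal hint
            (Filter.Eventually.of_forall fun x => by positivity), integral_const_mul,
            integral_gaussian]
          congr 1
          rw [← Real.sqrt_inv, ← Real.sqrt_mul (by positivity)]
          congr 1
          field_simp; norm_num

theorem lintegral_exp_gaussianReal (w : NNReal) :
    ∫⁻ x, ENNReal.ofReal (Real.exp x) ∂(gaussianReal 0 w) =
      ENNReal.ofReal (Real.exp (w / 2)) := by
  have h := integrable_exp_mul_gaussianReal (μ := 0) (v := w) 1
  simp only [one_mul] at h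
  rw [← ofReal_integral_eq_lintegral_ofReal h
    (Filter.Eventually.of_forall fun x => (Real.exp_pos x).le)]
  have h2 := congrFun (mgf_fun_id_gaussianReal (μ := 0) (v := w)) 1
  simp only [mgf, one_mul] at h2
  rw [h2]; simp

theorem lintegral_sq_gaussianReal (w : NNReal) :
    ∫⁻ x, ENNReal.ofReal (x ^ 2) ∂(gaussianReal 0 w) = w := by
  have hmem := memLp_id_gaussianReal (μ := 0) (v := w) 2
  have hint : Integrable (fun x : ℝ => x ^ 2) (gaussianReal 0 w) := hmem.integrable_sq
  rw [← ofReal_integral_eq_lintegral_ofReal hint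
    (Filter.Eventually.of_forall fun x => sq_nonneg x)]
  have hvar := variance_fun_id_gaussianReal (μ := 0) (v := w)
  rw [variance_of_integral_eq_zero (by fun_prop) (by simp)] at hvar
  rw [hvar, ENNReal.ofReal_coe_nnreal]

/-- The squared norm of a centred Gaussian vector in dimension `d` with covariance at most `s` has
an exponential moment at scale `4 d s`, by convexity from the one-dimensional case. -/
theorem lintegral_exp_norm_sq_le {Ω ι : Type*} [MeasurableSpace Ω] [Fintype ι] [Nonempty ι]
    (P : Measure Ω) {X : Ω → EuclideanSpace ℝ ι} (hX : Measurable X) {s : ℝ} (hs : 0 < s)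
    {V : EuclideanSpace ℝ ι → ℝ} (hV0 : ∀ a, 0 ≤ V a) (hVs : ∀ a, V a ≤ s * ‖a‖ ^ 2)
    (hlaw : ∀ a, P.map (fun ω => inner ℝ a (X ω)) = gaussianReal 0 (V a).toNNReal) :
    ∫⁻ ω, ENNReal.ofReal (Real.exp (‖X ω‖ ^ 2 / (4 * Fintype.card ι * s))) ∂P ≤
      ENNReal.ofReal √2 := by
  classical
  set d : ℝ := (Fintype.card ι : ℝ) with hd
  have hd0 : 0 < d := by rw [hd]; exact_mod_cast Fintype.card_pos
  have hpt : ∀ ω, Real.exp (‖X ω‖ ^ 2 / (4 * d * s)) ≤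
      ∑ i, d⁻¹ * Real.exp ((X ω i) ^ 2 / (4 * s)) := by
    intro ω
    have h2 := convexOn_exp.map_sum_le (t := Finset.univ) (w := fun _ : ι => d⁻¹)
      (p := fun i => (X ω i) ^ 2 / (4 * s)) (fun _ _ => by positivity)
      (by simp [hd]) (fun _ _ => Set.mem_univ _)
    simp only [smul_eq_mul] at h2
    refine le_trans (le_of_eq ?_) h2
    rw [EuclideanSpace.norm_sq_eq, ← Finset.mul_sum, ← Finset.sum_div]
    simp only [Real.norm_eq_abs, sq_abs]
    congr 1; field_simp
  have hcoord : ∀ i, ∫⁻ ω, ENNReal.ofReal (Real.exp ((X ω i) ^ 2 / (4 * s))) ∂P ≤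
      ENNReal.ofReal √2 := by
    intro i
    have h1 := hlaw (EuclideanSpace.single i 1)
    have h2 : (fun ω => inner ℝ (EuclideanSpace.single i (1 : ℝ)) (X ω)) = fun ω => X ω i := by
      funext ω; simp [EuclideanSpace.inner_single_left]
    rw [h2] at h1
    have hm : Measurable fun ω => X ω i := by fun_prop
    have h3 := lintegral_exp_sq_gaussianReal_le (hV0 (EuclideanSpace.single i 1)) (s := s)
      (by simpa using hVs (EuclideanSpace.single i 1))
    rw [← h1, lintegral_map (by fun_prop) hm] at h3
    exact h3
  calc ∫⁻ ω, ENNReal.ofReal (Real.exp (‖X ω‖ ^ 2 / (4 * d * s))) ∂P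
      ≤ ∫⁻ ω, ∑ i, ENNReal.ofReal d⁻¹ * ENNReal.ofReal (Real.exp ((X ω i) ^ 2 / (4 * s))) ∂P := by
        refine lintegral_mono fun ω => ?_
        simp_rw [← ENNReal.ofReal_mul (inv_nonneg.2 hd0.le)]
        rw [← ENNReal.ofReal_sum_of_nonneg fun i _ => by positivity]
        exact ENNReal.ofReal_le_ofReal (hpt ω)
    _ = ∑ i, ENNReal.ofReal d⁻¹ * ∫⁻ ω, ENNReal.ofReal (Real.exp ((X ω i) ^ 2 / (4 * s))) ∂P := by
        rw [lintegral_finsetSum _ (fun i _ => by fun_prop)]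
        exact Finset.sum_congr rfl fun i _ => lintegral_const_mul _ (by fun_prop)
    _ ≤ ∑ _i : ι, ENNReal.ofReal d⁻¹ * ENNReal.ofReal √2 :=
        Finset.sum_le_sum fun i _ => mul_le_mul_right (hcoord i) _
    _ = ENNReal.ofReal √2 := by
        rw [Finset.sum_const, Finset.card_univ, nsmul_eq_mul, ← mul_assoc,
          ← ENNReal.ofReal_natCast, ← ENNReal.ofReal_mul (by positivity), ← hd,
          mul_inv_cancel₀ hd0.ne']
        simp

end GaussianMoments

/-! ### Gaussian regression: the residual is independent of the regressor -/

section Residual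

variable {Ω E X : Type*} [MeasurableSpace Ω] {P : Measure Ω} [NormedAddCommGroup E]
  [InnerProductSpace ℝ E] [FiniteDimensional ℝ E] [MeasurableSpace E] [NormedAddCommGroup X]
  [InnerProductSpace ℝ X] [FiniteDimensional ℝ X] [MeasurableSpace X]

theorem integral_cexp_of_map_eq {L : Ω → ℝ} (hL : Measurable L) {w : NNReal}
    (h : P.map L = gaussianReal 0 w) :
    ∫ ω, Complex.exp (L ω * Complex.I) ∂P = Complex.exp (-(w : ℂ) / 2) := by
  have h1 := charFun_gaussianReal (μ := 0) (v := w) 1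
  rw [← h, charFun_apply_real, integral_map hL.aemeasurable (by fun_prop)] at h1
  simp only [Complex.ofReal_one, one_mul] at h1
  rw [h1]
  congr 1
  simp; ring

variable {v : Ω → E} {x : Ω → X} {S Sinv : X →ₗ[ℝ] X} {C : E →ₗ[ℝ] X}

/-- Data describing a centred Gaussian pair `(v, x)` with `v` standard, `x` of covariance `S` and
cross-covariance `C`, through the laws of its linear functionals. -/
structure IsGaussianPair (P : Measure Ω) (v : Ω → E) (x : Ω → X) (S Sinv : X →ₗ[ℝ] X)
    (C : E →ₗ[ℝ] X) : Prop where
  measurable_v : Measurable v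
  measurable_x : Measurable x
  pos : S.IsPositive
  S_Sinv : ∀ a, S (Sinv a) = a
  adjoint_le : ∀ a, ‖LinearMap.adjoint C a‖ ^ 2 ≤ inner ℝ a (S a)
  law : ∀ r a, P.map (fun ω => inner ℝ r (v ω) + inner ℝ a (x ω)) = gaussianReal 0
    (Real.toNNReal (inner ℝ a (S a) + ‖r‖ ^ 2 + 2 * inner ℝ r (LinearMap.adjoint C a)))

theorem IsGaussianPair.inner_Sinv (h : IsGaussianPair P v x S Sinv C) (a b : X) : inner ℝ (Sinv a) b = inner ℝ a (Sinv b) := by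
  have h1 := h.pos.isSymmetric (Sinv a) (Sinv b)
  rw [h.S_Sinv, h.S_Sinv] at h1
  exact h1.symm

/-- The variance of `⟪t, v - E[v | x]⟫`. -/
theorem IsGaussianPair.residual_variance_mem (h : IsGaussianPair P v x S Sinv C) (t : E) :
    0 ≤ ‖t‖ ^ 2 - inner ℝ (Sinv (C t)) (C t) ∧ ‖t‖ ^ 2 - inner ℝ (Sinv (C t)) (C t) ≤ ‖t‖ ^ 2 := by
  set m := Sinv (C t) with hm
  have h1 : inner ℝ m (C t) = inner ℝ m (S m) := by rw [hm, h.S_Sinv]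
  have h2 := h.pos.inner_nonneg_right m
  have h3 := h.adjoint_le m
  have h4 : inner ℝ m (C t) ≤ ‖LinearMap.adjoint C m‖ * ‖t‖ := by
    rw [← LinearMap.adjoint_inner_left]; exact real_inner_le_norm _ _
  constructor
  · nlinarith [sq_nonneg (‖LinearMap.adjoint C m‖ - ‖t‖)]
  · linarith

/-- The joint law of the residual and the regressor, through linear functionals: the cross term
vanishes. -/
theorem IsGaussianPair.law_residual (h : IsGaussianPair P v x S Sinv C) (t : E) (a : X) :
    P.map (fun ω => inner ℝ t (v ω - LinearMap.adjoint C (Sinv (x ω))) + inner ℝ a (x ω)) =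
      gaussianReal 0 (Real.toNNReal (‖t‖ ^ 2 - inner ℝ (Sinv (C t)) (C t)) +
        Real.toNNReal (inner ℝ a (S a))) := by
  set m := Sinv (C t) with hm
  have hSm : S m = C t := by rw [hm, h.S_Sinv]
  have e1 : (fun ω => inner ℝ t (v ω - LinearMap.adjoint C (Sinv (x ω))) + inner ℝ a (x ω)) =
      fun ω => inner ℝ t (v ω) + inner ℝ (a - m) (x ω) := by
    funext ω
    rw [inner_sub_right, LinearMap.adjoint_inner_right, inner_sub_left, hm, h.inner_Sinv]
    ring
  rw [e1, h.law, ← Real.toNNReal_add (h.residual_variance_mem t).1 (h.pos.inner_nonneg_right a)]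
  congr 2
  have e2 : inner ℝ m (S a) = inner ℝ a (C t) := by
    rw [← h.pos.isSymmetric, hSm, real_inner_comm]
  rw [map_sub, map_sub, hSm, inner_sub_left, inner_sub_right, inner_sub_right, inner_sub_right, e2,
    LinearMap.adjoint_inner_right, LinearMap.adjoint_inner_right, real_inner_comm a (C t),
    real_inner_comm m (C t)]
  ring

theorem IsGaussianPair.measurable_residual [BorelSpace E] [BorelSpace X]
    (h : IsGaussianPair P v x S Sinv C) :
    Measurable fun ω => v ω - LinearMap.adjoint C (Sinv (x ω)) := by
  have hc : Continuous fun y => LinearMap.adjoint C (Sinv y) :=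
    LinearMap.continuous_of_finiteDimensional (LinearMap.adjoint C ∘ₗ Sinv)
  exact h.measurable_v.sub (hc.measurable.comp h.measurable_x)

theorem IsGaussianPair.indepFun_residual [IsProbabilityMeasure P] [BorelSpace E] [BorelSpace X]
    (h : IsGaussianPair P v x S Sinv C) :
    IndepFun (fun ω => v ω - LinearMap.adjoint C (Sinv (x ω))) x P := by
  have hr := h.measurable_residual
  have hx := h.measurable_x
  set ξ := fun ω => v ω - LinearMap.adjoint C (Sinv (x ω)) with hξ
  rw [indepFun_iff_charFun_prod hr.aemeasurable hx.aemeasurable]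
  intro t
  obtain ⟨r, a⟩ := t
  have m1 : Measurable fun ω => inner ℝ r (ξ ω) := by fun_prop
  have m2 : Measurable fun ω => inner ℝ a (x ω) := by fun_prop
  have h1 := integral_cexp_of_map_eq (m1.add m2) (h.law_residual r a)
  have h2 := integral_cexp_of_map_eq m1 (w := Real.toNNReal (‖r‖ ^ 2 - inner ℝ (Sinv (C r)) (C r)))
    (by simpa using h.law_residual r 0)
  have h3 := integral_cexp_of_map_eq m2 (w := Real.toNNReal (inner ℝ a (S a)))
    (by simpa using h.law_residual 0 a)
  rw [charFun_apply, charFun_apply, charFun_apply, integral_map (by fun_prop) (by fun_prop),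
    integral_map (by fun_prop) (by fun_prop), integral_map (by fun_prop) (by fun_prop)]
  simp only [WithLp.prod_inner_apply, real_inner_comm] at h1 h2 h3 ⊢
  refine Eq.trans ?_ (h1.trans ?_)
  · simp [hξ]
  · rw [h2, h3, ← Complex.exp_add]
    congr 1
    push_cast; ring

theorem IsGaussianPair.lintegral_exp_residual_le [BorelSpace E] [BorelSpace X]
    (h : IsGaussianPair P v x S Sinv C) (t : E) :
    ∫⁻ ω, ENNReal.ofReal (Real.exp (inner ℝ t (v ω - LinearMap.adjoint C (Sinv (x ω))))) ∂P ≤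
      ENNReal.ofReal (Real.exp (‖t‖ ^ 2 / 2)) := by
  have hr := h.measurable_residual
  have h2 : P.map (fun ω => inner ℝ t (v ω - LinearMap.adjoint C (Sinv (x ω)))) =
      gaussianReal 0 (Real.toNNReal (‖t‖ ^ 2 - inner ℝ (Sinv (C t)) (C t))) := by
    simpa using h.law_residual t 0
  have h3 := lintegral_exp_gaussianReal (Real.toNNReal (‖t‖ ^ 2 - inner ℝ (Sinv (C t)) (C t)))
  rw [← h2, lintegral_map (by fun_prop) (by fun_prop)] at h3
  rw [h3, Real.coe_toNNReal _ (h.residual_variance_mem t).1]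
  refine ENNReal.ofReal_le_ofReal (Real.exp_le_exp.2 ?_)
  linarith [(h.residual_variance_mem t).2]

/-- If `y` is drawn from a kernel given `x`, then conditionally on `y` the residual of `v` is still
sub-Gaussian with parameter `1`; integrated form. -/
theorem IsGaussianPair.lintegral_exp_excess_le [IsProbabilityMeasure P] [BorelSpace E]
    [BorelSpace X] (h : IsGaussianPair P v x S Sinv C) {Y : Type*} [MeasurableSpace Y] (q : Kernel X Y)
    [IsMarkovKernel q] {Δ : Y → E} (hΔ : Measurable Δ) {l : ℝ} (hl0 : 0 ≤ l) (hl : l ≤ 1 / 4) :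
    ∫⁻ ω, ∫⁻ y, ENNReal.ofReal (Real.exp (-l * (‖Δ y‖ ^ 2 -
        2 * inner ℝ (v ω - LinearMap.adjoint C (Sinv (x ω))) (Δ y)))) ∂(q (x ω)) ∂P ≤
      ∫⁻ ω, ∫⁻ y, ENNReal.ofReal (Real.exp (-(l / 2) * ‖Δ y‖ ^ 2)) ∂(q (x ω)) ∂P := by
  have hr := h.measurable_residual
  have hx := h.measurable_x
  have hind := h.indepFun_residual
  have hexp := h.lintegral_exp_residual_le
  set ξ := fun ω => v ω - LinearMap.adjoint C (Sinv (x ω)) with hξ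
  have hmap := (indepFun_iff_map_prod_eq_prod_map_map hr.aemeasurable hx.aemeasurable).1 hind
  let f : E × X → Y → ℝ≥0∞ := fun p y =>
    ENNReal.ofReal (Real.exp (-l * (‖Δ y‖ ^ 2 - 2 * inner ℝ p.1 (Δ y))))
  let F : E × X → ℝ≥0∞ := fun p => ∫⁻ y, f p y ∂(q p.2)
  have hF : Measurable F := by
    have h1 : Measurable (Function.uncurry f) := by
      simp only [Function.uncurry_def, f]; fun_prop
    exact h1.lintegral_kernel_prod_right (κ := Kernel.prodMkLeft E q)
  have : IsProbabilityMeasure (P.map ξ) := Measure.isProbabilityMeasure_map hr.aemeasurable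
  have : IsProbabilityMeasure (P.map x) := Measure.isProbabilityMeasure_map hx.aemeasurable
  calc ∫⁻ ω, ∫⁻ y, ENNReal.ofReal (Real.exp (-l * (‖Δ y‖ ^ 2 - 2 * inner ℝ (ξ ω) (Δ y))))
        ∂(q (x ω)) ∂P
      = ∫⁻ p, F p ∂(P.map fun ω => (ξ ω, x ω)) := by
        rw [lintegral_map hF (hr.prodMk hx)]
    _ = ∫⁻ b, ∫⁻ e, F (e, b) ∂(P.map ξ) ∂(P.map x) := by
        rw [hmap, lintegral_prod_symm _ hF.aemeasurable]
    _ ≤ ∫⁻ b, ∫⁻ y, ENNReal.ofReal (Real.exp (-(l / 2) * ‖Δ y‖ ^ 2)) ∂(q b) ∂(P.map x) := by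
        refine lintegral_mono fun b => ?_
        have hswap : ∫⁻ e, F (e, b) ∂(P.map ξ) =
            ∫⁻ y, ∫⁻ e, f (e, b) y ∂(P.map ξ) ∂(q b) := by
          refine lintegral_lintegral_swap (μ := P.map ξ) (ν := q b) (f := fun e y => f (e, b) y) ?_
          simp only [Function.uncurry_def, f]
          exact Measurable.aemeasurable (by fun_prop)
        rw [hswap]
        refine lintegral_mono fun y => ?_
        have h1 : ∀ e : E, f (e, b) y = ENNReal.ofReal (Real.exp (-l * ‖Δ y‖ ^ 2)) *
            ENNReal.ofReal (Real.exp (inner ℝ ((2 * l) • Δ y) e)) := by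
          intro e
          rw [← ENNReal.ofReal_mul (Real.exp_pos _).le, ← Real.exp_add, inner_smul_left,
            real_inner_comm]
          simp only [f, conj_trivial]
          congr 2; ring
        simp_rw [h1]
        rw [lintegral_const_mul _ (by fun_prop), lintegral_map (by fun_prop) hr]
        refine (mul_le_mul_right (hexp ((2 * l) • Δ y)) _).trans ?_
        rw [← ENNReal.ofReal_mul (Real.exp_pos _).le, ← Real.exp_add]
        refine ENNReal.ofReal_le_ofReal (Real.exp_le_exp.2 ?_)
        rw [norm_smul, mul_pow, Real.norm_eq_abs, sq_abs]
        -- `2 l² ≤ l / 2`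
        have h2 : 2 * l ^ 2 ≤ l / 2 := by nlinarith
        nlinarith [mul_le_mul_of_nonneg_right h2 (sq_nonneg ‖Δ y‖)]
    _ = _ := by
        rw [lintegral_map _ hx]
        exact Measurable.lintegral_kernel_prod_right' (κ := q)
          (f := fun p : X × Y => ENNReal.ofReal (Real.exp (-(l / 2) * ‖Δ p.2‖ ^ 2))) (by fun_prop)

end Residual

/-! ### The data law and the regression model of Phase I -/

section DataLaw

variable {dx du : ℕ} {Y : Type*} [MeasurableSpace Y] (S : System dx du Y)

instance isProbabilityMeasure_dataLaw [IsMarkovKernel S.q] (κ₀ κ : ℕ) :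
    IsProbabilityMeasure (dataLaw S κ₀ κ) := by
  have h1 : IsProbabilityMeasure
      ((noiseLaw S).map fun z => (inputStack κ₀ κ z, state S z (κ₀ + κ))) :=
    Measure.isProbabilityMeasure_map
      ((measurable_inputStack κ₀ κ).prodMk (measurable_state S _)).aemeasurable
  unfold dataLaw
  exact Measure.isProbabilityMeasure_map (by fun_prop)

theorem lintegral_dataLaw [IsMarkovKernel S.q] (κ₀ κ : ℕ) {G : Stack κ du × Y → ℝ≥0∞}
    (hG : Measurable G) :
    ∫⁻ t, G t ∂(dataLaw S κ₀ κ) = ∫⁻ z, ∫⁻ y, G (inputStack κ₀ κ z, y)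
      ∂(S.q (state S z (κ₀ + κ))) ∂(noiseLaw S) := by
  have hm := (measurable_inputStack (dx := dx) (du := du) κ₀ κ).prodMk
    (measurable_state S (κ₀ + κ))
  have h1 : IsProbabilityMeasure
      ((noiseLaw S).map fun z => (inputStack κ₀ κ z, state S z (κ₀ + κ))) :=
    Measure.isProbabilityMeasure_map hm.aemeasurable
  have hG' : Measurable fun t : (Stack κ du × Vec dx) × Y => G (t.1.1, t.2) := by fun_prop
  rw [dataLaw, lintegral_map hG (by fun_prop), Measure.lintegral_compProd hG',
    lintegral_map _ hm]
  · simp only [Kernel.prodMkLeft_apply]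
  · exact hG'.lintegral_kernel_prod_right' (κ := Kernel.prodMkLeft (Stack κ du) S.q)

variable {S} {p : Params} {fstar : Y → Vec dx} {F : Finset (Y → Vec dx)}

/-- Under decodability, `fstar y` has the law of the state. -/
theorem Assumptions.lintegral_dataLaw_fstar (h : Assumptions S p fstar F) (κ₀ κ : ℕ)
    {g : Stack κ du → Vec dx → ℝ≥0∞} (hg : Measurable (Function.uncurry g)) :
    ∫⁻ t, g t.1 (fstar t.2) ∂(dataLaw S κ₀ κ) =
      ∫⁻ z, g (inputStack κ₀ κ z) (state S z (κ₀ + κ)) ∂(noiseLaw S) := by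
  have := h.markov
  have hf := h.measurable _ h.realizable
  have hg' : Measurable fun t : Stack κ du × Y => g t.1 (fstar t.2) :=
    hg.comp (measurable_fst.prodMk (hf.comp measurable_snd))
  rw [lintegral_dataLaw S κ₀ κ hg']
  refine lintegral_congr fun z => ?_
  have h1 : ∀ᵐ y ∂(S.q (state S z (κ₀ + κ))), g (inputStack κ₀ κ z) (fstar y) =
      g (inputStack κ₀ κ z) (state S z (κ₀ + κ)) := by
    filter_upwards [h.decodable (state S z (κ₀ + κ))] with y hy
    rw [hy]
  rw [lintegral_congr_ae h1]
  simp

theorem Assumptions.rank_ctrb (h : Assumptions S p fstar F) :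
    (ctrb S.A S.B p.kappa).rank = dx := by
  obtain ⟨k, hk, hr⟩ := h.controllable
  refine le_antisymm ((Matrix.rank_le_card_height _).trans (by simp)) ?_
  have h1 : ctrb S.A S.B k = (ctrb S.A S.B p.kappa).submatrix id
      fun jb : Fin k × Fin du => (⟨p.kappa - k + jb.1, by omega⟩, jb.2) := by
    ext a jb
    have e : k - 1 - (jb.1 : ℕ) = p.kappa - 1 - (p.kappa - k + (jb.1 : ℕ)) := by
      have := jb.1.isLt
      omega
    change (S.A ^ (k - 1 - (jb.1 : ℕ)) * S.B) a jb.2 =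
      (S.A ^ (p.kappa - 1 - (p.kappa - k + (jb.1 : ℕ))) * S.B) a jb.2
    rw [e]
  calc dx = (ctrb S.A S.B k).rank := hr.symm
    _ ≤ (ctrb S.A S.B p.kappa).rank := by rw [h1]; exact Matrix.rank_submatrix_le _ _ _

theorem Assumptions.dx_le (h : Assumptions S p fstar F) : dx ≤ p.kappa * du := by
  have h1 := Matrix.rank_le_card_width (ctrb S.A S.B p.kappa)
  rw [h.rank_ctrb] at h1
  simpa using h1

theorem Assumptions.kappa_pos (h : Assumptions S p fstar F) : 0 < p.kappa :=
  Nat.pos_of_mul_pos_right (h.dx_pos.trans_le h.dx_le)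

theorem Assumptions.du_pos (h : Assumptions S p fstar F) : 0 < du :=
  Nat.pos_of_mul_pos_left (h.dx_pos.trans_le h.dx_le)

theorem Assumptions.sigmaC_pos (h : Assumptions S p fstar F) : 0 < sigmaC S p := by
  rw [sigmaC, sigmaMin, LinearMap.singularValues_pos_iff_lt_finrank_range]
  have h1 : Module.finrank ℝ (LinearMap.range (Matrix.toEuclideanLin (ctrb S.A S.B p.kappa))) =
      dx := by
    refine Eq.trans ?_ h.rank_ctrb
    rw [Matrix.rank_eq_finrank_range_toLin (ctrb S.A S.B p.kappa)
      (EuclideanSpace.basisFun _ ℝ).toBasis (EuclideanSpace.basisFun _ ℝ).toBasis,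
      Matrix.toEuclideanLin_eq_toLin_orthonormal]
  rw [h1]
  have := h.dx_pos
  have := h.dx_le
  simp only [Fintype.card_fin, Fintype.card_prod]
  omega

theorem Assumptions.sigmaC_mul_norm_le (h : Assumptions S p fstar F) (a : Vec dx) :
    sigmaC S p * ‖a‖ ≤ ‖Matrix.toEuclideanLin (ctrb S.A S.B p.kappa)ᵀ a‖ :=
  sigmaMin_mul_norm_le _ (by simpa using h.dx_le) (by simpa using h.dx_pos) a

theorem Assumptions.norm_sq_le_inner_SigmaW (h : Assumptions S p fstar F) (a : Vec dx) :
    ‖a‖ ^ 2 ≤ p.Psi * inner ℝ a (Matrix.toEuclideanLin S.SigmaW a) := by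
  have hpos := Matrix.isPositive_toEuclideanLin_iff.2 h.SigmaW_pd.posSemidef
  set u := Matrix.toEuclideanLin S.SigmaW⁻¹ a with hu
  have hdet := (Matrix.isUnit_iff_isUnit_det _).1 h.SigmaW_pd.isUnit
  have hWu : Matrix.toEuclideanLin S.SigmaW u = a := by
    rw [hu, ← toEuclideanLin_mul, Matrix.mul_nonsing_inv _ hdet, Matrix.toLpLin_one]; rfl
  have h1 := inner_sq_le_of_isPositive hpos a u
  rw [hWu, real_inner_self_eq_norm_sq] at h1
  have h2 : inner ℝ u a ≤ p.Psi * ‖a‖ ^ 2 := by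
    rw [real_inner_comm]
    exact (inner_toEuclideanLin_self_le _ _).trans
      (mul_le_mul_of_nonneg_right h.norm_SigmaW_inv (sq_nonneg _))
  rcases (sq_nonneg ‖a‖).eq_or_lt with h0 | h0
  · rw [← h0]
    exact mul_nonneg (by linarith [h.one_le_Psi]) (hpos.inner_nonneg_right a)
  · have h3 := mul_le_mul_of_nonneg_left h2 (hpos.inner_nonneg_right a)
    nlinarith

theorem Assumptions.isPositive_stateCov (h : Assumptions S p fstar F) (κ₀ : ℕ) :
    (Matrix.toEuclideanLin (stateCov S (κ₀ + p.kappa))).IsPositive := by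
  refine ⟨fun a b => ?_, fun a => ?_⟩
  · rw [← inner_toEuclideanLin_transpose, isSymm_stateCov S h.Sigma0_psd h.SigmaW_pd.posSemidef]
  · have h1 := norm_ctrb_add_le_inner_stateCov S h.Sigma0_psd h.SigmaW_pd.posSemidef κ₀ h.kappa_pos a
    have h2 := inner_toEuclideanLin_self_nonneg h.SigmaW_pd.posSemidef a
    have h3 := sq_nonneg ‖Matrix.toEuclideanLin (ctrb S.A S.B p.kappa)ᵀ a‖
    rw [real_inner_comm] at *
    simp only [RCLike.re_to_real]
    linarith

theorem Assumptions.norm_sq_le_inner_stateCov (h : Assumptions S p fstar F) (κ₀ : ℕ)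
    (a : Vec dx) :
    ‖Matrix.toEuclideanLin (ctrb S.A S.B p.kappa)ᵀ a‖ ^ 2 + ‖a‖ ^ 2 / p.Psi ≤
      inner ℝ a (Matrix.toEuclideanLin (stateCov S (κ₀ + p.kappa)) a) := by
  have h1 := norm_ctrb_add_le_inner_stateCov S h.Sigma0_psd h.SigmaW_pd.posSemidef κ₀ h.kappa_pos a
  have h2 := h.norm_sq_le_inner_SigmaW a
  have hΨ : 0 < p.Psi := by linarith [h.one_le_Psi]
  have h3 : ‖a‖ ^ 2 / p.Psi ≤ inner ℝ a (Matrix.toEuclideanLin S.SigmaW a) := by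
    rw [div_le_iff₀ hΨ, mul_comm]; exact h2
  linarith

theorem Assumptions.stateCov_inv (h : Assumptions S p fstar F) (κ₀ : ℕ) (a : Vec dx) :
    Matrix.toEuclideanLin (stateCov S (κ₀ + p.kappa))
      (Matrix.toEuclideanLin (stateCov S (κ₀ + p.kappa))⁻¹ a) = a := by
  have hΨ : 0 < p.Psi := by linarith [h.one_le_Psi]
  have h1 : IsUnit (stateCov S (κ₀ + p.kappa)) := by
    refine isUnit_of_mul_norm_le _ (inv_pos.2 hΨ) fun b => ?_
    have h2 := h.norm_sq_le_inner_stateCov κ₀ b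
    have h3 := real_inner_le_norm b (Matrix.toEuclideanLin (stateCov S (κ₀ + p.kappa)) b)
    have h4 := sq_nonneg ‖Matrix.toEuclideanLin (ctrb S.A S.B p.kappa)ᵀ b‖
    rcases (norm_nonneg b).eq_or_lt with h0 | h0
    · rw [← h0, mul_zero]; exact norm_nonneg _
    · refine le_of_mul_le_mul_left ?_ h0
      have e : ‖b‖ * (p.Psi⁻¹ * ‖b‖) = ‖b‖ ^ 2 / p.Psi := by ring
      linarith
  have hdet := (Matrix.isUnit_iff_isUnit_det _).1 h1
  rw [← toEuclideanLin_mul, Matrix.mul_nonsing_inv _ hdet, Matrix.toLpLin_one]; rfl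

/-- The matrix `C_κᵀ Σ⁻¹` of the conditional expectation `E[v ∣ x_{κ₁}]`, where `Σ` is the
covariance of `x_{κ₁}`. -/
noncomputable def bayesMatrix (S : System dx du Y) (κ₀ κ : ℕ) :
    Matrix (Fin κ × Fin du) (Fin dx) ℝ :=
  (ctrb S.A S.B κ)ᵀ * (stateCov S (κ₀ + κ))⁻¹

theorem norm_le_of_norm_toEuclideanLin_le {m n : Type*} [Fintype m] [Fintype n] [DecidableEq n]
    (A : Matrix m n ℝ) {r : ℝ} (hr : 0 ≤ r)
    (hA : ∀ x, ‖Matrix.toEuclideanLin A x‖ ≤ r * ‖x‖) : ‖A‖ ≤ r := by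
  rw [Matrix.l2_opNorm_def]
  exact ContinuousLinearMap.opNorm_le_bound _ hr hA

theorem Assumptions.norm_bayesMatrix_le (h : Assumptions S p fstar F) (κ₀ : ℕ) :
    ‖bayesMatrix S κ₀ p.kappa‖ ≤ √p.Psi := by
  have hΨ : 0 < p.Psi := by linarith [h.one_le_Psi]
  refine norm_le_of_norm_toEuclideanLin_le _ (Real.sqrt_nonneg _) fun a => ?_
  rw [bayesMatrix, toEuclideanLin_mul]
  set u := Matrix.toEuclideanLin (stateCov S (κ₀ + p.kappa))⁻¹ a with hu
  have h1 := h.norm_sq_le_inner_stateCov κ₀ u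
  rw [hu, h.stateCov_inv, ← hu] at h1
  have h2 := real_inner_le_norm u a
  have h3 := sq_nonneg ‖Matrix.toEuclideanLin (ctrb S.A S.B p.kappa)ᵀ u‖
  have h4 : ‖u‖ ≤ p.Psi * ‖a‖ := by
    rcases (norm_nonneg u).eq_or_lt with h0 | h0
    · rw [← h0]; positivity
    · refine le_of_mul_le_mul_left ?_ h0
      have h5 : ‖u‖ ^ 2 / p.Psi ≤ ‖u‖ * ‖a‖ := by linarith
      rw [div_le_iff₀ hΨ] at h5
      linarith
  refine le_of_sq_le_sq ?_ (by positivity)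
  rw [mul_pow, Real.sq_sqrt hΨ.le]
  have h6 : 0 ≤ ‖u‖ ^ 2 / p.Psi := by positivity
  nlinarith [mul_le_mul_of_nonneg_right h4 (norm_nonneg a)]

theorem Assumptions.isGaussianPair (h : Assumptions S p fstar F) (κ₀ : ℕ) :
    IsGaussianPair (noiseLaw S) (fun z => inputStack κ₀ p.kappa z)
      (fun z => state S z (κ₀ + p.kappa)) (Matrix.toEuclideanLin (stateCov S (κ₀ + p.kappa)))
      (Matrix.toEuclideanLin (stateCov S (κ₀ + p.kappa))⁻¹)
      (Matrix.toEuclideanLin (ctrb S.A S.B p.kappa)) where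
  measurable_v := measurable_inputStack _ _
  measurable_x := measurable_state S _
  pos := h.isPositive_stateCov κ₀
  S_Sinv := h.stateCov_inv κ₀
  adjoint_le a := by
    rw [← toEuclideanLin_transpose]
    have hΨ : 0 < p.Psi := by linarith [h.one_le_Psi]
    have h1 := h.norm_sq_le_inner_stateCov κ₀ a
    have h2 : 0 ≤ ‖a‖ ^ 2 / p.Psi := by positivity
    linarith
  law r a := by
    rw [← toEuclideanLin_transpose]
    exact map_inner_add_inner S h.Sigma0_psd h.SigmaW_pd.posSemidef κ₀ p.kappa r a

theorem Assumptions.two_le_scale (h : Assumptions S p fstar F) :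
    2 ≤ 2 * p.Psi ^ 2 * p.alpha ^ 2 / (1 - p.gamma) := by
  have hγ : 0 < 1 - p.gamma := by linarith [h.gamma_mem.2]
  rw [le_div_iff₀ hγ]
  have h1 : 1 ≤ p.Psi ^ 2 * p.alpha ^ 2 :=
    one_le_mul_of_one_le_of_one_le (one_le_pow₀ h.one_le_Psi) (one_le_pow₀ h.one_le_alpha)
  nlinarith [h.gamma_mem.1]

theorem Assumptions.one_le_cConc (h : Assumptions S p fstar F) : 1 ≤ cConc p := by
  have hγ : 0 < 1 - p.gamma := by linarith [h.gamma_mem.2]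
  rw [cConc, le_div_iff₀ hγ]
  have h1 : 1 ≤ p.L ^ 2 * p.Psi ^ 3 * p.alpha ^ 2 :=
    one_le_mul_of_one_le_of_one_le (one_le_mul_of_one_le_of_one_le (one_le_pow₀ h.one_le_L)
      (one_le_pow₀ h.one_le_Psi)) (one_le_pow₀ h.one_le_alpha)
  nlinarith [h.gamma_mem.1]

/-- The envelope of the squares of the regression class. -/
noncomputable def envelope (p : Params) (fstar : Y → Vec dx) (y : Y) : ℝ :=
  p.Psi * p.L ^ 2 * max 1 ‖fstar y‖ ^ 2

theorem Assumptions.norm_sq_le_envelope (h : Assumptions S p fstar F) {f : Y → Vec dx}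
    (hf : f ∈ F) {κ : ℕ} {M : Matrix (Fin κ × Fin du) (Fin dx) ℝ} (hM : ‖M‖ ≤ √p.Psi) (y : Y) :
    ‖Matrix.toEuclideanLin M (f y)‖ ^ 2 ≤ envelope p fstar y := by
  have hΨ : 0 ≤ p.Psi := by linarith [h.one_le_Psi]
  have hL : 0 ≤ p.L := by linarith [h.one_le_L]
  calc ‖Matrix.toEuclideanLin M (f y)‖ ^ 2 ≤ (√p.Psi * (p.L * max 1 ‖fstar y‖)) ^ 2 := by
        refine pow_le_pow_left₀ (norm_nonneg _) ((norm_toEuclideanLin_le _ _).trans ?_) 2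
        exact mul_le_mul hM (h.growth f hf y) (norm_nonneg _) (Real.sqrt_nonneg _)
    _ = envelope p fstar y := by
        rw [mul_pow, Real.sq_sqrt hΨ, mul_pow, envelope, mul_assoc]

theorem Assumptions.norm_fstar_sq_le_envelope (h : Assumptions S p fstar F) (y : Y) :
    ‖fstar y‖ ^ 2 ≤ envelope p fstar y := by
  have hΨ := h.one_le_Psi
  have hL := h.one_le_L
  have h1 : 1 ≤ p.Psi * p.L ^ 2 := one_le_mul_of_one_le_of_one_le hΨ (one_le_pow₀ hL)
  calc ‖fstar y‖ ^ 2 ≤ 1 * max 1 ‖fstar y‖ ^ 2 := by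
        rw [one_mul]; exact pow_le_pow_left₀ (norm_nonneg _) (le_max_right _ _) 2
    _ ≤ _ := mul_le_mul_of_nonneg_right h1 (by positivity)

theorem Assumptions.measurable_envelope (h : Assumptions S p fstar F) :
    Measurable (envelope p fstar) := by
  have hf := h.measurable _ h.realizable
  unfold envelope
  fun_prop

theorem Assumptions.lintegral_exp_envelope_le (h : Assumptions S p fstar F) (κ₀ : ℕ) :
    ∫⁻ t, ENNReal.ofReal (Real.exp (envelope p fstar t.2 / (dx * cConc p)))
      ∂(dataLaw S κ₀ p.kappa) ≤ 2 := by
  have hΨ := h.one_le_Psi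
  have hL := h.one_le_L
  have hγ : 0 < 1 - p.gamma := by linarith [h.gamma_mem.2]
  have hdx : (1 : ℝ) ≤ dx := by exact_mod_cast h.dx_pos
  have : Nonempty (Fin dx) := ⟨⟨0, h.dx_pos⟩⟩
  set s := 2 * p.Psi ^ 2 * p.alpha ^ 2 / (1 - p.gamma) with hs
  have hs2 : 2 ≤ s := h.two_le_scale
  have hb : dx * cConc p = 6 * dx * s * (p.Psi * p.L ^ 2) := by
    rw [cConc, hs]; field_simp; ring
  have hq := lintegral_exp_norm_sq_le (noiseLaw S) (measurable_state S (κ₀ + p.kappa))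
    (s := s) (by linarith)
    (V := fun a => inner ℝ a (Matrix.toEuclideanLin (stateCov S (κ₀ + p.kappa)) a))
    (fun a => (h.isPositive_stateCov κ₀).inner_nonneg_right a)
    (fun a => inner_stateCov_le S h _ a) (fun a => by
      simpa using (h.isGaussianPair κ₀).law 0 a)
  rw [Fintype.card_fin] at hq
  have hpt : ∀ y, Real.exp (envelope p fstar y / (dx * cConc p)) ≤
      Real.exp (1 / 12) * Real.exp (‖fstar y‖ ^ 2 / (4 * dx * s)) := by
    intro y
    rw [← Real.exp_add]
    refine Real.exp_le_exp.2 ?_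
    have h0 : 0 < p.Psi * p.L ^ 2 := by positivity
    have h1 : envelope p fstar y / (dx * cConc p) = max 1 ‖fstar y‖ ^ 2 / (6 * dx * s) := by
      rw [envelope, hb]; field_simp
    rw [h1]
    have h2 : max 1 ‖fstar y‖ ^ 2 ≤ 1 + ‖fstar y‖ ^ 2 := by
      rcases max_choice 1 ‖fstar y‖ with h | h <;> rw [h] <;> nlinarith [sq_nonneg ‖fstar y‖]
    have h12 : 12 ≤ 6 * dx * s := by nlinarith
    calc max 1 ‖fstar y‖ ^ 2 / (6 * dx * s) ≤ (1 + ‖fstar y‖ ^ 2) / (6 * dx * s) :=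
          div_le_div_of_nonneg_right h2 (by positivity)
      _ = 1 / (6 * dx * s) + ‖fstar y‖ ^ 2 / (6 * dx * s) := add_div _ _ _
      _ ≤ _ := by
          refine add_le_add (one_div_le_one_div_of_le (by norm_num) h12) ?_
          refine div_le_div_of_nonneg_left (sq_nonneg _) (by positivity) ?_
          have : 0 ≤ dx * s := by positivity
          linarith
  have hnum : Real.exp (1 / 12) * √2 ≤ 2 := by
    have h1 : Real.exp (1 / 12) ≤ 1.4 := by
      have h2 : Real.exp (1 / 12) ^ 12 ≤ (1.4 : ℝ) ^ 12 := by
        rw [← Real.exp_nat_mul]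
        norm_num
        linarith [Real.exp_one_lt_d9]
      exact le_of_pow_le_pow_left₀ (by norm_num) (by norm_num) h2
    have h3 : √2 ≤ 1.42 := by
      rw [Real.sqrt_le_left (by norm_num)]; norm_num
    calc _ ≤ 1.4 * 1.42 := mul_le_mul h1 h3 (Real.sqrt_nonneg _) (by norm_num)
      _ ≤ 2 := by norm_num
  calc ∫⁻ t, ENNReal.ofReal (Real.exp (envelope p fstar t.2 / (dx * cConc p)))
        ∂(dataLaw S κ₀ p.kappa)
      ≤ ∫⁻ t, ENNReal.ofReal (Real.exp (1 / 12) * Real.exp (‖fstar t.2‖ ^ 2 / (4 * dx * s)))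
        ∂(dataLaw S κ₀ p.kappa) :=
        lintegral_mono fun t => ENNReal.ofReal_le_ofReal (hpt t.2)
    _ = ∫⁻ z, ENNReal.ofReal (Real.exp (1 / 12) *
          Real.exp (‖state S z (κ₀ + p.kappa)‖ ^ 2 / (4 * dx * s))) ∂(noiseLaw S) :=
        h.lintegral_dataLaw_fstar κ₀ p.kappa (g := fun _ x =>
          ENNReal.ofReal (Real.exp (1 / 12) * Real.exp (‖x‖ ^ 2 / (4 * dx * s))))
          (by simp only [Function.uncurry_def]; fun_prop)
    _ ≤ ENNReal.ofReal (Real.exp (1 / 12)) * ENNReal.ofReal √2 := by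
        simp_rw [ENNReal.ofReal_mul (Real.exp_pos _).le]
        rw [lintegral_const_mul']
        · exact mul_le_mul_right hq _
        · exact ENNReal.ofReal_ne_top
    _ ≤ 2 := by
        rw [← ENNReal.ofReal_mul (Real.exp_pos _).le]
        refine (ENNReal.ofReal_le_ofReal hnum).trans ?_
        simp

theorem Assumptions.isRegressionModel (h : Assumptions S p fstar F) (κ₀ : ℕ) :
    IsRegressionModel (dataLaw S κ₀ p.kappa)
      (fun y => Matrix.toEuclideanLin (bayesMatrix S κ₀ p.kappa) (fstar y))
      (envelope p fstar) (dx * cConc p) (du * p.kappa) := by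
  have := h.markov
  have hf := h.measurable _ h.realizable
  have hcont : Continuous (Matrix.toEuclideanLin (bayesMatrix S κ₀ p.kappa)) :=
    LinearMap.continuous_of_finiteDimensional _
  have hG := h.isGaussianPair κ₀
  have hκ := h.kappa_pos
  have hdu := h.du_pos
  refine ⟨hcont.measurable.comp hf, h.measurable_envelope,
    fun y => h.norm_sq_le_envelope h.realizable (h.norm_bayesMatrix_le κ₀) y, ?_, by positivity,
    h.lintegral_exp_envelope_le κ₀, ?_, fun Δ hΔ l hl0 hl => ?_⟩
  · have hdx : (1 : ℝ) ≤ dx := by exact_mod_cast h.dx_pos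
    exact one_le_mul_of_one_le_of_one_le hdx h.one_le_cConc
  · have : Nonempty (Fin p.kappa × Fin du) := ⟨(⟨0, hκ⟩, ⟨0, hdu⟩)⟩
    have hq := lintegral_exp_norm_sq_le (noiseLaw S) (measurable_inputStack κ₀ p.kappa)
      (s := 1) one_pos (V := fun a => ‖a‖ ^ 2) (fun a => sq_nonneg _) (fun a => by simp)
      (fun a => by simpa using hG.law a 0)
    rw [lintegral_dataLaw S κ₀ p.kappa (G := fun t =>
      ENNReal.ofReal (Real.exp (‖t.1‖ ^ 2 / (4 * (du * p.kappa))))) (by fun_prop)]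
    simp only [lintegral_const, measure_univ, mul_one]
    simp only [Fintype.card_prod, Fintype.card_fin, Nat.cast_mul, mul_one,
      mul_comm (p.kappa : ℝ)] at hq
    refine hq.trans ?_
    have h3 : √2 ≤ 2 := by
      rw [Real.sqrt_le_left (by norm_num)]; norm_num
    refine (ENNReal.ofReal_le_ofReal h3).trans ?_
    simp
  · have h1 := hG.lintegral_exp_excess_le S.q hΔ hl0 hl
    rw [lintegral_dataLaw S κ₀ p.kappa (G := fun t => ENNReal.ofReal (Real.exp (-l *
        (‖Δ t.2‖ ^ 2 - 2 * inner ℝ (t.1 - Matrix.toEuclideanLin (bayesMatrix S κ₀ p.kappa)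
          (fstar t.2)) (Δ t.2))))) (by fun_prop),
      lintegral_dataLaw S κ₀ p.kappa (G := fun t =>
        ENNReal.ofReal (Real.exp (-(l / 2) * ‖Δ t.2‖ ^ 2))) (by fun_prop)]
    refine le_trans (le_of_eq ?_) h1
    refine lintegral_congr fun z => lintegral_congr_ae ?_
    filter_upwards [h.decodable (state S z (κ₀ + p.kappa))] with y hy
    rw [hy, bayesMatrix, toEuclideanLin_mul, toEuclideanLin_transpose]

/-- The second moments of the decoded state. -/
theorem Assumptions.lintegral_inner_fstar_sq (h : Assumptions S p fstar F) (κ₀ : ℕ) (a : Vec dx) :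
    ∫⁻ t, ENNReal.ofReal (inner ℝ a (fstar t.2) ^ 2) ∂(dataLaw S κ₀ p.kappa) =
      ENNReal.ofReal (inner ℝ a (Matrix.toEuclideanLin (stateCov S (κ₀ + p.kappa)) a)) := by
  have h1 := (h.isGaussianPair κ₀).law 0 a
  simp only [inner_zero_left, zero_add, norm_zero, ne_eq, OfNat.ofNat_ne_zero, not_false_eq_true,
    zero_pow, add_zero, mul_zero] at h1
  have hm := measurable_state S (κ₀ + p.kappa)
  have h2 := lintegral_sq_gaussianReal (Real.toNNReal
    (inner ℝ a (Matrix.toEuclideanLin (stateCov S (κ₀ + p.kappa)) a)))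
  rw [← h1, lintegral_map (by fun_prop) (by fun_prop)] at h2
  refine (h.lintegral_dataLaw_fstar κ₀ p.kappa (g := fun _ x => ENNReal.ofReal (inner ℝ a x ^ 2))
    (by simp only [Function.uncurry_def]; fun_prop)).trans ?_
  rw [h2]; rfl

end DataLaw

/-! ### The regression step -/

theorem IsRegressionModel.lintegral_envelope_le {E Y : Type*} [NormedAddCommGroup E]
    [InnerProductSpace ℝ E] [MeasurableSpace E] [MeasurableSpace Y] {μ : Measure (E × Y)}
    {hstar : Y → E} {H : Y → ℝ} {b N : ℝ} (hM : IsRegressionModel μ hstar H b N) :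
    ∫⁻ t, ENNReal.ofReal (H t.2) ∂μ ≤ ENNReal.ofReal (2 * b) := by
  have hb : 0 < b := by linarith [hM.one_le_b]
  calc ∫⁻ t, ENNReal.ofReal (H t.2) ∂μ
      ≤ ∫⁻ t, ENNReal.ofReal b * ENNReal.ofReal (Real.exp (H t.2 / b)) ∂μ := by
        refine lintegral_mono fun t => ?_
        rw [← ENNReal.ofReal_mul hb.le]
        refine ENNReal.ofReal_le_ofReal ?_
        calc H t.2 = b * (H t.2 / b) := by field_simp
          _ ≤ _ := mul_le_mul_of_nonneg_left
            (by linarith [Real.add_one_le_exp (H t.2 / b)]) hb.le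
    _ ≤ ENNReal.ofReal b * 2 := by
        rw [lintegral_const_mul' _ _ ENNReal.ofReal_ne_top]
        exact mul_le_mul_right hM.exp_H _
    _ = _ := by
        have h2 : (2 : ℝ≥0∞) = ENNReal.ofReal 2 := by simp
        rw [h2, ← ENNReal.ofReal_mul hb.le, mul_comm]

/-- The envelope contributes little on an event of small probability. -/
theorem IsRegressionModel.lintegral_indicator_le {E Y : Type*} [NormedAddCommGroup E]
    [InnerProductSpace ℝ E] [MeasurableSpace E] [MeasurableSpace Y] {μ : Measure (E × Y)}
    {hstar : Y → E} {H : Y → ℝ} {b N : ℝ} (hM : IsRegressionModel μ hstar H b N)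
    {B : Set (E × Y)} (hB : MeasurableSet B) {ρ : ℝ} (hρ : 0 < ρ) (hμ : μ B ≤ ENNReal.ofReal ρ) :
    ∫⁻ t, B.indicator (fun t => ENNReal.ofReal (H t.2)) t ∂μ ≤
      ENNReal.ofReal (5 / 2 * b * √ρ) := by
  have hb : 0 < b := by linarith [hM.one_le_b]
  have hr : 0 < √ρ := Real.sqrt_pos.2 hρ
  have hpt : ∀ t, B.indicator (fun t => ENNReal.ofReal (H t.2)) t ≤
      B.indicator (fun _ => ENNReal.ofReal (b / 2 / √ρ)) t +
        ENNReal.ofReal (b * √ρ) * ENNReal.ofReal (Real.exp (H t.2 / b)) := by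
    intro t
    by_cases ht : t ∈ B
    · rw [Set.indicator_of_mem ht, Set.indicator_of_mem ht, ← ENNReal.ofReal_mul (by positivity),
        ← ENNReal.ofReal_add (by positivity) (by positivity)]
      refine ENNReal.ofReal_le_ofReal ?_
      have hH0 : 0 ≤ H t.2 / b := div_nonneg ((sq_nonneg _).trans (hM.norm_hstar t.2)) hb.le
      set x := H t.2 / b with hx
      have e : H t.2 = b * x := by rw [hx]; field_simp
      have h1 := Real.quadratic_le_exp_of_nonneg hH0
      -- `2 x ≤ 1 / √ρ + √ρ x²` and `x² ≤ 2 exp x`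
      have h2 : x ≤ 1 / 2 / √ρ + √ρ * (x ^ 2 / 2) := by
        have h3 : 0 ≤ (1 / √ρ) * (1 - √ρ * x) ^ 2 := by positivity
        have h4 : (1 / √ρ) * (1 - √ρ * x) ^ 2 = 1 / √ρ - 2 * x + √ρ * x ^ 2 := by
          field_simp; ring
        have h5 : 1 / 2 / √ρ = (1 / √ρ) / 2 := by ring
        rw [h5]; linarith
      have h6 : √ρ * (x ^ 2 / 2) ≤ √ρ * Real.exp x :=
        mul_le_mul_of_nonneg_left (by linarith) hr.le
      rw [e]
      calc b * x ≤ b * (1 / 2 / √ρ + √ρ * Real.exp x) :=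
            mul_le_mul_of_nonneg_left (by linarith) hb.le
        _ = _ := by ring
    · rw [Set.indicator_of_notMem ht]; exact zero_le
  calc _ ≤ ∫⁻ t, (B.indicator (fun _ => ENNReal.ofReal (b / 2 / √ρ)) t +
        ENNReal.ofReal (b * √ρ) * ENNReal.ofReal (Real.exp (H t.2 / b))) ∂μ := lintegral_mono hpt
    _ = ENNReal.ofReal (b / 2 / √ρ) * μ B +
          ENNReal.ofReal (b * √ρ) * ∫⁻ t, ENNReal.ofReal (Real.exp (H t.2 / b)) ∂μ := by
        rw [lintegral_add_left (measurable_const.indicator hB), lintegral_indicator_const hB,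
          lintegral_const_mul' _ _ ENNReal.ofReal_ne_top]
    _ ≤ ENNReal.ofReal (b / 2 / √ρ) * ENNReal.ofReal ρ + ENNReal.ofReal (b * √ρ) * 2 :=
        add_le_add (mul_le_mul_right hμ _) (mul_le_mul_right hM.exp_H _)
    _ = _ := by
        have h2 : (2 : ℝ≥0∞) = ENNReal.ofReal 2 := by simp
        rw [h2, ← ENNReal.ofReal_mul (by positivity), ← ENNReal.ofReal_mul (by positivity),
          ← ENNReal.ofReal_add (by positivity) (by positivity)]
        congr 1
        have h3 : b / 2 / √ρ * ρ = b / 2 * √ρ := by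
          nth_rewrite 2 [← Real.mul_self_sqrt hρ.le]
          field_simp
        rw [h3]; ring

section Regression

variable {dx du : ℕ} {Y : Type*} [MeasurableSpace Y] {S : System dx du Y} {p : Params}
  {fstar : Y → Vec dx} {F : Finset (Y → Vec dx)}

/-- Finitely many matrices that approximate the regression class to relative precision `1 / n`. -/
theorem Assumptions.exists_regClass_net (h : Assumptions S p fstar F) {n : ℕ} (hn : 0 < n) :
    ∃ net : Finset (Matrix (Fin p.kappa × Fin du) (Fin dx) ℝ), net.Nonempty ∧
      (∀ c ∈ net, ‖c‖ ≤ √p.Psi) ∧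
      (∀ M : Matrix (Fin p.kappa × Fin du) (Fin dx) ℝ, ‖M‖ ≤ √p.Psi → ∃ c ∈ net, ∀ f ∈ F, ∀ y,
        ‖Matrix.toEuclideanLin M (f y) - Matrix.toEuclideanLin c (f y)‖ ^ 2 ≤
          envelope p fstar y / n ^ 2) ∧
      Real.log net.card ≤ du * p.kappa * dx * Real.log (1 + 2 * n) := by
  have hΨ : 0 < p.Psi := by linarith [h.one_le_Psi]
  have hL : 0 ≤ p.L := by linarith [h.one_le_L]
  obtain ⟨net, hnet, hcov, hcard⟩ := exists_net_closedBall
    (E := Matrix (Fin p.kappa × Fin du) (Fin dx) ℝ) (Real.sqrt_pos.2 hΨ) hn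
  obtain ⟨c0, hc0, -⟩ := hcov 0 (by rw [norm_zero]; exact Real.sqrt_nonneg _)
  refine ⟨net, ⟨c0, hc0⟩, hnet, fun M hM => ?_, ?_⟩
  · obtain ⟨c, hc, hMc⟩ := hcov M hM
    refine ⟨c, hc, fun f hf y => ?_⟩
    rw [← LinearMap.sub_apply, ← map_sub]
    calc ‖Matrix.toEuclideanLin (M - c) (f y)‖ ^ 2
        ≤ (√p.Psi / n * (p.L * max 1 ‖fstar y‖)) ^ 2 := by
          refine pow_le_pow_left₀ (norm_nonneg _) ((norm_toEuclideanLin_le _ _).trans ?_) 2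
          exact mul_le_mul hMc (h.growth f hf y) (norm_nonneg _) (by positivity)
      _ = envelope p fstar y / n ^ 2 := by
          rw [mul_pow, div_pow, Real.sq_sqrt hΨ.le, envelope]; ring
  · have hpos : (0 : ℝ) < net.card := by exact_mod_cast Finset.card_pos.2 ⟨c0, hc0⟩
    rw [Module.finrank_matrix] at hcard
    simp only [Fintype.card_prod, Fintype.card_fin, Module.finrank_self, mul_one] at hcard
    have h1 : (net.card : ℝ) ≤ (1 + 2 * n) ^ (p.kappa * du * dx) := by exact_mod_cast hcard
    have h2 := Real.log_le_log hpos h1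
    rw [Real.log_pow] at h2
    push_cast at h2
    have e : (p.kappa * du * dx : ℝ) = du * p.kappa * dx := by ring
    rwa [e] at h2

/-- With probability at least `1 - 2δ`, an empirical risk minimizer is close in mean square to the
conditional expectation of `v`. -/
theorem Assumptions.exists_erm_event (h : Assumptions S p fstar F) (κ₀ : ℕ) {n : ℕ} (hn : 3 ≤ n)
    {δ : ℝ} (hδ : 0 < δ) :
    ∃ G : Set (Fin n → Stack p.kappa du × Y), MeasurableSet G ∧
      (Measure.pi fun _ : Fin n => dataLaw S κ₀ p.kappa) Gᶜ ≤ ENNReal.ofReal (2 * δ) ∧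
      ∀ s ∈ G, ∀ g : Y → Stack p.kappa du, IsERM (regClass du p.kappa F √p.Psi) s g →
        ∫⁻ t, ENNReal.ofReal (‖g t.2 - Matrix.toEuclideanLin (bayesMatrix S κ₀ p.kappa)
          (fstar t.2)‖ ^ 2) ∂(dataLaw S κ₀ p.kappa) ≤
        ENNReal.ofReal (8 / n * ((3 * (dx * cConc p) + 4 * (du * p.kappa)) * Real.log (4 / δ) +
          4 * (dx * cConc p) * Real.log n * (du * p.kappa * dx * Real.log (1 + 2 * n) +
            Real.log F.card + Real.log (1 / δ))) + 20 * (dx * cConc p) / n) := by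
  have := h.markov
  have hM := h.isRegressionModel κ₀
  have hn0 : 0 < n := by omega
  obtain ⟨net, hne, hnet, hcov, hcard⟩ := h.exists_regClass_net hn0
  have hneJ : Nonempty (net × F) := ⟨(⟨hne.choose, hne.choose_spec⟩, ⟨fstar, h.realizable⟩)⟩
  let hj : net × F → Y → Stack p.kappa du := fun j y => Matrix.toEuclideanLin j.1.1 (j.2.1 y)
  have hjm : ∀ j, Measurable (hj j) := fun j => by
    have hc : Continuous (Matrix.toEuclideanLin j.1.1) :=
      LinearMap.continuous_of_finiteDimensional _
    exact hc.measurable.comp (h.measurable _ j.2.2)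
  have hjH : ∀ j y, ‖hj j y‖ ^ 2 ≤ envelope p fstar y := fun j y =>
    h.norm_sq_le_envelope j.2.2 (hnet _ j.1.2) y
  obtain ⟨G, hG, hGp, hGE⟩ := hM.exists_event hjm hjH hn hδ
  refine ⟨G, hG, hGp, fun s hs g hg => ?_⟩
  obtain ⟨⟨f, hf, M, hMn, rfl⟩, hmin⟩ := hg
  have hnear : ∃ j, ∀ y, ‖Matrix.toEuclideanLin M (f y) - hj j y‖ ^ 2 ≤
      envelope p fstar y / n ^ 2 := by
    obtain ⟨c, hc, hMc⟩ := hcov M hMn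
    exact ⟨(⟨c, hc⟩, ⟨f, hf⟩), hMc f hf⟩
  have hloss := hmin _ ⟨fstar, h.realizable, _, h.norm_bayesMatrix_le κ₀, rfl⟩
  have hbound := hGE s hs _ (fun y => h.norm_sq_le_envelope hf hMn y) hloss hnear
  refine hbound.trans (ENNReal.ofReal_le_ofReal ?_)
  have hb : 0 < dx * cConc p := by linarith [hM.one_le_b]
  have hlogn : 0 ≤ Real.log n := Real.log_natCast_nonneg n
  have hFpos : (0 : ℝ) < F.card := by
    exact_mod_cast Finset.card_pos.2 ⟨fstar, h.realizable⟩
  have hnpos : (0 : ℝ) < net.card := by exact_mod_cast Finset.card_pos.2 hne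
  have hJ : Real.log (Fintype.card (net × F)) ≤
      du * p.kappa * dx * Real.log (1 + 2 * n) + Real.log F.card := by
    rw [Fintype.card_prod, Fintype.card_coe, Fintype.card_coe, Nat.cast_mul,
      Real.log_mul hnpos.ne' hFpos.ne']
    linarith
  have h8 : (0 : ℝ) ≤ 8 / n := by positivity
  have h4b : 0 ≤ 4 * (dx * cConc p) * Real.log n := by positivity
  have h3 := mul_le_mul_of_nonneg_left hJ h4b
  have h4 := mul_le_mul_of_nonneg_left h3 h8
  linarith

/-! ### The principal component step -/

theorem norm_toEuclideanLin_transpose_le {ι : Type*} [Fintype ι] [DecidableEq ι] {d : ℕ}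
    {V : Matrix ι (Fin d) ℝ} (hV : Vᵀ * V = 1) (x : EuclideanSpace ℝ ι) :
    ‖Matrix.toEuclideanLin Vᵀ x‖ ≤ ‖x‖ := by
  have h1 : ‖V‖ ≤ 1 := by
    refine norm_le_of_norm_toEuclideanLin_le _ zero_le_one fun y => ?_
    rw [one_mul]
    refine le_of_sq_le_sq (le_of_eq ?_) (norm_nonneg _)
    rw [← real_inner_self_eq_norm_sq, ← inner_toEuclideanLin_transpose, ← toEuclideanLin_mul, hV,
      Matrix.toLpLin_one]
    simp
  calc _ ≤ ‖Vᵀ‖ * ‖x‖ := norm_toEuclideanLin_le _ _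
    _ ≤ 1 * ‖x‖ := mul_le_mul_of_nonneg_right (by rw [norm_transpose_eq]; exact h1) (norm_nonneg _)
    _ = ‖x‖ := one_mul _

/-- The vectors `h y_i` lie in the range of `V`, so a vector orthogonal to the columns of `V` is
orthogonal to their span. -/
theorem inner_eq_zero_of_mem_span {Y : Type*} {κ n : ℕ} (hn : 0 < n) {M : Matrix (Fin κ × Fin du) (Fin dx) ℝ}
    {f : Y → Vec dx} {s : Fin n → Stack κ du × Y} {V : Matrix (Fin κ × Fin du) (Fin dx) ℝ}
    (hV : IsTopEigenbasis (secondMoment (fun y => Matrix.toEuclideanLin M (f y)) s) V)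
    {x : Stack κ du} (hx : x ∈ Submodule.span ℝ
      (Set.range fun i => Matrix.toEuclideanLin M (f (s i).2)))
    {e : Stack κ du} (he : Matrix.toEuclideanLin Vᵀ e = 0) : inner ℝ e x = (0 : ℝ) := by
  have hn' : (0 : ℝ) < (n : ℝ)⁻¹ := by positivity
  have h1 := hV.mulVec_transpose_mulVec (z := fun i =>
      WithLp.ofLp (Matrix.toEuclideanLin M (f (s i).2))) hn' M
    (x := fun i => WithLp.ofLp (f (s i).2)) (fun i => rfl)
  have hle : Submodule.span ℝ (Set.range fun i => Matrix.toEuclideanLin M (f (s i).2)) ≤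
      LinearMap.ker (innerₛₗ ℝ e) := by
    rw [Submodule.span_le]
    rintro _ ⟨i, rfl⟩
    have h2 : Matrix.toEuclideanLin V (Matrix.toEuclideanLin Vᵀ
        (Matrix.toEuclideanLin M (f (s i).2))) = Matrix.toEuclideanLin M (f (s i).2) := by
      ext j
      exact congrFun (h1 i) j
    change inner ℝ e (Matrix.toEuclideanLin M (f (s i).2)) = 0
    rw [← h2]
    have h3 := inner_toEuclideanLin_transpose Vᵀ e
      (Matrix.toEuclideanLin Vᵀ (Matrix.toEuclideanLin M (f (s i).2)))
    rw [Matrix.transpose_transpose] at h3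
    rw [h3, he, inner_zero_left]
  exact hle hx

/-- With probability at least `1 - δ` over `n` samples, all but a small fraction of the
distribution of `M f(y)` lies in the span of the samples. -/
theorem measure_span_deficient_le_of_log (μ : Measure (Stack p.kappa du × Y))
    [IsProbabilityMeasure μ] (hdx : 0 < dx) {n : ℕ} (hn : 0 < n) {δ : ℝ} (hδ : 0 < δ)
    (hl : 1 ≤ Real.log (n / δ)) (M : Matrix (Fin p.kappa × Fin du) (Fin dx) ℝ) {f : Y → Vec dx}
    (hf : Measurable f) :
    (Measure.pi fun _ : Fin n => μ) {ω | ENNReal.ofReal (4 * dx * Real.log (n / δ) / n) <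
      μ {t | Matrix.toEuclideanLin M (f t.2) ∉ (⊥ : Submodule ℝ (Stack p.kappa du)) ⊔
        Submodule.span ℝ (Set.range fun i => Matrix.toEuclideanLin M (f (ω i).2))}} ≤
      ENNReal.ofReal δ := by
  have hc : Continuous (Matrix.toEuclideanLin M) := LinearMap.continuous_of_finiteDimensional _
  have hfin : Module.finrank ℝ (LinearMap.range (Matrix.toEuclideanLin M)) ≤ dx := by
    simpa using LinearMap.finrank_range_le (Matrix.toEuclideanLin M)
  refine (measure_span_deficient_le μ (g := fun t => Matrix.toEuclideanLin M (f t.2))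
    (hc.measurable.comp (hf.comp measurable_snd))
    (T := LinearMap.range (Matrix.toEuclideanLin M)) (fun t => LinearMap.mem_range_self _ _)
    (4 * dx * Real.log (n / δ) / n) n dx ⊥ bot_le
    (by rw [finrank_bot, zero_add]; exact hfin)).trans (ENNReal.ofReal_le_ofReal ?_)
  have hnR : (1 : ℝ) ≤ n := by exact_mod_cast hn
  have hdR : (1 : ℝ) ≤ dx := by exact_mod_cast hdx
  have e1 : -(4 * dx * Real.log (n / δ) / n) / 2 * n = dx * (-2 * Real.log (n / δ)) := by
    field_simp; ring
  rw [e1, Real.exp_nat_mul, ← mul_pow]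
  have h1 : 2 * Real.exp (-2 * Real.log (n / δ)) ≤ Real.exp (-Real.log (n / δ)) := by
    have h2 : (2 : ℝ) ≤ Real.exp (Real.log (n / δ)) := by
      linarith [Real.add_one_le_exp (Real.log (n / δ))]
    calc 2 * Real.exp (-2 * Real.log (n / δ)) ≤
          Real.exp (Real.log (n / δ)) * Real.exp (-2 * Real.log (n / δ)) :=
          mul_le_mul_of_nonneg_right h2 (Real.exp_pos _).le
      _ = _ := by rw [← Real.exp_add]; congr 1; ring
  have h3 : Real.exp (-Real.log (n / δ)) = δ / n := by
    rw [Real.exp_neg, Real.exp_log (by positivity), inv_div]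
  have h4 : Real.exp (-Real.log (n / δ)) ≤ 1 := by
    rw [Real.exp_le_one_iff]; linarith
  calc _ ≤ Real.exp (-Real.log (n / δ)) ^ dx := pow_le_pow_left₀ (by positivity) h1 _
    _ ≤ Real.exp (-Real.log (n / δ)) := pow_le_of_le_one (Real.exp_pos _).le h4 hdx.ne'
    _ = δ / n := h3
    _ ≤ δ := div_le_self hδ.le hnR

theorem Assumptions.sigmaC_sq_le (h : Assumptions S p fstar F) :
    sigmaC S p ^ 2 ≤ 2 * p.Psi ^ 2 * p.alpha ^ 2 / (1 - p.gamma) := by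
  have hΨ : 0 < p.Psi := by linarith [h.one_le_Psi]
  set a : Vec dx := EuclideanSpace.single ⟨0, h.dx_pos⟩ 1 with ha
  have hna : ‖a‖ = 1 := by simp [ha]
  have h1 := h.norm_sq_le_inner_stateCov 0 a
  have h2 := inner_stateCov_le S h (0 + p.kappa) a
  have h3 := pow_le_pow_left₀ (mul_nonneg h.sigmaC_pos.le (norm_nonneg a))
    (h.sigmaC_mul_norm_le a) 2
  have h4 : 0 ≤ ‖a‖ ^ 2 / p.Psi := by positivity
  rw [hna, mul_one] at h3
  rw [hna] at h1 h2 h4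
  linarith

theorem Assumptions.sigmaMinId_eq (h : Assumptions S p fstar F) :
    sigmaMinId S p = sigmaC S p / (2 * (2 * p.Psi ^ 2 * p.alpha ^ 2 / (1 - p.gamma))) := by
  have hγ : 0 < 1 - p.gamma := by linarith [h.gamma_mem.2]
  have hΨ : 0 < p.Psi := by linarith [h.one_le_Psi]
  have hα : 0 < p.alpha := by linarith [h.one_le_alpha]
  rw [sigmaMinId]; field_simp; ring

theorem Assumptions.sigmaMinId_le_one (h : Assumptions S p fstar F) : sigmaMinId S p ≤ 1 := by
  rw [h.sigmaMinId_eq]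
  have h1 := h.two_le_scale
  have h2 := h.sigmaC_sq_le
  set s := 2 * p.Psi ^ 2 * p.alpha ^ 2 / (1 - p.gamma)
  rw [div_le_one (by linarith)]
  nlinarith [sq_nonneg (sigmaC S p - 1)]

/-- If `h = M f` is close to the conditional expectation of `v`, and the top eigenspace catches
almost all of `h y`, then the decoder is close to a well-conditioned transformation of `fstar`. -/
theorem Assumptions.exists_transformation (h : Assumptions S p fstar F) (κ₀ : ℕ) {n : ℕ}
    (hn : 0 < n) {f : Y → Vec dx} (hf : f ∈ F)
    {M : Matrix (Fin p.kappa × Fin du) (Fin dx) ℝ}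
    {ε ρ : ℝ} (hε : 0 ≤ ε) (hρ : 0 < ρ)
    (hM : ∫⁻ t, ENNReal.ofReal (‖Matrix.toEuclideanLin M (f t.2) -
        Matrix.toEuclideanLin (bayesMatrix S κ₀ p.kappa) (fstar t.2)‖ ^ 2)
        ∂(dataLaw S κ₀ p.kappa) ≤ ENNReal.ofReal ε)
    {s : Fin n → Stack p.kappa du × Y}
    (hs : dataLaw S κ₀ p.kappa {t | Matrix.toEuclideanLin M (f t.2) ∉
      (⊥ : Submodule ℝ (Stack p.kappa du)) ⊔
        Submodule.span ℝ (Set.range fun i => Matrix.toEuclideanLin M (f (s i).2))} ≤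
      ENNReal.ofReal ρ)
    (hτ : ε + 5 / 2 * (dx * cConc p) * √ρ ≤
      3 / 4 * sigmaC S p ^ 2 / (2 * p.Psi ^ 2 * p.alpha ^ 2 / (1 - p.gamma)))
    {V : Matrix (Fin p.kappa × Fin du) (Fin dx) ℝ}
    (hV : IsTopEigenbasis (secondMoment (fun y => Matrix.toEuclideanLin M (f y)) s) V) :
    ∃ Sid : Matrix (Fin dx) (Fin dx) ℝ, IsUnit Sid ∧
      sigmaMinId S p ≤ min 1 (sigmaMin Sid) ∧ max 1 ‖Sid‖ ≤ sigmaMaxId p ∧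
      ∫⁻ t, ‖decoder V (fun y => Matrix.toEuclideanLin M (f y)) t.2 -
        Matrix.toEuclideanLin Sid (fstar t.2)‖ₑ ^ 2 ∂(dataLaw S κ₀ p.kappa) ≤
        ENNReal.ofReal ε := by
  have := h.markov
  have hR := h.isRegressionModel κ₀
  have hb : 0 < dx * cConc p := by linarith [hR.one_le_b]
  have hσ := h.sigmaC_pos
  have hs2 := h.two_le_scale
  have hc : Continuous (Matrix.toEuclideanLin M) := LinearMap.continuous_of_finiteDimensional _
  have hfm := h.measurable f hf
  set μ := dataLaw S κ₀ p.kappa with hμ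
  set B := {t : Stack p.kappa du × Y | Matrix.toEuclideanLin M (f t.2) ∉
      (⊥ : Submodule ℝ (Stack p.kappa du)) ⊔
        Submodule.span ℝ (Set.range fun i => Matrix.toEuclideanLin M (f (s i).2))} with hBdef
  have hB : MeasurableSet B :=
    measurableSet_notMem_sup_span ⊥ (z := fun _ : Stack p.kappa du × Y =>
        fun i => Matrix.toEuclideanLin M (f (s i).2))
      (x := fun t => Matrix.toEuclideanLin M (f t.2)) measurable_const
      (hc.measurable.comp (hfm.comp measurable_snd))
  have hproj : ∀ e : Stack p.kappa du, LinearMap.adjoint (Matrix.toEuclideanLin V) e = 0 →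
      inner ℝ (Matrix.toEuclideanLin (stateCov S (κ₀ + p.kappa))⁻¹
          (Matrix.toEuclideanLin (ctrb S.A S.B p.kappa) e))
        (Matrix.toEuclideanLin (stateCov S (κ₀ + p.kappa))
          (Matrix.toEuclideanLin (stateCov S (κ₀ + p.kappa))⁻¹
            (Matrix.toEuclideanLin (ctrb S.A S.B p.kappa) e))) ≤
      ‖e‖ ^ 2 * (ε + 5 / 2 * (dx * cConc p) * √ρ) := by
    intro e he
    rw [← toEuclideanLin_transpose] at he
    rw [← ENNReal.ofReal_le_ofReal_iff (by positivity), ← h.lintegral_inner_fstar_sq κ₀]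
    have hin : ∀ x, inner ℝ (Matrix.toEuclideanLin (stateCov S (κ₀ + p.kappa))⁻¹
          (Matrix.toEuclideanLin (ctrb S.A S.B p.kappa) e)) x =
        inner ℝ e (Matrix.toEuclideanLin (bayesMatrix S κ₀ p.kappa) x) := by
      intro x
      rw [(h.isGaussianPair κ₀).inner_Sinv, bayesMatrix, toEuclideanLin_mul,
        inner_toEuclideanLin_transpose]
    simp_rw [hin]
    have hpt : ∀ t : Stack p.kappa du × Y,
        ENNReal.ofReal (inner ℝ e (Matrix.toEuclideanLin (bayesMatrix S κ₀ p.kappa)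
          (fstar t.2)) ^ 2) ≤
        ENNReal.ofReal (‖e‖ ^ 2) * (ENNReal.ofReal (‖Matrix.toEuclideanLin M (f t.2) -
            Matrix.toEuclideanLin (bayesMatrix S κ₀ p.kappa) (fstar t.2)‖ ^ 2) +
          B.indicator (fun t => ENNReal.ofReal (envelope p fstar t.2)) t) := by
      intro t
      by_cases ht : t ∈ B
      · rw [Set.indicator_of_mem ht]
        refine le_trans ?_ (mul_le_mul_right le_add_self _)
        rw [← ENNReal.ofReal_mul (sq_nonneg _)]
        refine ENNReal.ofReal_le_ofReal ?_
        have h1 := abs_real_inner_le_norm e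
          (Matrix.toEuclideanLin (bayesMatrix S κ₀ p.kappa) (fstar t.2))
        have h2 := hR.norm_hstar t.2
        rw [← sq_abs]
        calc _ ≤ (‖e‖ * ‖Matrix.toEuclideanLin (bayesMatrix S κ₀ p.kappa) (fstar t.2)‖) ^ 2 :=
              pow_le_pow_left₀ (abs_nonneg _) h1 2
          _ ≤ _ := by rw [mul_pow]; exact mul_le_mul_of_nonneg_left h2 (sq_nonneg _)
      · rw [Set.indicator_of_notMem ht, add_zero, ← ENNReal.ofReal_mul (sq_nonneg _)]
        refine ENNReal.ofReal_le_ofReal ?_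
        have hmem : Matrix.toEuclideanLin M (f t.2) ∈
            Submodule.span ℝ (Set.range fun i => Matrix.toEuclideanLin M (f (s i).2)) := by
          by_contra hcon
          exact ht (by rw [hBdef, Set.mem_ofPred_eq, bot_sup_eq]; exact hcon)
        have h0 := inner_eq_zero_of_mem_span hn hV hmem he
        have h1 := abs_real_inner_le_norm e (Matrix.toEuclideanLin M (f t.2) -
          Matrix.toEuclideanLin (bayesMatrix S κ₀ p.kappa) (fstar t.2))
        rw [inner_sub_right, h0, zero_sub, abs_neg] at h1
        rw [← sq_abs, ← mul_pow]
        exact pow_le_pow_left₀ (abs_nonneg _) h1 2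
    calc _ ≤ ∫⁻ t, ENNReal.ofReal (‖e‖ ^ 2) *
            (ENNReal.ofReal (‖Matrix.toEuclideanLin M (f t.2) -
              Matrix.toEuclideanLin (bayesMatrix S κ₀ p.kappa) (fstar t.2)‖ ^ 2) +
            B.indicator (fun t => ENNReal.ofReal (envelope p fstar t.2)) t) ∂μ :=
          lintegral_mono hpt
      _ = ENNReal.ofReal (‖e‖ ^ 2) * (∫⁻ t, ENNReal.ofReal (‖Matrix.toEuclideanLin M (f t.2) -
              Matrix.toEuclideanLin (bayesMatrix S κ₀ p.kappa) (fstar t.2)‖ ^ 2) ∂μ +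
            ∫⁻ t, B.indicator (fun t => ENNReal.ofReal (envelope p fstar t.2)) t ∂μ) := by
          have hH := hR.H_measurable
          rw [lintegral_const_mul' _ _ ENNReal.ofReal_ne_top,
            lintegral_add_right _ (Measurable.indicator (by fun_prop) hB)]
      _ ≤ ENNReal.ofReal (‖e‖ ^ 2) * (ENNReal.ofReal ε +
            ENNReal.ofReal (5 / 2 * (dx * cConc p) * √ρ)) :=
          mul_le_mul_right (add_le_add hM (hR.lintegral_indicator_le hB hρ hs)) _
      _ = _ := by
          rw [← ENNReal.ofReal_add hε (by positivity), ← ENNReal.ofReal_mul (sq_nonneg _)]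
  have hVV : ∀ x, LinearMap.adjoint (Matrix.toEuclideanLin V) (Matrix.toEuclideanLin V x) = x := by
    intro x
    rw [← toEuclideanLin_transpose, ← toEuclideanLin_mul, hV.1, Matrix.toLpLin_one]; rfl
  have hlow : ∀ a : Vec dx, sigmaMinId S p * ‖a‖ ≤
      ‖Matrix.toEuclideanLin (Vᵀ * bayesMatrix S κ₀ p.kappa) a‖ := by
    intro a
    rw [h.sigmaMinId_eq, bayesMatrix, toEuclideanLin_mul, toEuclideanLin_mul,
      toEuclideanLin_transpose, toEuclideanLin_transpose]
    refine mul_norm_le_norm_adjoint_comp (h.isPositive_stateCov κ₀) (h.stateCov_inv κ₀) hVV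
      (by linarith) hσ.le (fun c => inner_stateCov_le S h _ c) (fun c => ?_) hproj
      (by positivity) hτ a
    rw [← toEuclideanLin_transpose]
    exact h.sigmaC_mul_norm_le c
  have hpos : 0 < sigmaMinId S p := by
    rw [h.sigmaMinId_eq]; positivity
  refine ⟨Vᵀ * bayesMatrix S κ₀ p.kappa, isUnit_of_mul_norm_le _ hpos hlow,
    le_min h.sigmaMinId_le_one (le_sigmaMin h.dx_pos _ hpos.le hlow), max_le ?_ ?_, ?_⟩
  · rw [sigmaMaxId, Real.one_le_sqrt]; exact h.one_le_Psi
  · refine norm_le_of_norm_toEuclideanLin_le _ (Real.sqrt_nonneg _) fun a => ?_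
    rw [toEuclideanLin_mul]
    refine (norm_toEuclideanLin_transpose_le hV.1 _).trans ((norm_toEuclideanLin_le _ _).trans ?_)
    exact mul_le_mul_of_nonneg_right (h.norm_bayesMatrix_le κ₀) (norm_nonneg _)
  · refine (lintegral_mono fun t => ?_).trans hM
    rw [← ofReal_norm, ← ENNReal.ofReal_pow (norm_nonneg _)]
    refine ENNReal.ofReal_le_ofReal (pow_le_pow_left₀ (norm_nonneg _) ?_ 2)
    rw [decoder, toEuclideanLin_mul, ← map_sub]
    exact norm_toEuclideanLin_transpose_le hV.1 _

end Regression

/-! ### Phase I succeeds once the regression error is small -/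

section Guarantee

variable {dx du : ℕ} {Y : Type*} [MeasurableSpace Y] {S : System dx du Y} {p : Params}
  {fstar : Y → Vec dx} {F : Finset (Y → Vec dx)} {n : ℕ} {δ : ℝ}

theorem PhaseOneGuarantee.mono {ε ε' : ℝ} (h : PhaseOneGuarantee S p fstar F n δ ε)
    (hε : ε ≤ ε') : PhaseOneGuarantee S p fstar F n δ ε' := by
  intro hhat hm herm
  obtain ⟨G, hG, hGp, hGs⟩ := h hhat hm herm
  refine ⟨G, hG, hGp, fun s hs V hV => ?_⟩
  obtain ⟨Sid, h1, h2, h3, h4⟩ := hGs s hs V hV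
  exact ⟨Sid, h1, h2, h3, h4.trans (ENNReal.ofReal_le_ofReal hε)⟩

/-- For `δ ≥ 1 / 3` the guarantee asks for an event of probability at least `0`. -/
theorem phaseOneGuarantee_of_one_third_le (hδ : 1 / 3 ≤ δ) (ε : ℝ) :
    PhaseOneGuarantee S p fstar F n δ ε := by
  intro hhat hm herm
  refine ⟨∅, MeasurableSet.empty, ?_, fun s hs => hs.elim⟩
  rw [ENNReal.ofReal_of_nonpos (by linarith)]
  exact zero_le

/-- The envelope alone gives a guarantee with `S_id = 1`. -/
theorem Assumptions.phaseOneGuarantee_of_envelope_le (h : Assumptions S p fstar F) (hδ : 0 ≤ δ)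
    {ε : ℝ} (hε : 8 * (dx * cConc p) ≤ ε) : PhaseOneGuarantee S p fstar F n δ ε := by
  intro hhat hm herm
  have := h.markov
  have hR := h.isRegressionModel (burnIn dx p n)
  refine ⟨Set.univ, MeasurableSet.univ, ?_, fun s _ V hV => ⟨1, isUnit_one, ?_, ?_, ?_⟩⟩
  · rw [measure_univ, ← ENNReal.ofReal_one]
    exact ENNReal.ofReal_le_ofReal (by linarith)
  · exact le_min h.sigmaMinId_le_one (h.sigmaMinId_le_one.trans
      (le_sigmaMin h.dx_pos _ zero_le_one fun a => by rw [Matrix.toLpLin_one]; simp))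
  · rw [sigmaMaxId]
    have h1 : 1 ≤ √p.Psi := by rw [Real.one_le_sqrt]; exact h.one_le_Psi
    refine max_le h1 (le_trans ?_ h1)
    exact norm_le_of_norm_toEuclideanLin_le _ zero_le_one fun a => by
      rw [Matrix.toLpLin_one]; simp
  · obtain ⟨f, hf, M, hM, hfM⟩ := (herm s.1).1
    have hpt : ∀ t : Stack p.kappa du × Y, ‖decoder V (hhat s.1) t.2 -
        Matrix.toEuclideanLin (1 : Matrix (Fin dx) (Fin dx) ℝ) (fstar t.2)‖ₑ ^ 2 ≤
        ENNReal.ofReal 4 * ENNReal.ofReal (envelope p fstar t.2) := by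
      intro t
      rw [← ofReal_norm, ← ENNReal.ofReal_pow (norm_nonneg _), ← ENNReal.ofReal_mul (by norm_num)]
      refine ENNReal.ofReal_le_ofReal ?_
      rw [Matrix.toLpLin_one, LinearMap.id_apply]
      have h1 : ‖decoder V (hhat s.1) t.2‖ ^ 2 ≤ envelope p fstar t.2 := by
        refine le_trans (pow_le_pow_left₀ (norm_nonneg _)
          (norm_toEuclideanLin_transpose_le hV.1 _) 2) ?_
        rw [hfM]
        exact h.norm_sq_le_envelope hf hM t.2
      have h2 := h.norm_fstar_sq_le_envelope t.2
      have h3 := norm_sub_le (decoder V (hhat s.1) t.2) (fstar t.2)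
      have h4 := pow_le_pow_left₀ (norm_nonneg _) h3 2
      nlinarith [sq_nonneg (‖decoder V (hhat s.1) t.2‖ - ‖fstar t.2‖)]
    refine (lintegral_mono hpt).trans ?_
    rw [lintegral_const_mul' _ _ ENNReal.ofReal_ne_top]
    refine (mul_le_mul_right hR.lintegral_envelope_le _).trans ?_
    rw [← ENNReal.ofReal_mul (by norm_num)]
    exact ENNReal.ofReal_le_ofReal (by linarith)

/-- The main guarantee: `ε` bounds the regression error, and the error of the regression and of the
missing directions together is at most a constant times `σ_min(C_κ)²`. -/
theorem Assumptions.phaseOneGuarantee (h : Assumptions S p fstar F) (hn : 3 ≤ n) (hδ : 0 < δ)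
    (hl : 1 ≤ Real.log (n / δ)) {ε : ℝ} (hε0 : 0 ≤ ε)
    (hε : 8 / n * ((3 * (dx * cConc p) + 4 * (du * p.kappa)) * Real.log (4 / δ) +
          4 * (dx * cConc p) * Real.log n * (du * p.kappa * dx * Real.log (1 + 2 * n) +
            Real.log F.card + Real.log (1 / δ))) + 20 * (dx * cConc p) / n ≤ ε)
    (hτ : ε + 5 / 2 * (dx * cConc p) * √(4 * dx * Real.log (n / δ) / n) ≤
      3 / 4 * sigmaC S p ^ 2 / (2 * p.Psi ^ 2 * p.alpha ^ 2 / (1 - p.gamma))) :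
    PhaseOneGuarantee S p fstar F n δ ε := by
  intro hhat hm herm
  have := h.markov
  set μ := dataLaw S (burnIn dx p n) p.kappa with hμ
  set P := Measure.pi fun _ : Fin n => μ with hP
  have hn0 : 0 < n := by omega
  have hnR : (0 : ℝ) < n := by exact_mod_cast hn0
  have hdx : (0 : ℝ) < dx := by exact_mod_cast h.dx_pos
  set ρ := 4 * dx * Real.log (n / δ) / n with hρ
  have hρ0 : 0 < ρ := by
    have : 0 < Real.log (n / δ) := by linarith
    positivity
  obtain ⟨G₁, hG₁, hG₁p, hG₁s⟩ := h.exists_erm_event (burnIn dx p n) hn hδ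
  let B : Set ((Fin n → Stack p.kappa du × Y) × (Fin n → Stack p.kappa du × Y)) :=
    {s | ENNReal.ofReal ρ < μ {t | hhat s.1 t.2 ∉ (⊥ : Submodule ℝ (Stack p.kappa du)) ⊔
      Submodule.span ℝ (Set.range fun i => hhat s.1 (s.2 i).2)}}
  have hBm : MeasurableSet B := by
    have h1 : MeasurableSet {q : ((Fin n → Stack p.kappa du × Y) ×
        (Fin n → Stack p.kappa du × Y)) × (Stack p.kappa du × Y) |
        hhat q.1.1 q.2.2 ∉ (⊥ : Submodule ℝ (Stack p.kappa du)) ⊔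
          Submodule.span ℝ (Set.range fun i => hhat q.1.1 (q.1.2 i).2)} := by
      refine measurableSet_notMem_sup_span ⊥ (z := fun q : ((Fin n → Stack p.kappa du × Y) ×
        (Fin n → Stack p.kappa du × Y)) × (Stack p.kappa du × Y) =>
          fun i => hhat q.1.1 (q.1.2 i).2) (x := fun q => hhat q.1.1 q.2.2) ?_ ?_
      · refine measurable_pi_lambda _ fun i => ?_
        exact hm.comp ((measurable_fst.comp measurable_fst).prodMk (measurable_snd.comp
          ((measurable_pi_apply i).comp (measurable_snd.comp measurable_fst))))
      · exact hm.comp ((measurable_fst.comp measurable_fst).prodMk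
          (measurable_snd.comp measurable_snd))
    exact measurableSet_lt measurable_const (measurable_measure_prodMk_left (ν := μ) h1)
  have hBp : (P.prod P) B ≤ ENNReal.ofReal δ := by
    rw [Measure.prod_apply hBm]
    calc ∫⁻ s₁, P (Prod.mk s₁ ⁻¹' B) ∂P ≤ ∫⁻ _s₁, ENNReal.ofReal δ ∂P := by
          refine lintegral_mono fun s₁ => ?_
          obtain ⟨f, hf, M, -, hfM⟩ := (herm s₁).1
          have h1 := measure_span_deficient_le_of_log μ h.dx_pos hn0 hδ hl M (h.measurable f hf)
          refine le_trans (le_of_eq ?_) h1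
          simp only [B, Set.preimage_ofPred_eq, hfM, hρ, hP]
      _ = ENNReal.ofReal δ := by simp
  refine ⟨(G₁ ×ˢ Set.univ) ∩ Bᶜ, (hG₁.prod MeasurableSet.univ).inter hBm.compl, ?_, ?_⟩
  · have h1 : (P.prod P) ((G₁ ×ˢ Set.univ) ∩ Bᶜ)ᶜ ≤ ENNReal.ofReal (3 * δ) := by
      rw [Set.compl_inter, compl_compl]
      refine (measure_union_le _ _).trans ?_
      have e : (G₁ ×ˢ (Set.univ : Set (Fin n → Stack p.kappa du × Y)))ᶜ =
          G₁ᶜ ×ˢ Set.univ := by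
        ext q; simp
      rw [e, Measure.prod_prod, measure_univ, mul_one]
      refine (add_le_add hG₁p hBp).trans (le_of_eq ?_)
      rw [← ENNReal.ofReal_add (by positivity) hδ.le]
      congr 1; ring
    have hGm : MeasurableSet ((G₁ ×ˢ Set.univ) ∩ Bᶜ) :=
      (hG₁.prod MeasurableSet.univ).inter hBm.compl
    rw [ENNReal.ofReal_sub _ (by positivity), ENNReal.ofReal_one, tsub_le_iff_right,
      ← measure_univ (μ := P.prod P), ← measure_add_measure_compl hGm]
    exact add_le_add le_rfl h1
  · rintro ⟨s₁, s₂⟩ ⟨⟨hs₁, -⟩, hs₂⟩ V hV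
    have herm₁ := herm s₁
    have hE := (hG₁s s₁ hs₁ _ herm₁).trans (ENNReal.ofReal_le_ofReal hε)
    obtain ⟨f, hf, M, -, hfM⟩ := herm₁.1
    simp only [B, Set.mem_compl_iff, Set.mem_ofPred_eq, not_lt] at hs₂
    rw [hfM] at hE hs₂ hV ⊢
    exact h.exists_transformation (burnIn dx p n) hn0 hf hε0 hρ0 hE hs₂ hτ hV

end Guarantee

/-! ### Sample size arithmetic -/

section Arithmetic

variable {b N d f n δ : ℝ}

theorem log_sq_le {x : ℝ} (hx : 1 ≤ x) : Real.log x ^ 2 ≤ 64 * √√x := by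
  have h1 : Real.log √√√x = Real.log x / 8 := by
    rw [Real.log_sqrt (by positivity), Real.log_sqrt (by positivity), Real.log_sqrt (by positivity)]
    ring
  have h2 := Real.log_le_self (Real.sqrt_nonneg √√x)
  rw [h1] at h2
  have h3 : Real.log x ≤ 8 * √√√x := by linarith
  calc Real.log x ^ 2 ≤ (8 * √√√x) ^ 2 := pow_le_pow_left₀ (Real.log_nonneg hx) h3 2
    _ = 64 * √√x := by rw [mul_pow, Real.sq_sqrt (Real.sqrt_nonneg _)]; norm_num

/-- The bound of the regression step, simplified with `log (1 + 2 n) ≤ 2 log n`, `4 / δ ≤ n / δ` and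
`1 ≤ log (n / δ)`. -/
theorem regression_error_le (hb : 0 ≤ b) (hN : 0 ≤ N) (hd : 0 ≤ d) (hf : 0 ≤ f) (hn : 4 ≤ n)
    (hδ : 0 < δ) (hl : 1 ≤ Real.log (n / δ)) :
    8 / n * ((3 * b + 4 * N) * Real.log (4 / δ) + 4 * b * Real.log n *
      (N * d * Real.log (1 + 2 * n) + f + Real.log (1 / δ))) + 20 * b / n ≤
    100 / n * ((b + N) * Real.log (n / δ) +
      b * Real.log n * (Real.log n * (N * d) + f + Real.log (n / δ))) := by
  have hn0 : 0 < n := by linarith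
  set l := Real.log (n / δ) with hl'
  set ln := Real.log n with hln
  have hln0 : 0 ≤ ln := Real.log_nonneg (by linarith)
  have h1 : Real.log (4 / δ) ≤ l :=
    Real.log_le_log (by positivity) (div_le_div_of_nonneg_right hn hδ.le)
  have h2 : Real.log (1 / δ) ≤ l :=
    Real.log_le_log (by positivity) (div_le_div_of_nonneg_right (by linarith) hδ.le)
  have h3 : Real.log (1 + 2 * n) ≤ 2 * ln := by
    have h4 : 2 * ln = Real.log (n ^ 2) := by rw [Real.log_pow]; simp [hln]
    rw [h4]
    exact Real.log_le_log (by positivity) (by nlinarith)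
  have t1 : (3 * b + 4 * N) * Real.log (4 / δ) ≤ 4 * ((b + N) * l) := by
    have := mul_le_mul_of_nonneg_left h1 (by positivity : 0 ≤ 3 * b + 4 * N)
    nlinarith [mul_nonneg hb (by linarith : 0 ≤ l)]
  have t2 : N * d * Real.log (1 + 2 * n) + f + Real.log (1 / δ) ≤ 2 * (ln * (N * d) + f + l) := by
    have := mul_le_mul_of_nonneg_left h3 (by positivity : 0 ≤ N * d)
    linarith
  have t3 := mul_le_mul_of_nonneg_left t2 (by positivity : 0 ≤ 4 * b * ln)
  have t4 : 20 * b ≤ 20 * ((b + N) * l) := by nlinarith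
  have t5 : 0 ≤ b * ln * (ln * (N * d) + f + l) := by positivity
  have t6 : 0 ≤ (b + N) * l := by positivity
  rw [div_mul_eq_mul_div, div_mul_eq_mul_div, ← add_div]
  refine div_le_div_of_nonneg_right ?_ hn0.le
  linarith

theorem regression_error_le_sq (hb : 0 ≤ b) (hN : 1 ≤ N) (hd : 1 ≤ d) (hf : 0 ≤ f) (hn : 1 ≤ n)
    (hδ : 0 < δ) (hδ1 : δ < 1) (hl : 1 ≤ Real.log (n / δ)) :
    100 / n * ((b + N) * Real.log (n / δ) +
      b * Real.log n * (Real.log n * (N * d) + f + Real.log (n / δ))) ≤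
    300 * (Real.log (n / δ) ^ 2 * (N + b) * (f + N * d) / n) := by
  have hn0 : 0 < n := by linarith
  have hlnl : Real.log n ≤ Real.log (n / δ) :=
    Real.log_le_log hn0 (by rw [le_div_iff₀ hδ]; nlinarith)
  have hln0 : 0 ≤ Real.log n := Real.log_nonneg hn
  set l := Real.log (n / δ)
  have hNd : 1 ≤ N * d := one_le_mul_of_one_le_of_one_le hN hd
  have hl2 : l ≤ l ^ 2 := by nlinarith
  have hc : 1 ≤ f + N * d := by linarith
  have t1 : (b + N) * l ≤ l ^ 2 * (N + b) * (f + N * d) := by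
    calc (b + N) * l ≤ (b + N) * l ^ 2 := mul_le_mul_of_nonneg_left hl2 (by positivity)
      _ = l ^ 2 * (N + b) * 1 := by ring
      _ ≤ _ := mul_le_mul_of_nonneg_left hc (by positivity)
  have t2 : b * Real.log n * (Real.log n * (N * d) + f + l) ≤
      (N + b) * l * (l * (2 * (f + N * d))) := by
    refine mul_le_mul (mul_le_mul (by linarith) hlnl hln0 (by positivity)) ?_ (by positivity)
      (by positivity)
    have h1 := mul_le_mul_of_nonneg_right hlnl (by positivity : 0 ≤ N * d)
    have h2 : f ≤ l * f := by nlinarith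
    have h3 : l ≤ l * (N * d) := by nlinarith
    have h4 : 0 ≤ l * f := by positivity
    linarith
  rw [div_mul_eq_mul_div, mul_div_assoc', div_le_div_iff_of_pos_right hn0]
  linarith

/-- The explicit condition, with `R` standing for `σ_min(C_κ)² / s ≤ 1`. -/
theorem condition_of_explicit {ε R : ℝ} (hb : 1 ≤ b) (hN : 1 ≤ N) (hd : 1 ≤ d) (hf : 0 ≤ f)
    (hn : 0 < n) (hl : 1 ≤ Real.log (n / δ)) (hR : 0 < R) (hR1 : R ≤ 1)
    (hε : ε = 300 * (Real.log (n / δ) ^ 2 * (N + b) * (f + N * d) / n))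
    (h : √ε * √b ≤ 2 / 71 * R) :
    4 ≤ n ∧ ε + 5 / 2 * b * √(4 * d * Real.log (n / δ) / n) ≤ 3 / 4 * R := by
  set l := Real.log (n / δ) with hldef
  have hε0 : 0 ≤ ε := by rw [hε]; positivity
  have h1 : ε * b ≤ (2 / 71 * R) ^ 2 := by
    rw [← Real.sq_sqrt hε0, ← Real.sq_sqrt (by linarith : 0 ≤ b), ← mul_pow]
    exact pow_le_pow_left₀ (by positivity) h 2
  have hNd : 1 ≤ N * d := one_le_mul_of_one_le_of_one_le hN hd
  have hl2 : 1 ≤ l ^ 2 := one_le_pow₀ hl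
  -- `ε b ≥ 300 b² d l / n`
  have h2 : b ^ 2 * (4 * d * l / n) ≤ ε * b := by
    have h3 : b * (d * l) ≤ l ^ 2 * (N + b) * (f + N * d) := by
      have h4 : d * l ≤ l ^ 2 * (f + N * d) := by
        have h5 : l ≤ l ^ 2 := by nlinarith
        have h6 : d ≤ f + N * d := by nlinarith
        calc d * l ≤ (f + N * d) * l ^ 2 := mul_le_mul h6 h5 (by linarith) (by linarith)
          _ = _ := by ring
      calc b * (d * l) ≤ (N + b) * (l ^ 2 * (f + N * d)) :=
            mul_le_mul (by linarith) h4 (by positivity) (by positivity)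
        _ = _ := by ring
    calc b ^ 2 * (4 * d * l / n) = 4 * b * (b * (d * l) / n) := by ring
      _ ≤ 4 * b * (l ^ 2 * (N + b) * (f + N * d) / n) :=
          mul_le_mul_of_nonneg_left (div_le_div_of_nonneg_right h3 hn.le) (by positivity)
      _ ≤ 300 * b * (l ^ 2 * (N + b) * (f + N * d) / n) :=
          mul_le_mul_of_nonneg_right (by linarith) (by positivity)
      _ = ε * b := by rw [hε]; ring
  have h3 : b * √(4 * d * l / n) ≤ 2 / 71 * R := by
    refine le_of_sq_le_sq ?_ (by positivity)
    rw [mul_pow, Real.sq_sqrt (by positivity)]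
    exact h2.trans h1
  have h4 : ε ≤ 2 / 71 * R := by
    have h5 : ε ≤ ε * b := by nlinarith
    nlinarith
  refine ⟨?_, by linarith⟩
  have h5 : 300 / n ≤ ε := by
    rw [hε, ← mul_div_assoc]
    refine div_le_div_of_nonneg_right ?_ hn.le
    have h6 : 1 ≤ l ^ 2 * (N + b) * (f + N * d) :=
      one_le_mul_of_one_le_of_one_le (one_le_mul_of_one_le_of_one_le hl2 (by linarith))
        (by linarith)
    linarith
  have h6 : 300 / n ≤ 1 := by linarith
  rw [div_le_one hn] at h6
  linarith

/-- In the regime `R⁴ D l² ≤ d n` with `R⁴ d D ≤ n`, where `l = log (n / δ)` and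
`D = N (f + N d)`, the two error terms are of order `k / R³` and `k / R²`. -/
theorem error_terms_le {k R : ℝ} (hk : 1 ≤ k) (hR100 : 100 ≤ R) (hd : 1 ≤ d) (hdN : d ≤ N)
    (hf : 0 ≤ f) (hδ : 0 < δ) (hδ1 : δ < 1) (hl : 1 ≤ Real.log (n / δ))
    (hn : R ^ 4 * (d * (N * (f + N * d))) ≤ n)
    (hreg : R ^ 4 * (N * (f + N * d) * Real.log (n / δ) ^ 2) ≤ d * n) :
    0 < n ∧ R ^ 3 * ((d * k + N) * Real.log (n / δ) +
      d * k * Real.log n * (Real.log n * (N * d) + f + Real.log (n / δ))) ≤ 65 * k * n ∧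
    d * √(4 * d * Real.log (n / δ) / n) ≤ 2 / R ^ 2 := by
  have hR0 : 0 < R := by linarith
  have hN : 1 ≤ N := hd.trans hdN
  set D := N * (f + N * d) with hD
  have hNd : 1 ≤ N * d := one_le_mul_of_one_le_of_one_le hN hd
  have hD1 : 1 ≤ D := one_le_mul_of_one_le_of_one_le hN (by linarith)
  have hDN2 : N ^ 2 * d ≤ D := by rw [hD]; nlinarith [mul_nonneg (by linarith : 0 ≤ N) hf]
  have hDd3 : d ^ 3 ≤ D := by
    calc d ^ 3 = d ^ 2 * d := by ring
      _ ≤ N ^ 2 * d := mul_le_mul_of_nonneg_right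
          (pow_le_pow_left₀ (by linarith) hdN 2) (by linarith)
      _ ≤ D := hDN2
  have hDN : N ≤ D := by rw [hD]; nlinarith
  have hDf : d * f ≤ D := by
    rw [hD]
    exact mul_le_mul hdN (by linarith) hf (by linarith)
  have hdD : 1 ≤ d * D := one_le_mul_of_one_le_of_one_le hd hD1
  have hn1 : 1 ≤ n := by
    have h1 : 1 ≤ R ^ 4 := one_le_pow₀ (by linarith)
    exact (one_le_mul_of_one_le_of_one_le h1 hdD).trans hn
  have hn0 : 0 < n := by linarith
  have hlnl : Real.log n ≤ Real.log (n / δ) :=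
    Real.log_le_log hn0 (by rw [le_div_iff₀ hδ]; nlinarith)
  have hln0 : 0 ≤ Real.log n := Real.log_nonneg hn1
  have hlog := log_sq_le hn1
  set l := Real.log (n / δ) with hl'
  set ln := Real.log n with hln
  set q := √√n with hq
  have hq4 : q ^ 4 = n := by
    rw [show q ^ 4 = (q ^ 2) ^ 2 by ring, hq, Real.sq_sqrt (Real.sqrt_nonneg _),
      Real.sq_sqrt hn0.le]
  have hq0 : 0 < q := by rw [hq]; positivity
  -- the product of the two conditions
  have hDl : R ^ 4 * (D * l) ≤ n := by
    refine le_of_sq_le_sq ?_ hn0.le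
    have h1 := mul_le_mul hn hreg (by positivity) hn0.le
    have h2 : d * (R ^ 4 * (D * l)) ^ 2 ≤ d * n ^ 2 := by
      calc d * (R ^ 4 * (D * l)) ^ 2 = R ^ 4 * (d * D) * (R ^ 4 * (D * l ^ 2)) := by ring
        _ ≤ n * (d * n) := h1
        _ = d * n ^ 2 := by ring
    exact le_of_mul_le_mul_left h2 (by linarith)
  have hR4 : 0 < R ^ 4 := by positivity
  have hk0 : 0 ≤ k := by linarith
  have h2k : 0 ≤ 2 * k := by linarith
  have t1 : R ^ 4 * ((d * k + N) * l) ≤ 2 * k * n := by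
    have h1 : (d * k + N) * l ≤ 2 * k * (D * l) := by
      have h2 : d * k + N ≤ 2 * k * D := by nlinarith
      calc _ ≤ 2 * k * D * l := mul_le_mul_of_nonneg_right h2 (by linarith)
        _ = _ := by ring
    linarith [mul_le_mul_of_nonneg_left h1 hR4.le, mul_le_mul_of_nonneg_left hDl h2k]
  have t2 : R ^ 4 * (d * k * ln * f) ≤ k * n := by
    have h1 : d * k * ln * f ≤ k * (D * l) := by
      calc d * k * ln * f = k * (d * f * ln) := by ring
        _ ≤ k * (D * l) := mul_le_mul_of_nonneg_left
            (mul_le_mul hDf hlnl hln0 (by linarith)) (by linarith)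
    linarith [mul_le_mul_of_nonneg_left h1 hR4.le, mul_le_mul_of_nonneg_left hDl hk0]
  have t3 : R ^ 4 * (d * k * ln * l) ≤ k * n := by
    have h1 : d * (d * k * ln * l) ≤ k * (D * l ^ 2) := by
      have h2 : d ^ 2 ≤ D := by
        refine le_trans ?_ hDd3
        nlinarith [sq_nonneg d]
      calc d * (d * k * ln * l) = k * (d ^ 2 * (ln * l)) := by ring
        _ ≤ k * (D * (l * l)) := mul_le_mul_of_nonneg_left
            (mul_le_mul h2 (mul_le_mul_of_nonneg_right hlnl (by linarith)) (by positivity)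
              (by linarith)) (by linarith)
        _ = _ := by ring
    have h3 : d * (R ^ 4 * (d * k * ln * l)) ≤ d * (k * n) := by
      linarith [mul_le_mul_of_nonneg_left h1 hR4.le, mul_le_mul_of_nonneg_left hreg hk0]
    exact le_of_mul_le_mul_left h3 (by linarith)
  have t4 : R ^ 3 * (d * k * ln * (ln * (N * d))) ≤ 64 * k * n := by
    have h1 : R ^ 2 * (d * N) ≤ q ^ 2 := by
      refine le_of_sq_le_sq ?_ (by positivity)
      calc (R ^ 2 * (d * N)) ^ 2 = R ^ 4 * (d * (N ^ 2 * d)) := by ring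
        _ ≤ R ^ 4 * (d * D) := mul_le_mul_of_nonneg_left
            (mul_le_mul_of_nonneg_left hDN2 (by linarith)) hR4.le
        _ ≤ n := hn
        _ = (q ^ 2) ^ 2 := by rw [← hq4]; ring
    have h2 : R * d ≤ q := by
      refine le_of_sq_le_sq (le_trans ?_ h1) hq0.le
      rw [mul_pow, pow_two d]
      exact mul_le_mul_of_nonneg_left (mul_le_mul_of_nonneg_left hdN (by linarith)) (by positivity)
    calc R ^ 3 * (d * k * ln * (ln * (N * d))) =
          k * ((R * d) * (R ^ 2 * (d * N))) * ln ^ 2 := by ring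
      _ ≤ k * (q * q ^ 2) * (64 * q) := by
          refine mul_le_mul (mul_le_mul_of_nonneg_left
            (mul_le_mul h2 h1 (by positivity) hq0.le) (by linarith)) hlog (sq_nonneg _)
            (by positivity)
      _ = 64 * k * q ^ 4 := by ring
      _ = 64 * k * n := by rw [hq4]
  have t5 : d * √(4 * d * l / n) ≤ 2 / R ^ 2 := by
    refine le_of_sq_le_sq ?_ (by positivity)
    rw [mul_pow, Real.sq_sqrt (by positivity), div_pow, ← pow_mul, mul_div_assoc',
      div_le_div_iff₀ hn0 (by positivity)]
    norm_num
    have h1 : d ^ 3 * l ≤ D * l := mul_le_mul_of_nonneg_right hDd3 (by linarith)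
    linarith [mul_le_mul_of_nonneg_left h1 hR4.le]
  refine ⟨hn0, ?_, t5⟩
  have h1 : R * (R ^ 3 * ((d * k + N) * l + d * k * ln * f + d * k * ln * l)) ≤
      R * (k * n) := by
    have h2 : 4 * (k * n) ≤ R * (k * n) :=
      mul_le_mul_of_nonneg_right (by linarith) (by positivity)
    calc _ = R ^ 4 * ((d * k + N) * l) + R ^ 4 * (d * k * ln * f) +
          R ^ 4 * (d * k * ln * l) := by ring
      _ ≤ R * (k * n) := by linarith
  have h3 := le_of_mul_le_mul_left h1 hR0
  calc _ = R ^ 3 * ((d * k + N) * l + d * k * ln * f + d * k * ln * l) +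
        R ^ 3 * (d * k * ln * (ln * (N * d))) := by ring
    _ ≤ _ := by linarith

/-- With `R` a large multiple of `k m`, the regime of `error_terms_le` gives an error of at most
`3 / (4 m)`; here `m` stands for `s / σ_min(C_κ)²`. -/
theorem condition_of_polynomial {k m R : ℝ} (hk : 1 ≤ k) (hm : 1 ≤ m) (hR : R = 100 * k * m)
    (hd : 1 ≤ d) (hdN : d ≤ N) (hf : 0 ≤ f) (hδ : 0 < δ) (hδ1 : δ < 1)
    (hl : 1 ≤ Real.log (n / δ)) (hn : R ^ 4 * (d * (N * (f + N * d))) ≤ n)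
    (hreg : R ^ 4 * (N * (f + N * d) * Real.log (n / δ) ^ 2) ≤ d * n) :
    100 / n * ((d * k + N) * Real.log (n / δ) +
      d * k * Real.log n * (Real.log n * (N * d) + f + Real.log (n / δ))) +
      5 / 2 * (d * k) * √(4 * d * Real.log (n / δ) / n) ≤ 3 / 4 * m⁻¹ := by
  have hR100 : 100 ≤ R := by
    rw [hR]; nlinarith [one_le_mul_of_one_le_of_one_le hk hm]
  have hR0 : 0 < R := by linarith
  obtain ⟨hn0, hsum, t5⟩ := error_terms_le hk hR100 hd hdN hf hδ hδ1 hl hn hreg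
  set l := Real.log (n / δ)
  set ln := Real.log n
  have hfirst : 100 / n * ((d * k + N) * l + d * k * ln * (ln * (N * d) + f + l)) ≤
      6500 * k / R ^ 3 := by
    rw [div_mul_eq_mul_div, div_le_div_iff₀ hn0 (by positivity)]
    linarith
  have hsecond : 5 / 2 * (d * k) * √(4 * d * l / n) ≤ 5 * k / R ^ 2 := by
    calc _ = 5 / 2 * k * (d * √(4 * d * l / n)) := by ring
      _ ≤ 5 / 2 * k * (2 / R ^ 2) := mul_le_mul_of_nonneg_left t5 (by positivity)
      _ = _ := by ring
  have hthird : 6500 * k / R ^ 3 ≤ 65 * k / R ^ 2 := by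
    rw [div_le_div_iff₀ (by positivity) (by positivity)]
    have h1 : 0 ≤ k * R ^ 2 := by positivity
    nlinarith
  have hlast : 70 * k / R ^ 2 ≤ 3 / 4 * m⁻¹ := by
    rw [← div_eq_mul_inv, div_le_div_iff₀ (by positivity) (by linarith), hR]
    have h1 : k * m ≤ (k * m) * (k * m) := by
      nlinarith [one_le_mul_of_one_le_of_one_le hk hm]
    nlinarith
  have e : 65 * k / R ^ 2 + 5 * k / R ^ 2 = 70 * k / R ^ 2 := by rw [← add_div]; ring
  linarith

end Arithmetic

/-! ### The two forms of the sample size condition -/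

section SampleSize

variable {dx du : ℕ} {Y : Type*} [MeasurableSpace Y] {S : System dx du Y} {p : Params}
  {fstar : Y → Vec dx} {F : Finset (Y → Vec dx)} {n : ℕ} {δ : ℝ}

/-- Only `δ < 1 / 3` matters, and there `n / δ ≥ 3 > e`. -/
theorem one_le_log_div (hn : 0 < n) (hδ : 0 < δ) (hδ3 : δ < 1 / 3) : 1 ≤ Real.log (n / δ) := by
  have hn1 : (1 : ℝ) ≤ n := by exact_mod_cast hn
  rw [Real.le_log_iff_exp_le (by positivity), le_div_iff₀ hδ]
  nlinarith [Real.exp_one_lt_d9]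

theorem Assumptions.explicit_guarantee (h : Assumptions S p fstar F) (hn : 0 < n) (hδ : 0 < δ)
    (hcond : √(epsSq 300 du p F n δ) * √(dx * cConc p) ≤
      (1 - p.gamma) * sigmaC S p ^ 2 / (71 * p.alpha ^ 2 * p.Psi ^ 2)) :
    PhaseOneGuarantee S p fstar F n δ (epsSq 300 du p F n δ) := by
  rcases le_or_gt (1 / 3) δ with hδ3 | hδ3
  · exact phaseOneGuarantee_of_one_third_le hδ3 _
  have hl := one_le_log_div hn hδ hδ3
  have hγ : 0 < 1 - p.gamma := by linarith [h.gamma_mem.2]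
  have hΨ : 0 < p.Psi := by linarith [h.one_le_Psi]
  have hα : 0 < p.alpha := by linarith [h.one_le_alpha]
  have hnR : (0 : ℝ) < n := by exact_mod_cast hn
  have hd : (1 : ℝ) ≤ dx := by exact_mod_cast h.dx_pos
  have hN : (1 : ℝ) ≤ du * p.kappa := by
    exact_mod_cast Nat.mul_pos h.du_pos h.kappa_pos
  have hb : 1 ≤ dx * cConc p := one_le_mul_of_one_le_of_one_le hd h.one_le_cConc
  have hf : 0 ≤ Real.log F.card := Real.log_natCast_nonneg _
  have hσ := h.sigmaC_pos
  have hs := h.two_le_scale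
  have hσs := h.sigmaC_sq_le
  set R := sigmaC S p ^ 2 / (2 * p.Psi ^ 2 * p.alpha ^ 2 / (1 - p.gamma)) with hR
  have hε : epsSq 300 du p F n δ = 300 * (Real.log (n / δ) ^ 2 * (du * p.kappa + dx * cConc p) *
      (Real.log F.card + du * p.kappa * dx) / n) := by
    rw [epsSq, complexity]; ring
  have hR71 : (1 - p.gamma) * sigmaC S p ^ 2 / (71 * p.alpha ^ 2 * p.Psi ^ 2) = 2 / 71 * R := by
    rw [hR]; field_simp
  rw [hR71] at hcond
  obtain ⟨hn4, hτ⟩ := condition_of_explicit hb hN hd hf hnR hl (by positivity)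
    ((div_le_one (by linarith)).2 hσs) hε hcond
  have hn4' : 4 ≤ n := by exact_mod_cast hn4
  refine h.phaseOneGuarantee (by omega) hδ hl (by rw [hε]; positivity) ?_ ?_
  · refine (regression_error_le (by linarith) (by linarith) (by linarith) hf hn4 hδ hl).trans ?_
    rw [hε]
    exact regression_error_le_sq (by linarith) hN hd hf (by linarith) hδ (by linarith) hl
  · exact hτ.trans_eq (mul_div_assoc _ _ _).symm

/-- The polynomial whose value is `c_conc`. -/
noncomputable def concPoly : MvPolynomial (Fin 6) ℝ :=
  .C 12 * .X 4 ^ 2 * .X 3 ^ 3 * .X 0 ^ 2 * .X 2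

/-- The polynomial whose value is the bound `2 Ψ² α² / (1 - γ)` on the state covariance divided by
`σ_min(C_κ)²`. -/
noncomputable def condPoly : MvPolynomial (Fin 6) ℝ :=
  .C 2 * .X 3 ^ 2 * .X 0 ^ 2 * .X 2 * .X 5 ^ 2

/-- The polynomial `C₁` of the sample size condition. -/
noncomputable def sizePoly : MvPolynomial (Fin 6) ℝ := (.C 100 * concPoly * condPoly) ^ 4

/-- The polynomial `C₂` of the error bound. -/
noncomputable def errorPoly : MvPolynomial (Fin 6) ℝ := .C 8 * concPoly * sizePoly

theorem polyAt_concPoly : polyAt concPoly S p = cConc p := by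
  simp [polyAt, concPoly, cConc, div_eq_mul_inv]

theorem polyAt_condPoly : polyAt condPoly S p =
    2 * p.Psi ^ 2 * p.alpha ^ 2 / (1 - p.gamma) / sigmaC S p ^ 2 := by
  simp [polyAt, condPoly, div_eq_mul_inv]

theorem polyAt_sizePoly : polyAt sizePoly S p =
    (100 * polyAt concPoly S p * polyAt condPoly S p) ^ 4 := by
  simp [polyAt, sizePoly]

theorem polyAt_errorPoly : polyAt errorPoly S p =
    8 * polyAt concPoly S p * polyAt sizePoly S p := by
  simp [polyAt, errorPoly]

theorem Assumptions.polynomial_guarantee (h : Assumptions S p fstar F) (hn : 0 < n) (hδ : 0 < δ)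
    (hcond : polyAt sizePoly S p * (dx * du * p.kappa * complexity du p F) ≤ n) :
    PhaseOneGuarantee S p fstar F n δ (polyAt errorPoly S p *
      (du * p.kappa * complexity du p F * Real.log (n / δ) ^ 2 / n)) := by
  rcases le_or_gt (1 / 3) δ with hδ3 | hδ3
  · exact phaseOneGuarantee_of_one_third_le hδ3 _
  have hl := one_le_log_div hn hδ hδ3
  have hnR : (0 : ℝ) < n := by exact_mod_cast hn
  have hd : (1 : ℝ) ≤ dx := by exact_mod_cast h.dx_pos
  have hdN : (dx : ℝ) ≤ du * p.kappa := by
    rw [mul_comm]; exact_mod_cast h.dx_le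
  have hk := h.one_le_cConc
  have hf : 0 ≤ Real.log F.card := Real.log_natCast_nonneg _
  have hσ := h.sigmaC_pos
  have hs := h.two_le_scale
  have hσs := h.sigmaC_sq_le
  have hcomp : complexity du p F = Real.log F.card + du * p.kappa * dx := by
    rw [complexity]; ring
  rw [polyAt_errorPoly, polyAt_concPoly]
  rw [polyAt_sizePoly, polyAt_concPoly, polyAt_condPoly] at hcond ⊢
  rw [hcomp] at hcond ⊢
  set m := 2 * p.Psi ^ 2 * p.alpha ^ 2 / (1 - p.gamma) / sigmaC S p ^ 2 with hm
  set k := cConc p with hk'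
  set N : ℝ := du * p.kappa with hN
  set f := Real.log F.card with hf'
  set l := Real.log (n / δ) with hl'
  have hm1 : 1 ≤ m := by rw [hm, one_le_div (by positivity)]; exact hσs
  set R := 100 * k * m with hR
  have hR100 : 100 ≤ R := by
    rw [hR]; nlinarith [one_le_mul_of_one_le_of_one_le hk hm1]
  have hR4 : 100 ≤ R ^ 4 := hR100.trans (le_self_pow₀ (by linarith) (by norm_num))
  have hN1 : 1 ≤ N := hd.trans hdN
  have hNd : 1 ≤ N * dx := one_le_mul_of_one_le_of_one_le hN1 hd
  have hcond' : R ^ 4 * (dx * (N * (f + N * dx))) ≤ n := by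
    refine le_trans (le_of_eq ?_) hcond
    rw [hN]; ring
  have hτ := condition_of_polynomial (n := n) hk hm1 hR hd hdN hf hδ (by linarith) hl hcond'
  clear_value R
  -- whether the claimed error lies below the trivial one
  rcases le_or_gt (R ^ 4 * (N * (f + N * dx) * l ^ 2)) (dx * n) with hreg | hreg
  · have hn4 : (4 : ℝ) ≤ n := by
      have h1 : (1 : ℝ) ≤ dx * (N * (f + N * dx)) :=
        one_le_mul_of_one_le_of_one_le hd (one_le_mul_of_one_le_of_one_le hN1 (by linarith))
      nlinarith
    have hn4' : 4 ≤ n := by exact_mod_cast hn4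
    have hτ := hτ hreg
    have hraw := regression_error_le (b := dx * k) (N := N) (d := dx) (f := f) (by positivity)
      (by linarith) (by linarith) hf hn4 hδ hl
    have hln : 0 ≤ Real.log n := Real.log_natCast_nonneg n
    refine (h.phaseOneGuarantee (by omega) hδ hl (by positivity) hraw ?_).mono ?_
    · refine hτ.trans (le_of_eq ?_)
      rw [hm, inv_div]
      exact (mul_div_assoc _ _ _).symm
    · refine (regression_error_le_sq (by positivity) hN1 hd hf (by linarith) hδ
        (by linarith) hl).trans ?_
      have h1 : N + dx * k ≤ 2 * k * N := by nlinarith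
      calc 300 * (l ^ 2 * (N + dx * k) * (f + N * dx) / n)
          = 300 * (N + dx * k) * (l ^ 2 * (f + N * dx) / n) := by ring
        _ ≤ 300 * (2 * k * N) * (l ^ 2 * (f + N * dx) / n) :=
            mul_le_mul_of_nonneg_right (by linarith) (by positivity)
        _ = (6 * k * 100) * (N * (f + N * dx) * l ^ 2 / n) := by ring
        _ ≤ (8 * k * R ^ 4) * (N * (f + N * dx) * l ^ 2 / n) :=
            mul_le_mul_of_nonneg_right (mul_le_mul (by linarith) hR4 (by norm_num) (by linarith))
              (by positivity)
  · -- the required error is larger than the trivial one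
    refine h.phaseOneGuarantee_of_envelope_le hδ.le ?_
    calc 8 * (dx * k) = 8 * k * (dx * n / n) := by field_simp
      _ ≤ 8 * k * (R ^ 4 * (N * (f + N * dx) * l ^ 2) / n) := by gcongr
      _ = _ := by ring

end SampleSize

end RichLQR

theorem theorem2 :
    ∃ (c : ℝ) (P Q : MvPolynomial (Fin 6) ℝ), 8 ≤ c ∧
      ∀ (dx du : ℕ) (Y : Type*) [MeasurableSpace Y] (S : RichLQR.System dx du Y)
        (p : RichLQR.Params) (fstar : Y → RichLQR.Vec dx) (F : Finset (Y → RichLQR.Vec dx)),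
        RichLQR.Assumptions S p fstar F →
        ∀ (n : ℕ) (δ : ℝ), 0 < n → 0 < δ → δ < 1 →
          -- explicit sample size condition and explicit bound
          (√(RichLQR.epsSq c du p F n δ) * √(dx * RichLQR.cConc p) ≤
              (1 - p.gamma) * RichLQR.sigmaC S p ^ 2 / (71 * p.alpha ^ 2 * p.Psi ^ 2) →
            RichLQR.PhaseOneGuarantee S p fstar F n δ (RichLQR.epsSq c du p F n δ)) ∧
          -- the polynomial form
          (RichLQR.polyAt P S p * (dx * du * p.kappa * RichLQR.complexity du p F) ≤ n →
            RichLQR.PhaseOneGuarantee S p fstar F n δ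
              (RichLQR.polyAt Q S p *
                (du * p.kappa * RichLQR.complexity du p F * Real.log (n / δ) ^ 2 / n)) ∧
            RichLQR.PhaseOneGuarantee S p fstar F n δ
              (RichLQR.polyAt Q S p *
                (du * p.kappa * RichLQR.complexity du p F * Real.log (n / δ) ^ 3 / n))) := by
  refine ⟨300, RichLQR.sizePoly, RichLQR.errorPoly, by norm_num, ?_⟩
  intro dx du Y _ S p fstar F h n δ hn hδ _
  refine ⟨h.explicit_guarantee hn hδ, fun hcond => ?_⟩
  have h2 := h.polynomial_guarantee hn hδ hcond
  refine ⟨h2, ?_⟩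
  rcases le_or_gt (1 / 3) δ with hδ3 | hδ3
  · exact RichLQR.phaseOneGuarantee_of_one_third_le hδ3 _
  refine h2.mono ?_
  have hl := RichLQR.one_le_log_div hn hδ hδ3
  have hpow : Real.log (n / δ) ^ 2 ≤ Real.log (n / δ) ^ 3 := pow_le_pow_right₀ hl (by norm_num)
  have hk := h.one_le_cConc
  have hQ : 0 ≤ RichLQR.polyAt RichLQR.errorPoly S p := by
    have h4 : 0 ≤ RichLQR.polyAt RichLQR.sizePoly S p := by
      rw [RichLQR.polyAt_sizePoly]; exact Even.pow_nonneg (by decide) _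
    rw [RichLQR.polyAt_errorPoly, RichLQR.polyAt_concPoly]
    positivity
  have hcomp : 0 ≤ RichLQR.complexity du p F := by
    have := Real.log_natCast_nonneg F.card
    unfold RichLQR.complexity
    positivity
  gcongr
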